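/- Let $c\ge 0$. A time series is a finite nonempty sequence of real numbers. The MSM distance $d(x,y)$ of two time series is the least cost of a sequence of operations that transforms $x$ into $y$, where the operations are: a move, which adds some $w\in\mathbb{R}$ to one point (cost $|w|$); a split, which replaces one point by two consecutive copies of it (cost $c$); and a merge, which replaces two consecutive equal points by one of them (cost $c$). For time series $X=(x^{(1)},\dots,x^{(k)})$ of lengths $n_1,\dots,n_k$, let $V(X)$ be the set of all values of their points, and let $N=(\max_i n_i-1)k+1$. A mean of $X$ is a time series $m$ that minimizes $D(X,m)=\sum_{i=1}^k d(x^{(i)},m)$ among all time series. For $x,x',y\in\mathbb{R}$ let $C(x,x',y)=c$ if $x'\le x\le y$ or $x'\ge x\ge y$, and $C(x,x',y)=c+\min(|x-x'|,|x-y|)$ otherwise. The $(k+2)$-dimensional table with entries $D[p,\ell,v]$, where $p=(p_1,\dots,p_k)$ with $p_i\in\{1,\dots,n_i\}$, $\ell\in\{1,\dots,N\}$ and $v\in V(X)$, is defined by the following recursion. Let $D[p,\ell,v]=+\infty$ if some $p_i=0$ or $\ell=0$, and $D[(1,\dots,1),1,v]=\sum_i|x^{(i)}_1-v|$. In all other cases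 $D[p,\ell,v]$ is the minimum of $$\min_{v'\in V(X)}\ \min_{S\subseteq[k]}\Bigl(D[p-\mathbf 1_S,\ell-1,v']+\sum_{i\in S}|x^{(i)}_{p_i}-v|+\sum_{i\notin S}C(v,x^{(i)}_{p_i},v')\Bigr)$$ and $$\min_{\emptyset\ne S\subseteq[k]}\Bigl(D[p-\mathbf 1_S,\ell,v]+\sum_{i\in S}C(x^{(i)}_{p_i},x^{(i)}_{p_i-1},v)\Bigr).$$ There are a program for a random access machine with real registers (unit-cost addition, subtraction and comparison of real numbers and of natural numbers, and indirect addressing) and a constant $K$ such that the following holds for all $k\ge1$, all $n$, all $c\ge0$ and all time series $X=(x^{(1)},\dots,x^{(k)})$ of length at most $n$: on input $X$ and $c$, the program halts after at most $K\cdot n^{k+3}2^kk^3$ steps, has then stored all entries $D[p,\ell,v]$ of the table, each in a memory cell of its own, and outputs a mean $m$ of $X$; moreover $D(X,m)=\min_{1\le\ell\le N,\ v\in V(X)}D[(n_1,\dots,n_k),\ell,v]$. In particular, the MSM-Mean problem for $k$ time series of length at most $n$ can be solved in time $O(n^{k+3}2^kk^3)$. -/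

import Mathlib

namespace MSM

/-! ### Time series and the move-split-merge distance -/

/-- A time series: a finite, nonempty sequence of real data points. -/
abbrev TimeSeries : Type := {x : List ℝ // x ≠ []}

/-- The transformation operations; positions are counted from `0`. -/
inductive Op where
  | move (i : ℕ) (w : ℝ)
  | split (i : ℕ)
  | merge (i : ℕ)

/-- The cost of one operation: `|w|` for a move by `w`, and `c` for a split or a merge. -/
def Op.cost (c : ℝ) : Op → ℝ
  | .move _ w => |w|
  | .split _ => c
  | .merge _ => c

/-- `S.Applies x y`: the operation `S` may be applied to `x`, and the result is `y`. -/
inductive Op.Applies : Op → List ℝ → List ℝ → Prop where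
  | move (l r : List ℝ) (a w : ℝ) :
      Op.Applies (.move l.length w) (l ++ a :: r) (l ++ (a + w) :: r)
  | split (l r : List ℝ) (a : ℝ) :
      Op.Applies (.split l.length) (l ++ a :: r) (l ++ a :: a :: r)
  | merge (l r : List ℝ) (a : ℝ) :
      Op.Applies (.merge l.length) (l ++ a :: a :: r) (l ++ a :: r)

/-- `Transforms S x y`: applying the operations of the sequence `S` one after the other
transforms `x` into `y`. -/
inductive Transforms : List Op → List ℝ → List ℝ → Prop where
  | nil (x : List ℝ) : Transforms [] x x
  | cons {S : Op} {T : List Op} {x y z : List ℝ} :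
      S.Applies x y → Transforms T y z → Transforms (S :: T) x z

/-- The cost of a sequence of operations. -/
noncomputable def seqCost (c : ℝ) (S : List Op) : ℝ := (S.map (Op.cost c)).sum

/-- The MSM distance: the least cost of a sequence of operations transforming `x` into `y`. -/
noncomputable def dist (c : ℝ) (x y : TimeSeries) : ℝ :=
  sInf {r : ℝ | ∃ S : List Op, Transforms S x.1 y.1 ∧ r = seqCost c S}

/-- The distance of the time series `X 0, …, X (k - 1)` to `y`. -/
noncomputable def totalDist (c : ℝ) {k : ℕ} (X : Fin k → TimeSeries) (y : TimeSeries) : ℝ :=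
  ∑ i, dist c (X i) y

/-- `m` is a mean of `X`: it minimizes the distance to `X` among all time series. -/
def IsMean (c : ℝ) {k : ℕ} (X : Fin k → TimeSeries) (m : TimeSeries) : Prop :=
  ∀ z : TimeSeries, totalDist c X m ≤ totalDist c X z

/-! ### The dynamic programming table -/

/-- The set `V(X)` of the values of all points of all time series of `X`. -/
def values {k : ℕ} (X : Fin k → TimeSeries) : Set ℝ := {v | ∃ i, v ∈ (X i).1}

/-- The maximum length of the time series of `X`. -/
def maxLength {k : ℕ} (X : Fin k → TimeSeries) : ℕ := Finset.univ.sup fun i => (X i).1.length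

/-- The `q`-th point of the `i`-th time series, where `q` is counted from `1`. -/
noncomputable def point {k : ℕ} (X : Fin k → TimeSeries) (i : Fin k) (q : ℕ) : ℝ :=
  (X i).1.getD (q - 1) 0

/-- The cost `C(x, x', y)` of a merge or split step. -/
noncomputable def stepCost (c x x' y : ℝ) : ℝ :=
  if (x' ≤ x ∧ x ≤ y) ∨ (x' ≥ x ∧ x ≥ y) then c else c + min |x - x'| |x - y|

/-- The positions `p` with those in `S` decreased by one. -/
def decr {k : ℕ} (p : Fin k → ℕ) (S : Finset (Fin k)) : Fin k → ℕ :=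
  fun i => if i ∈ S then p i - 1 else p i

theorem sum_decr_le {k : ℕ} (p : Fin k → ℕ) (S : Finset (Fin k)) :
    ∑ i, decr p S i ≤ ∑ i, p i :=
  Finset.sum_le_sum fun i _ => by unfold decr; split_ifs <;> omega

theorem sum_decr_lt {k : ℕ} (p : Fin k → ℕ) (S : Finset (Fin k)) (hS : S.Nonempty)
    (hp : ∀ i, p i ≠ 0) : ∑ i, decr p S i < ∑ i, p i := by
  obtain ⟨j, hj⟩ := hS
  refine Finset.sum_lt_sum (fun i _ => by unfold decr; split_ifs <;> omega)
    ⟨j, Finset.mem_univ j, ?_⟩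
  have := hp j
  simp only [decr, hj, if_true]
  omega

/-- The entry `D[p, ℓ, v]` of the `(k + 2)`-dimensional table. The current positions `p i` and `ℓ`
are counted from `1`, and `v` is the value of the `ℓ`-th point of the mean. In the general case the
first infimum is over the steps in which the time series in `S` move and all others split, and the
second one is over the steps in which the time series in `S` merge and all others pause. -/
noncomputable def table (c : ℝ) {k : ℕ} (X : Fin k → TimeSeries) (p : Fin k → ℕ) (ℓ : ℕ) (v : ℝ) :
    EReal :=
  open Classical in
  if _h : (∃ i, p i = 0) ∨ ℓ = 0 then ⊤
  else if (∀ i, p i = 1) ∧ ℓ = 1 then ((∑ i, |point X i 1 - v| : ℝ) : EReal)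
  else
    min
      (⨅ v' ∈ values X, ⨅ S : Finset (Fin k),
        table c X (decr p S) (ℓ - 1) v' +
          ((∑ i ∈ S, |point X i (p i) - v| +
            ∑ i ∈ Sᶜ, stepCost c v (point X i (p i)) v' : ℝ) : EReal))
      (⨅ (S : Finset (Fin k)) (_ : S.Nonempty),
        table c X (decr p S) ℓ v +
          ((∑ i ∈ S, stepCost c (point X i (p i)) (point X i (p i - 1)) v : ℝ) : EReal))
termination_by ℓ + ∑ i, p i
decreasing_by
  · have := sum_decr_le p S
    omega
  · rename_i hS
    have := sum_decr_lt p S hS fun i hi => _h (Or.inl ⟨i, hi⟩)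
    omega

/-- The index set of the table: `p i ∈ [n_i]`, `ℓ ∈ [N]` with `N = (n - 1) k + 1`, where `n` is the
maximum length, and `v ∈ V(X)`. -/
def tableIndices {k : ℕ} (X : Fin k → TimeSeries) : Set ((Fin k → ℕ) × ℕ × ℝ) :=
  {e | (∀ i, 1 ≤ e.1 i ∧ e.1 i ≤ (X i).1.length) ∧
    (1 ≤ e.2.1 ∧ e.2.1 ≤ (maxLength X - 1) * k + 1) ∧ e.2.2 ∈ values X}

/-- The least table entry at the final positions: the minimum of `D[(n_1, …, n_k), ℓ, v]` over
`ℓ ∈ [N]` and `v ∈ V(X)`. -/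
noncomputable def tableOptimum (c : ℝ) {k : ℕ} (X : Fin k → TimeSeries) : EReal :=
  ⨅ ℓ ∈ Finset.Icc 1 ((maxLength X - 1) * k + 1), ⨅ v ∈ values X,
    table c X (fun i => (X i).1.length) ℓ v

/-! ### A random access machine with real registers

The machine has registers and arrays of natural numbers, used for counting and addressing, and
registers and arrays of real numbers. A program is a fixed finite text, so it uses finitely many
registers and arrays. Real numbers can be copied, added, subtracted and compared, and there is no
conversion between the two sorts. Natural numbers can be added, subtracted and compared. Every
elementary operation has unit cost. -/

/-- The memory contents: registers `nreg`, `rreg`, and arrays `narr`, `rarr` with unboundedly many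
cells each. -/
structure Memory where
  nreg : ℕ → ℕ
  rreg : ℕ → ℝ
  narr : ℕ → ℕ → ℕ
  rarr : ℕ → ℕ → ℝ

/-- Expressions with natural number values. `get a e` is cell `e` of array `a`, and `sub` is
truncated subtraction. -/
inductive NExp where
  | lit (n : ℕ)
  | reg (x : ℕ)
  | get (a : ℕ) (e : NExp)
  | add (e₁ e₂ : NExp)
  | sub (e₁ e₂ : NExp)

/-- Expressions with real values. -/
inductive RExp where
  | zero
  | reg (x : ℕ)
  | get (a : ℕ) (e : NExp)
  | add (e₁ e₂ : RExp)
  | sub (e₁ e₂ : RExp)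

/-- Tests. -/
inductive Test where
  | nle (e₁ e₂ : NExp)
  | rle (e₁ e₂ : RExp)
  | not (b : Test)
  | and (b₁ b₂ : Test)

def NExp.eval (σ : Memory) : NExp → ℕ
  | .lit n => n
  | .reg x => σ.nreg x
  | .get a e => σ.narr a (e.eval σ)
  | .add e₁ e₂ => e₁.eval σ + e₂.eval σ
  | .sub e₁ e₂ => e₁.eval σ - e₂.eval σ

def RExp.eval (σ : Memory) : RExp → ℝ
  | .zero => 0
  | .reg x => σ.rreg x
  | .get a e => σ.rarr a (e.eval σ)
  | .add e₁ e₂ => e₁.eval σ + e₂.eval σ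
  | .sub e₁ e₂ => e₁.eval σ - e₂.eval σ

def Test.Holds (σ : Memory) : Test → Prop
  | .nle e₁ e₂ => e₁.eval σ ≤ e₂.eval σ
  | .rle e₁ e₂ => e₁.eval σ ≤ e₂.eval σ
  | .not b => ¬ b.Holds σ
  | .and b₁ b₂ => b₁.Holds σ ∧ b₂.Holds σ

/-- The number of steps for evaluating an expression: one for each of its nodes. -/
def NExp.steps : NExp → ℕ
  | .lit _ => 1
  | .reg _ => 1
  | .get _ e => e.steps + 1
  | .add e₁ e₂ => e₁.steps + e₂.steps + 1
  | .sub e₁ e₂ => e₁.steps + e₂.steps + 1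

def RExp.steps : RExp → ℕ
  | .zero => 1
  | .reg _ => 1
  | .get _ e => e.steps + 1
  | .add e₁ e₂ => e₁.steps + e₂.steps + 1
  | .sub e₁ e₂ => e₁.steps + e₂.steps + 1

def Test.steps : Test → ℕ
  | .nle e₁ e₂ => e₁.steps + e₂.steps + 1
  | .rle e₁ e₂ => e₁.steps + e₂.steps + 1
  | .not b => b.steps + 1
  | .and b₁ b₂ => b₁.steps + b₂.steps + 1

/-- Programs. `nput a i e` and `rput a i e` write the value of `e` to cell `i` of array `a`. -/
inductive Program where
  | skip
  | nset (x : ℕ) (e : NExp)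
  | rset (x : ℕ) (e : RExp)
  | nput (a : ℕ) (i : NExp) (e : NExp)
  | rput (a : ℕ) (i : NExp) (e : RExp)
  | seq (P Q : Program)
  | ite (b : Test) (P Q : Program)
  | while (b : Test) (P : Program)

/-- `Runs P σ t τ`: started with memory `σ`, the program `P` halts after exactly `t` steps with
memory `τ`. -/
inductive Runs : Program → Memory → ℕ → Memory → Prop where
  | skip (σ : Memory) : Runs .skip σ 1 σ
  | nset (x : ℕ) (e : NExp) (σ : Memory) :
      Runs (.nset x e) σ (e.steps + 1)
        { σ with nreg := Function.update σ.nreg x (e.eval σ) }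
  | rset (x : ℕ) (e : RExp) (σ : Memory) :
      Runs (.rset x e) σ (e.steps + 1)
        { σ with rreg := Function.update σ.rreg x (e.eval σ) }
  | nput (a : ℕ) (i e : NExp) (σ : Memory) :
      Runs (.nput a i e) σ (i.steps + e.steps + 1)
        { σ with narr :=
            Function.update σ.narr a (Function.update (σ.narr a) (i.eval σ) (e.eval σ)) }
  | rput (a : ℕ) (i : NExp) (e : RExp) (σ : Memory) :
      Runs (.rput a i e) σ (i.steps + e.steps + 1)
        { σ with rarr :=
            Function.update σ.rarr a (Function.update (σ.rarr a) (i.eval σ) (e.eval σ)) }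
  | seq {P Q : Program} {σ τ υ : Memory} {s t : ℕ} :
      Runs P σ s τ → Runs Q τ t υ → Runs (.seq P Q) σ (s + t) υ
  | ite_true {b : Test} {P : Program} (Q : Program) {σ τ : Memory} {t : ℕ} :
      b.Holds σ → Runs P σ t τ → Runs (.ite b P Q) σ (b.steps + 1 + t) τ
  | ite_false {b : Test} (P : Program) {Q : Program} {σ τ : Memory} {t : ℕ} :
      ¬ b.Holds σ → Runs Q σ t τ → Runs (.ite b P Q) σ (b.steps + 1 + t) τ
  | while_false {b : Test} (P : Program) {σ : Memory} :
      ¬ b.Holds σ → Runs (.while b P) σ (b.steps + 1) σ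
  | while_true {b : Test} {P : Program} {σ τ υ : Memory} {s t : ℕ} :
      b.Holds σ → Runs P σ s τ → Runs (.while b P) τ t υ →
        Runs (.while b P) σ (b.steps + 1 + s + t) υ

/-- The initial memory for the input `X`, `c`: natural register `0` holds `k`, natural array `0`
holds the lengths `n_1, …, n_k`, real register `0` holds `c`, and real array `0` holds the points of
the time series, one time series after the other. Everything else is `0`. -/
noncomputable def input (c : ℝ) {k : ℕ} (X : Fin k → TimeSeries) : Memory where
  nreg x := if x = 0 then k else 0
  rreg x := if x = 0 then c else 0
  narr a i := if a = 0 then (List.ofFn fun j => (X j).1.length).getD i 0 else 0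
  rarr a i := if a = 0 then (List.ofFn fun j => (X j).1).flatten.getD i 0 else 0

/-- The output sequence: its length is in natural register `1`, its points are in real array `1`. -/
def output (τ : Memory) : List ℝ := (List.range (τ.nreg 1)).map (τ.rarr 1)

/-- Real array `2` holds the whole table, each entry in a cell of its own. -/
def HoldsTable (c : ℝ) {k : ℕ} (X : Fin k → TimeSeries) (τ : Memory) : Prop :=
  ∃ addr : (Fin k → ℕ) × ℕ × ℝ → ℕ, Set.InjOn addr (tableIndices X) ∧
    ∀ e ∈ tableIndices X, ((τ.rarr 2 (addr e) : ℝ) : EReal) = table c X e.1 e.2.1 e.2.2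

end MSM

/-! Operation sequences are replaced by alignments. Read from the end, an alignment of a series with
the mean consists of diagonal steps (a new point in both), merges (a new point in the series only)
and splits (a new point in the mean only). The distance is the infimum of alignment costs: each step
is simulated by operations (`Align.reach`), and undoing the operations of a sequence one by one,
starting from the trivial alignment, raises the cost by at most the price of each (`Align.of_step`).
As `stepCost` is `c` plus the distance to an interval, all estimates become inequalities for `gap`.

Two facts make the search finite. Length: a point of the mean at which every series splits can be
deleted, so each point but the first consumes a point of some series by a diagonal step
(`NormalAlign.exists_shorter`); this gives the bound `N`. Values: a value of the mean outside `V(X)`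
can be rounded at random to its two neighbours so that its expectation is preserved. Monotone
roundings act linearly on `gap`, so the expected cost does not increase, and one of the two outcomes
is no worse (`Align.exists_values`).

The last steps of an alignment family are exactly the cases of the recursion. Hence the least final
entry is at most every total distance (`tableOptimum_le`). Conversely, the chain of predecessors of
an entry is an alignment family with that cost (`Realizes`), so the traceback outputs a series
attaining the lower bound (`Realizes.isMean`).

The program stores the entries at mixed radix addresses whose lowest digits are the index of the
mean value and the length. Every predecessor then has a smaller address, so increasing addresses are
a valid order of evaluation (`entry_eq_of_best`). There are at most `n ^ (k + 2) * k ^ 2` addresses.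
Each one inspects at most `n * k` previous values with at most `2 ^ k` subsets, and the costs of all
subsets are listed by doubling in time `O(2 ^ k)`, which saves a factor `k` (`ends_listSubsets`). -/

namespace MSM

/-! ### The gap function -/

/-- The distance of `x` to the closed interval spanned by `x'` and `y`. -/
noncomputable def gap (x x' y : ℝ) : ℝ := max 0 (max (x - max x' y) (min x' y - x))

/-- Outside the interval, its nearest point is whichever of `x'` and `y` is closer to `x`. With this
form, cost comparisons become piecewise linear inequalities in which the constants `c` can be
counted separately. -/
theorem stepCost_eq_gap (c x x' y : ℝ) : stepCost c x x' y = c + gap x x' y := by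
  unfold stepCost gap
  grind

theorem gap_nonneg (x x' y : ℝ) : 0 ≤ gap x x' y := le_max_left _ _

theorem gap_comm (x x' y : ℝ) : gap x x' y = gap x y x' := by
  unfold gap
  rw [max_comm x' y, min_comm x' y]

theorem gap_self_left (x y : ℝ) : gap x x y = 0 := by
  unfold gap
  grind

theorem gap_self_right (x y : ℝ) : gap x y x = 0 := by
  rw [gap_comm, gap_self_left]

theorem gap_le_abs_left (x x' y : ℝ) : gap x x' y ≤ |x - x'| := by
  unfold gap
  grind

/-- The distance to the interval of `x` and `b` is 1-Lipschitz and convex and vanishes at `x`, so on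
the interval of `x` and `a` it is at most its value at `a`. -/
theorem gap_triangle (e x a b : ℝ) : gap e x b ≤ gap a x b + gap e x a := by
  unfold gap
  grind

/-- The point of the interval of `a'` and `m` nearest to `a` is within `|a' - m|` of `m`. -/
theorem abs_sub_le_add_gap (a a' m : ℝ) : |a - m| ≤ |a' - m| + gap a a' m := by
  unfold gap
  grind

/-- For a split from `m` to `m'` at a point `a'` that is changed to `a`: correcting the alignment
before the split and then splitting at `a` is paid for by the old split and a correction after it.
-/
theorem gap_exchange_up (a a' m m' : ℝ) :
    gap a a' m + gap m' a m ≤ gap m' a' m + gap a a' m' := by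
  unfold gap
  grind

/-- For a point `x` merged into `a'` under the mean value `m`, when `a'` is changed to `a`: the full
price `|a - a'|` also covers the change of the merge cost. -/
theorem gap_exchange_right (a a' m x : ℝ) :
    gap a a' m + gap x a m ≤ gap x a' m + |a - a'| := by
  unfold gap
  grind

/-- The right-hand side prices a split from `b` to `a` at `x`, followed by a merge of `y` into `x`,
without the two constants. Either aligning `y` with `a` directly is no dearer, or merging before
splitting is. -/
theorem min_le_gap_add_gap (x y a b : ℝ) :
    |y - a| ≤ gap a x b + gap y x a ∨
      gap y x b + gap a y b ≤ gap a x b + gap y x a := by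
  unfold gap
  grind

end MSM

namespace MSM

/-! ### Operations on reversed time series

Lists are read backwards from here on: the head of a list is the last point of the time series. -/

/-- One operation on reversed time series, with its cost. -/
inductive Step (c : ℝ) : List ℝ → List ℝ → ℝ → Prop where
  | move (l : List ℝ) (a b : ℝ) (r : List ℝ) : Step c (l ++ a :: r) (l ++ b :: r) |b - a|
  | split (l : List ℝ) (a : ℝ) (r : List ℝ) : Step c (l ++ a :: r) (l ++ a :: a :: r) c
  | merge (l : List ℝ) (a : ℝ) (r : List ℝ) : Step c (l ++ a :: a :: r) (l ++ a :: r) c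

/-- A sequence of operations on reversed time series, with its total cost. -/
inductive Reach (c : ℝ) : List ℝ → List ℝ → ℝ → Prop where
  | refl (u : List ℝ) : Reach c u u 0
  | step {u v z : List ℝ} {w s : ℝ} : Step c u v w → Reach c v z s → Reach c u z (w + s)

variable {c : ℝ}

theorem Step.symm {u v : List ℝ} {w : ℝ} (h : Step c u v w) : Step c v u w := by
  cases h with
  | move l a b r => rw [abs_sub_comm]; exact .move l b a r
  | split l a r => exact .merge l a r
  | merge l a r => exact .split l a r

theorem Step.cons (x : ℝ) {u v : List ℝ} {w : ℝ} (h : Step c u v w) :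
    Step c (x :: u) (x :: v) w := by
  cases h with
  | move l a b r => exact .move (x :: l) a b r
  | split l a r => exact .split (x :: l) a r
  | merge l a r => exact .merge (x :: l) a r

theorem Step.exists_applies {u v : List ℝ} {w : ℝ} (h : Step c u v w) :
    ∃ S : Op, S.Applies u.reverse v.reverse ∧ S.cost c = w := by
  cases h with
  | move l a b r =>
    refine ⟨.move r.reverse.length (b - a), ?_, rfl⟩
    simpa using Op.Applies.move r.reverse l.reverse a (b - a)
  | split l a r =>
    refine ⟨.split r.reverse.length, ?_, rfl⟩
    simpa using Op.Applies.split r.reverse l.reverse a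
  | merge l a r =>
    refine ⟨.merge r.reverse.length, ?_, rfl⟩
    simpa using Op.Applies.merge r.reverse l.reverse a

theorem Op.Applies.step {S : Op} {x y : List ℝ} (h : S.Applies x y) :
    Step c x.reverse y.reverse (S.cost c) := by
  cases h with
  | move l r a w => simpa [Op.cost] using Step.move (c := c) r.reverse a (a + w) l.reverse
  | split l r a => simpa [Op.cost] using Step.split (c := c) r.reverse a l.reverse
  | merge l r a => simpa [Op.cost] using Step.merge (c := c) r.reverse a l.reverse

theorem Reach.exists_transforms {u v : List ℝ} {s : ℝ} (h : Reach c u v s) :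
    ∃ S : List Op, Transforms S u.reverse v.reverse ∧ s = seqCost c S := by
  induction h with
  | refl u => exact ⟨[], .nil _, by simp [seqCost]⟩
  | step h _ ih =>
    obtain ⟨S, hS, rfl⟩ := ih
    obtain ⟨O, hO, rfl⟩ := h.exists_applies
    exact ⟨O :: S, .cons hO hS, by simp [seqCost]⟩

theorem Reach.single {u v : List ℝ} {w : ℝ} (h : Step c u v w) : Reach c u v w := by
  simpa using Reach.step h (.refl v)

theorem Reach.trans {u v z : List ℝ} {s t : ℝ} (h : Reach c u v s) (h' : Reach c v z t) :
    Reach c u z (s + t) := by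
  induction h with
  | refl u => simpa using h'
  | step h _ ih => rw [add_assoc]; exact .step h (ih h')

theorem Reach.symm {u v : List ℝ} {s : ℝ} (h : Reach c u v s) : Reach c v u s := by
  induction h with
  | refl u => exact .refl u
  | step h _ ih => rw [add_comm]; exact ih.trans (.single h.symm)

theorem Reach.cons (x : ℝ) {u v : List ℝ} {s : ℝ} (h : Reach c u v s) :
    Reach c (x :: u) (x :: v) s := by
  induction h with
  | refl u => exact .refl _
  | step h _ ih => exact .step (h.cons x) ih

/-- If the head moves past `x`, then a new head `x` can be absorbed at the price of one merge. -/
theorem Reach.absorb {u v : List ℝ} {s : ℝ} (h : Reach c u v s) (x : ℝ) :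
    ∀ {a b : ℝ} {u' v' : List ℝ}, u = a :: u' → v = b :: v' →
      (a ≤ x ∧ x ≤ b) ∨ (b ≤ x ∧ x ≤ a) → Reach c (x :: u) v (s + c) := by
  induction h with
  | refl u =>
    rintro a b u' v' rfl h hx
    obtain ⟨rfl, rfl⟩ := List.cons.inj h
    obtain rfl : x = a := by rcases hx with hx | hx <;> linarith [hx.1, hx.2]
    rw [zero_add]
    exact .single (.merge [] x u')
  | @step u v z w s h h' ih =>
    intro a b u' v' hu hz hx
    have key : ∀ {v₁}, v = a :: v₁ → Reach c (x :: u) z (w + s + c) := fun hv => by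
      rw [add_assoc]
      exact .step (h.cons x) (ih hv hz hx)
    cases h with
    | move l a₀ b₀ r =>
      rcases l with _ | ⟨e, l⟩
      · simp only [List.nil_append, List.cons.injEq] at hu key ih ⊢
        obtain ⟨rfl, rfl⟩ := hu
        by_cases hb : (b₀ ≤ x ∧ x ≤ b) ∨ (b ≤ x ∧ x ≤ b₀)
        · rw [add_assoc]
          exact .step (.move [x] a₀ b₀ r) (ih ⟨rfl, rfl⟩ hz hb)
        -- Here the head passes `x` during this very move. The move is interrupted at `x`, the two
        -- equal points are merged there, and the move is resumed at no extra cost.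
        · have e : |b₀ - a₀| + s + c = |x - a₀| + (c + (|b₀ - x| + s)) := by
            have : |b₀ - a₀| = |x - a₀| + |b₀ - x| := by grind
            linarith
          rw [e]
          exact .step (.move [x] a₀ x r) (.step (.merge [] x r) (.step (.move [] x b₀ r) h'))
      · simp only [List.cons_append, List.cons.injEq] at hu
        exact key (by rw [List.cons_append, hu.1])
    | split l a₀ r =>
      rcases l with _ | ⟨e, l⟩
      · obtain ⟨rfl, rfl⟩ := List.cons.inj hu
        exact key rfl
      · simp only [List.cons_append, List.cons.injEq] at hu
        exact key (by rw [List.cons_append, hu.1])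
    | merge l a₀ r =>
      rcases l with _ | ⟨e, l⟩
      · obtain ⟨rfl, rfl⟩ := List.cons.inj hu
        exact key rfl
      · simp only [List.cons_append, List.cons.injEq] at hu
        exact key (by rw [List.cons_append, hu.1])

/-- If `x` lies between `x'` and `y`, the head meets `x` on its way and absorbs it. Otherwise `x` is
moved to the nearer of the two, and merged with `x'` before the other operations or with `y` after
them. -/
theorem Reach.merge {x x' y : ℝ} {xs ys : List ℝ} {s : ℝ}
    (h : Reach c (x' :: xs) (y :: ys) s) :
    Reach c (x :: x' :: xs) (y :: ys) (s + stepCost c x x' y) := by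
  unfold stepCost
  split_ifs with hx
  · exact h.absorb x rfl rfl (hx.imp_right And.symm)
  · rcases le_total |x - x'| |x - y| with hm | hm
    · rw [min_eq_left hm, abs_sub_comm,
        show s + (c + |x' - x|) = |x' - x| + (c + s) by ring]
      exact .step (.move [] x x' _) (.step (.merge [] x' xs) h)
    · rw [min_eq_right hm, abs_sub_comm,
        show s + (c + |y - x|) = s + (|y - x| + c) by ring]
      exact (h.cons x).trans (.step (.move [] x y _) (.single (.merge [] y ys)))

/-! ### Alignments -/

/-- `Align c x y r`: there is a monotone alignment of the reversed time series `x` and `y`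
of cost `r`. -/
inductive Align (c : ℝ) : List ℝ → List ℝ → ℝ → Prop where
  | base (x y : ℝ) : Align c [x] [y] |x - y|
  | diag {xs ys : List ℝ} {r : ℝ} (x y : ℝ) :
      Align c xs ys r → Align c (x :: xs) (y :: ys) (r + |x - y|)
  | right {x' y : ℝ} {xs ys : List ℝ} {r : ℝ} (x : ℝ) :
      Align c (x' :: xs) (y :: ys) r → Align c (x :: x' :: xs) (y :: ys) (r + stepCost c x x' y)
  | up {x y' : ℝ} {xs ys : List ℝ} {r : ℝ} (y : ℝ) :
      Align c (x :: xs) (y' :: ys) r → Align c (x :: xs) (y :: y' :: ys) (r + stepCost c y x y')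

/-- Only `right` needs an argument, namely `Reach.merge`; a split is a merge read in the reverse
direction, since every operation can be reversed at equal cost. -/
theorem Align.reach {x y : List ℝ} {r : ℝ} (h : Align c x y r) : Reach c x y r := by
  induction h with
  | base x y => rw [abs_sub_comm]; exact .single (.move [] x y [])
  | @diag xs ys r x y _ ih =>
    rw [abs_sub_comm]
    exact (ih.cons x).trans (.single (.move [] x y ys))
  | right x _ ih => exact ih.merge
  | @up x y' xs ys r y _ ih =>
    have : stepCost c y x y' = stepCost c y y' x := by
      rw [stepCost_eq_gap, stepCost_eq_gap, gap_comm]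
    rw [this]
    exact ih.symm.merge.symm

theorem Align.ne_nil_left {x y : List ℝ} {r : ℝ} (h : Align c x y r) : x ≠ [] := by
  cases h <;> simp

theorem Align.ne_nil_right {x y : List ℝ} {r : ℝ} (h : Align c x y r) : y ≠ [] := by
  cases h <;> simp

theorem Align.refl : ∀ {x : List ℝ}, x ≠ [] → Align c x x 0
  | [a], _ => by simpa using Align.base (c := c) a a
  | a :: b :: x, _ => by
    simpa using Align.diag a a (Align.refl (x := b :: x) (by simp))

theorem exists_align {x y : List ℝ} (hx : x ≠ []) (hy : y ≠ []) : ∃ r, Align c x y r := by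
  obtain ⟨b, ys, rfl⟩ := List.exists_cons_of_ne_nil hy
  induction x with
  | nil => exact absurd rfl hx
  | cons a xs ih =>
    rcases xs with _ | ⟨a', xs⟩
    · clear ih hy
      induction ys generalizing b with
      | nil => exact ⟨_, .base a b⟩
      | cons b' ys ih => obtain ⟨r, hr⟩ := ih b'; exact ⟨_, .up b hr⟩
    · obtain ⟨r, hr⟩ := ih (by simp)
      exact ⟨_, .right a hr⟩

/-! ### Alignments under a single operation -/

/-- The bound `|a - a'|` alone does not survive the induction: when the changed point is the head, a
later merge or split also changes its cost. The sharper bound by `gap` at the head leaves exactly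
the room that `gap_exchange_right` and `gap_exchange_up` require. -/
theorem Align.move {x' y : List ℝ} {s : ℝ} (h : Align c x' y s) :
    ∀ {l : List ℝ} {a a' : ℝ} {r : List ℝ}, x' = l ++ a' :: r →
      ∃ s', Align c (l ++ a :: r) y s' ∧ s' ≤ s + |a - a'| ∧
        (l = [] → ∀ m ys, y = m :: ys → s' ≤ s + gap a a' m) := by
  induction h with
  | base x y =>
    intro l a a' r hl
    rcases l with _ | ⟨b, l⟩
    · simp only [List.nil_append, List.cons.injEq] at hl ⊢
      obtain ⟨rfl, rfl⟩ := hl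
      refine ⟨_, .base a y, by have := abs_sub_le a x y; linarith, ?_⟩
      rintro - m ys ⟨rfl, rfl⟩
      exact abs_sub_le_add_gap a x y
    · simp at hl
  | @diag xs ys r₀ x y h ih =>
    intro l a a' r hl
    rcases l with _ | ⟨b, l⟩
    · simp only [List.nil_append, List.cons.injEq] at hl ⊢
      obtain ⟨rfl, rfl⟩ := hl
      refine ⟨_, .diag a y h, by have := abs_sub_le a x y; linarith, ?_⟩
      rintro - m ys ⟨rfl, rfl⟩
      linarith [abs_sub_le_add_gap a x y]
    · simp only [List.cons_append, List.cons.injEq] at hl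
      obtain ⟨rfl, rfl⟩ := hl
      obtain ⟨s', h', hs, -⟩ := ih (a := a) rfl
      exact ⟨_, .diag x y h', by linarith, by simp⟩
  | @right x₁ y xs ys r₀ x h ih =>
    intro l a a' r hl
    rcases l with _ | ⟨b, l⟩
    · simp only [List.nil_append, List.cons.injEq] at hl ⊢
      obtain ⟨rfl, rfl⟩ := hl
      have h1 := gap_triangle a y x x₁
      rw [gap_comm a y x₁, gap_comm x y x₁, gap_comm a y x] at h1
      have h3 := gap_le_abs_left a x y
      refine ⟨_, .right a h, ?_, ?_⟩
      · rw [stepCost_eq_gap, stepCost_eq_gap]; linarith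
      · rintro - m ys ⟨rfl, rfl⟩
        rw [stepCost_eq_gap, stepCost_eq_gap]; linarith
    · simp only [List.cons_append, List.cons.injEq] at hl
      obtain ⟨rfl, hl⟩ := hl
      obtain ⟨s', h', hs, hs'⟩ := ih (a := a) hl
      rcases l with _ | ⟨b, l⟩
      · simp only [List.nil_append, List.cons.injEq] at hl h' ⊢
        obtain ⟨rfl, rfl⟩ := hl
        refine ⟨_, .right x h', ?_, by simp⟩
        have := hs' rfl y ys rfl
        have := gap_exchange_right a x₁ y x
        rw [stepCost_eq_gap, stepCost_eq_gap]; linarith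
      · simp only [List.cons_append, List.cons.injEq] at hl h' ⊢
        obtain ⟨rfl, rfl⟩ := hl
        exact ⟨_, .right x h', by linarith, by simp⟩
  | @up x y' xs ys r₀ y h ih =>
    intro l a a' r hl
    obtain ⟨s', h', hs, hs'⟩ := ih (a := a) hl
    rcases l with _ | ⟨b, l⟩
    · simp only [List.nil_append, List.cons.injEq] at hl h' ⊢
      obtain ⟨rfl, rfl⟩ := hl
      have h1 := hs' rfl y' ys rfl
      have h2 := gap_exchange_up a x y' y
      have h3 := gap_le_abs_left a x y
      refine ⟨_, .up y h', ?_, ?_⟩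
      · rw [stepCost_eq_gap, stepCost_eq_gap]; linarith
      · rintro - m ys ⟨rfl, rfl⟩
        rw [stepCost_eq_gap, stepCost_eq_gap]; linarith
    · simp only [List.cons_append, List.cons.injEq] at hl h' ⊢
      obtain ⟨rfl, rfl⟩ := hl
      exact ⟨_, .up y h', by linarith, by simp⟩

theorem Align.duplicate {x' y : List ℝ} {s : ℝ} (h : Align c x' y s) :
    ∀ {l : List ℝ} {a : ℝ} {r : List ℝ}, x' = l ++ a :: r →
      Align c (l ++ a :: a :: r) y (s + c) := by
  have key : ∀ {a : ℝ} {r y : List ℝ} {s : ℝ}, Align c (a :: r) y s →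
      Align c (a :: a :: r) y (s + c) := fun {a r y s} h => by
    obtain ⟨b, ys, rfl⟩ := List.exists_cons_of_ne_nil h.ne_nil_right
    simpa [stepCost_eq_gap, gap_self_left] using Align.right a h
  induction h with
  | base x y =>
    rintro (_ | ⟨b, l⟩) a r hl
    · simp only [List.nil_append, List.cons.injEq] at hl ⊢
      obtain ⟨rfl, rfl⟩ := hl
      exact key (.base x y)
    · simp at hl
  | diag x y h ih =>
    rintro (_ | ⟨b, l⟩) a r hl
    · simp only [List.nil_append, List.cons.injEq] at hl ⊢
      obtain ⟨rfl, rfl⟩ := hl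
      exact key (.diag x y h)
    · simp only [List.cons_append, List.cons.injEq] at hl ⊢
      obtain ⟨rfl, rfl⟩ := hl
      rw [add_right_comm]
      exact .diag x y (ih rfl)
  | right x h ih =>
    rintro (_ | ⟨b, l⟩) a r hl
    · simp only [List.nil_append, List.cons.injEq] at hl ⊢
      obtain ⟨rfl, rfl⟩ := hl
      exact key (.right x h)
    · simp only [List.cons_append, List.cons.injEq] at hl ⊢
      obtain ⟨rfl, hl⟩ := hl
      have := ih hl
      rw [add_right_comm]
      rcases l with _ | ⟨b, l⟩ <;>
      · simp only [List.nil_append, List.cons_append, List.cons.injEq] at hl this ⊢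
        obtain ⟨rfl, rfl⟩ := hl
        exact .right x this
  | up y h ih =>
    intro l a r hl
    have := ih hl
    rw [add_right_comm]
    rcases l with _ | ⟨b, l⟩ <;>
    · simp only [List.nil_append, List.cons_append, List.cons.injEq] at hl this ⊢
      obtain ⟨rfl, rfl⟩ := hl
      exact .up y this

theorem Align.dedup (hc : 0 ≤ c) {x' y : List ℝ} {s : ℝ} (h : Align c x' y s) :
    ∀ {l : List ℝ} {a : ℝ} {r : List ℝ}, x' = l ++ a :: a :: r →
      ∃ s', Align c (l ++ a :: r) y s' ∧ s' ≤ s + c := by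
  induction h with
  | base x y => rintro (_ | ⟨b, l⟩) a r hl <;> simp at hl
  | diag x y h ih =>
    rintro (_ | ⟨b, l⟩) a r hl
    · simp only [List.nil_append, List.cons.injEq] at hl ⊢
      obtain ⟨rfl, rfl⟩ := hl
      obtain ⟨b, ys, rfl⟩ := List.exists_cons_of_ne_nil h.ne_nil_right
      -- The last copy was aligned diagonally with `y`. Without it the other copy, already aligned
      -- with `b`, splits to reach `y`; the excess over `c` is at most the old diagonal cost.
      refine ⟨_, .up y h, ?_⟩
      have := gap_le_abs_left y x b
      rw [abs_sub_comm] at this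
      rw [stepCost_eq_gap]; linarith
    · simp only [List.cons_append, List.cons.injEq] at hl ⊢
      obtain ⟨rfl, rfl⟩ := hl
      obtain ⟨s', h', hs⟩ := ih rfl
      exact ⟨_, .diag x y h', by linarith⟩
  | @right x' y xs ys r x h ih =>
    rintro (_ | ⟨b, l⟩) a r hl
    · simp only [List.nil_append, List.cons.injEq] at hl ⊢
      obtain ⟨rfl, rfl, rfl⟩ := hl
      have := gap_nonneg x' x' y
      exact ⟨_, h, by rw [stepCost_eq_gap]; linarith⟩
    · simp only [List.cons_append, List.cons.injEq] at hl ⊢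
      obtain ⟨rfl, hl⟩ := hl
      obtain ⟨s', h', hs⟩ := ih hl
      rcases l with _ | ⟨b, l⟩ <;>
      · simp only [List.nil_append, List.cons_append, List.cons.injEq] at hl h' ⊢
        obtain ⟨rfl, rfl⟩ := hl
        exact ⟨_, .right x h', by linarith⟩
  | up y h ih =>
    intro l a r hl
    obtain ⟨s', h', hs⟩ := ih hl
    rcases l with _ | ⟨b, l⟩ <;>
    · simp only [List.nil_append, List.cons_append, List.cons.injEq] at hl h' ⊢
      obtain ⟨rfl, rfl⟩ := hl
      exact ⟨_, .up y h', by linarith⟩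

theorem Align.of_step (hc : 0 ≤ c) {x x' y : List ℝ} {w s : ℝ} (h : Step c x x' w)
    (h' : Align c x' y s) : ∃ s', Align c x y s' ∧ s' ≤ w + s := by
  cases h with
  | move l a b r =>
    obtain ⟨s', h₁, hs, -⟩ := h'.move (a := a) rfl
    exact ⟨s', h₁, by rw [abs_sub_comm]; linarith⟩
  | split l a r =>
    obtain ⟨s', h₁, hs⟩ := h'.dedup hc rfl
    exact ⟨s', h₁, by linarith⟩
  | merge l a r => exact ⟨_, h'.duplicate rfl, by linarith⟩

/-! ### The distance as an infimum over alignments -/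

/-- Induction from the end of the sequence: `y` is aligned with itself at cost `0`, and each
operation is undone by `Align.of_step`. -/
theorem Transforms.exists_align (hc : 0 ≤ c) {S : List Op} {x y : List ℝ} (h : Transforms S x y)
    (hy : y ≠ []) : ∃ s, Align c x.reverse y.reverse s ∧ s ≤ seqCost c S := by
  induction h with
  | nil x => exact ⟨0, .refl (by simpa using hy), by simp [seqCost]⟩
  | cons h _ ih =>
    obtain ⟨s, h', hs⟩ := ih hy
    obtain ⟨s', h'', hs'⟩ := Align.of_step hc h.step h'
    refine ⟨s', h'', ?_⟩
    simp only [seqCost, List.map_cons, List.sum_cons] at hs ⊢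
    linarith

theorem seqCost_nonneg (hc : 0 ≤ c) (S : List Op) : 0 ≤ seqCost c S := by
  refine List.sum_nonneg fun r hr => ?_
  obtain ⟨O, -, rfl⟩ := List.mem_map.1 hr
  cases O <;> simp [Op.cost, hc]

theorem dist_le_of_align (hc : 0 ≤ c) {x y : TimeSeries} {r : ℝ}
    (h : Align c x.1.reverse y.1.reverse r) : dist c x y ≤ r := by
  refine csInf_le ⟨0, ?_⟩ ?_
  · rintro _ ⟨S, -, rfl⟩
    exact seqCost_nonneg hc S
  · simpa using h.reach.exists_transforms

/-- Attainment of the infimum is never needed; near-optimal alignments suffice for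
`tableOptimum_le`. -/
theorem exists_align_lt (hc : 0 ≤ c) (x y : TimeSeries) {ε : ℝ} (hε : 0 < ε) :
    ∃ r, Align c x.1.reverse y.1.reverse r ∧ r < dist c x y + ε := by
  obtain ⟨r₀, h₀⟩ := MSM.exists_align (c := c) (x := x.1.reverse) (y := y.1.reverse)
    (by simpa using x.2) (by simpa using y.2)
  obtain ⟨_, ⟨S, hS, rfl⟩, hlt⟩ := exists_lt_of_csInf_lt
    (⟨r₀, by simpa using h₀.reach.exists_transforms⟩ :
      {r : ℝ | ∃ S : List Op, Transforms S x.1 y.1 ∧ r = seqCost c S}.Nonempty)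
    (lt_add_of_pos_right (dist c x y) hε)
  obtain ⟨s, h, hs⟩ := hS.exists_align hc y.2
  exact ⟨s, h, hs.trans_lt hlt⟩

end MSM

namespace MSM

variable {c : ℝ}

/-! ### Shortening the mean -/

/-- Alignments in which no point of `x` is merged immediately after a split. The flag tells
whether the last step is a split. -/
inductive NormalAlign (c : ℝ) : Bool → List ℝ → List ℝ → ℝ → Prop where
  | base (x y : ℝ) : NormalAlign c false [x] [y] |x - y|
  | diag {b : Bool} {xs ys : List ℝ} {r : ℝ} (x y : ℝ) :
      NormalAlign c b xs ys r → NormalAlign c false (x :: xs) (y :: ys) (r + |x - y|)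
  | right {x' y : ℝ} {xs ys : List ℝ} {r : ℝ} (x : ℝ) :
      NormalAlign c false (x' :: xs) (y :: ys) r →
        NormalAlign c false (x :: x' :: xs) (y :: ys) (r + stepCost c x x' y)
  | up {b : Bool} {x y' : ℝ} {xs ys : List ℝ} {r : ℝ} (y : ℝ) :
      NormalAlign c b (x :: xs) (y' :: ys) r →
        NormalAlign c true (x :: xs) (y :: y' :: ys) (r + stepCost c y x y')

theorem NormalAlign.ne_nil_left {b : Bool} {x y : List ℝ} {r : ℝ} (h : NormalAlign c b x y r) :
    x ≠ [] := by
  cases h <;> simp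

theorem NormalAlign.ne_nil_right {b : Bool} {x y : List ℝ} {r : ℝ} (h : NormalAlign c b x y r) :
    y ≠ [] := by
  cases h <;> simp

/-- A merge after a split is either contracted with it to one diagonal step, which also saves `2 *
c`, or pushed below the split by `min_le_gap_add_gap`, and the recursion continues on the shorter
mean. -/
theorem NormalAlign.exists_right (hc : 0 ≤ c) (x : ℝ) {x' : ℝ} {xs : List ℝ} :
    ∀ {ys : List ℝ} {b : Bool} {y r : ℝ}, NormalAlign c b (x' :: xs) (y :: ys) r →
      ∃ b' r', NormalAlign c b' (x :: x' :: xs) (y :: ys) r' ∧ r' ≤ r + stepCost c x x' y := by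
  intro ys
  induction ys with
  | nil =>
    intro b y r h
    cases b with
    | false => exact ⟨_, _, .right x h, le_rfl⟩
    | true => cases h
  | cons y' ys ih =>
    intro b y r h
    cases b with
    | false => exact ⟨_, _, .right x h, le_rfl⟩
    | true =>
      cases h with
      | up _ h =>
        rcases min_le_gap_add_gap x' x y y' with hd | hr
        · exact ⟨_, _, .diag x y h, by rw [stepCost_eq_gap, stepCost_eq_gap]; linarith⟩
        · obtain ⟨b', r', h', hr'⟩ := ih h
          refine ⟨_, _, .up y h', ?_⟩
          simp only [stepCost_eq_gap] at hr' ⊢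
          linarith

theorem Align.exists_normalAlign (hc : 0 ≤ c) {x y : List ℝ} {r : ℝ} (h : Align c x y r) :
    ∃ b r', NormalAlign c b x y r' ∧ r' ≤ r := by
  induction h with
  | base x y => exact ⟨_, _, .base x y, le_rfl⟩
  | diag x y _ ih =>
    obtain ⟨b, r', h, hr⟩ := ih
    exact ⟨_, _, .diag x y h, by linarith⟩
  | right x _ ih =>
    obtain ⟨b, r', h, hr⟩ := ih
    obtain ⟨b', r'', h', hr'⟩ := h.exists_right hc x
    exact ⟨_, _, h', by linarith⟩
  | up y _ ih =>
    obtain ⟨b, r', h, hr⟩ := ih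
    exact ⟨_, _, .up y h, by linarith⟩

/-- The mean is processed from its last point. If all series split there, the point is dropped;
otherwise it is kept, and unless it is the first point, some diagonal step consumes a point of a
series to pay for it. Dropping changes the head from `v` to `h`; the slack `gap v x h` in the cost
bound compensates later splits for this change. Merges are removed beforehand and reattached, which
requires that the head is not dropped under them: this is why normal alignments are used and why the
last steps are recorded by `b`. -/
theorem NormalAlign.exists_shorter (hc : 0 ≤ c) {ι : Type*} [Fintype ι] (n : ℕ) :
    ∀ (X : ι → List ℝ) (v : ℝ) (ms : List ℝ) (b : ι → Bool) (r : ι → ℝ),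
      ms.length + ∑ i, (X i).length ≤ n → (∀ i, NormalAlign c (b i) (X i) (v :: ms) (r i)) →
      ∃ (h : ℝ) (ms' : List ℝ) (r' : ι → ℝ),
        ms'.length + Fintype.card ι ≤ ∑ i, (X i).length ∧
        (∀ i, Align c (X i) (h :: ms') (r' i)) ∧
        (∀ i x xs, X i = x :: xs → r' i + gap v x h ≤ r i) ∧
        (h = v ∨ ∀ i, b i = true) ∧ ∀ w ∈ h :: ms', w ∈ v :: ms := by
  induction n with
  | zero =>
    intro X v ms b r hn hA
    have hX : ∀ i, False := fun i => by
      have := Finset.single_le_sum (f := fun i => (X i).length) (fun _ _ => Nat.zero_le _)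
        (Finset.mem_univ i)
      have := List.length_pos_of_ne_nil (hA i).ne_nil_left
      omega
    have : IsEmpty ι := ⟨hX⟩
    exact ⟨v, [], r, by simp, fun i => (hX i).elim, fun i => (hX i).elim, .inl rfl, by simp⟩
  | succ n ih =>
    intro X v ms b r hn hA
    by_cases hR : ∃ i₀ x x' xs r₀, b i₀ = false ∧ X i₀ = x :: x' :: xs ∧
        NormalAlign c false (x' :: xs) (v :: ms) r₀ ∧ r i₀ = r₀ + stepCost c x x' v
    -- Some series end with a merge. The last merges of all of them are undone at once; the last
    -- conjunct records that such a series becomes shorter and, by normality, does not end with a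
    -- split.
    · have hch : ∀ i, ∃ X' b' r₀, NormalAlign c b' X' (v :: ms) r₀ ∧
          ((X' = X i ∧ b' = b i ∧ r₀ = r i) ∨ (b' = false ∧ ∃ x x' xs, X i = x :: x' :: xs ∧
            X' = x' :: xs ∧ r i = r₀ + stepCost c x x' v)) ∧
          ((∃ x x' xs r₀, b i = false ∧ X i = x :: x' :: xs ∧
        NormalAlign c false (x' :: xs) (v :: ms) r₀ ∧ r i = r₀ + stepCost c x x' v) →
          b' = false ∧ X'.length < (X i).length) := by
        intro i
        by_cases hi : ∃ x x' xs r₀, b i = false ∧ X i = x :: x' :: xs ∧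
          NormalAlign c false (x' :: xs) (v :: ms) r₀ ∧ r i = r₀ + stepCost c x x' v
        · obtain ⟨x, x', xs, r₀, hb, hX, h, hr⟩ := hi
          exact ⟨_, _, _, h, .inr ⟨rfl, x, x', xs, hX, rfl, hr⟩, fun _ => ⟨rfl, by simp [hX]⟩⟩
        · exact ⟨_, _, _, hA i, .inl ⟨rfl, rfl, rfl⟩, fun h => absurd h hi⟩
      choose X' b' r₀ hA' hcase hstrict using hch
      obtain ⟨i₀, hi₀⟩ := hR
      have hle : ∀ i, (X' i).length ≤ (X i).length := fun i => by
        rcases hcase i with h | ⟨-, x, x', xs, h₁, h₂, -⟩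
        · rw [h.1]
        · simp [h₁, h₂]
      have hlt : ∑ i, (X' i).length < ∑ i, (X i).length :=
        Finset.sum_lt_sum (fun i _ => hle i) ⟨i₀, Finset.mem_univ _, (hstrict i₀ hi₀).2⟩
      obtain ⟨h, ms', r', hlen, hal, hgap, hor, hmem⟩ := ih X' v ms b' r₀ (by omega) hA'
      -- The series `i₀` does not end with a split after its merge is undone, so the induction
      -- hypothesis keeps `v`, and the merges can be reattached at their old prices.
      obtain rfl : h = v := by
        rcases hor with h | h
        · exact h
        · have := h i₀
          rw [(hstrict i₀ hi₀).1] at this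
          cases this
      have hfin : ∀ i, ∃ r'', Align c (X i) (h :: ms') r'' ∧ r'' ≤ r i := fun i => by
        obtain ⟨y, ys, hy⟩ := List.exists_cons_of_ne_nil (hA' i).ne_nil_left
        have hg := hgap i y ys hy
        have := gap_nonneg h y h
        rcases hcase i with hh | ⟨-, x, x', xs, h₁, h₂, h₃⟩
        · refine ⟨r' i, hh.1 ▸ hal i, ?_⟩
          rw [← hh.2.2]; linarith
        · have := hal i
          rw [h₂] at this
          refine ⟨r' i + stepCost c x x' h, by rw [h₁]; exact .right x this, ?_⟩
          rw [h₃]; linarith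
      choose r'' hal'' hr'' using hfin
      refine ⟨h, ms', r'', by omega, hal'', fun i x xs hX => ?_, .inl rfl, hmem⟩
      rw [gap_self_right, add_zero]
      exact hr'' i
    · rcases ms with _ | ⟨v', ms⟩
      · have hX : ∀ i, ∃ x, X i = [x] ∧ r i = |x - v| := fun i => by
          have hi := hA i
          generalize hXi : X i = Z, hbi : b i = β, hri : r i = ρ at hi
          cases hi with
          | base x y => exact ⟨x, rfl, rfl⟩
          | diag x y h => exact absurd rfl h.ne_nil_right
          | right x h => exact absurd ⟨i, x, _, _, _, hbi, hXi, h, hri⟩ hR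
        choose x hx hr using hX
        refine ⟨v, [], r, by simp [hx], fun i => ?_, fun i => ?_, .inl rfl, by simp⟩
        · rw [hx, hr]
          exact .base _ _
        · intro x xs _
          rw [gap_self_right, add_zero]
      · have hch : ∀ i, ∃ X' b' r₀, NormalAlign c b' X' (v' :: ms) r₀ ∧
            ((b i = false ∧ ∃ x, X i = x :: X' ∧ r i = r₀ + |x - v|) ∨
              (b i = true ∧ X' = X i ∧ ∃ x xs, X i = x :: xs ∧ r i = r₀ + stepCost c v x v')) :=
            fun i => by
          have hi := hA i
          generalize hXi : X i = Z, hbi : b i = β, hri : r i = ρ at hi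
          cases hi with
          | diag x y h => exact ⟨_, _, _, h, .inl ⟨rfl, x, rfl, rfl⟩⟩
          | right x h => exact absurd ⟨i, x, _, _, _, hbi, hXi, h, hri⟩ hR
          | up y h => exact ⟨_, _, _, h, .inr ⟨rfl, rfl, _, _, rfl, rfl⟩⟩
        choose X' b' r₀ hA' hcase using hch
        have hle : ∀ i, (X' i).length ≤ (X i).length := fun i => by
          rcases hcase i with ⟨-, x, h, -⟩ | ⟨-, h, -⟩ <;> simp [h]
        have hles := Finset.sum_le_sum fun i (_ : i ∈ Finset.univ) => hle i
        simp only [List.length_cons] at hn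
        obtain ⟨h, ms', r', hlen, hal, hgap, hor, hmem⟩ :=
          ih X' v' ms b' r₀ (by omega) hA'
        -- No series ends with a merge: each ends with a diagonal step or a split. The point `v` is
        -- deleted exactly when all split.
        by_cases hall : ∀ i, b i = true
        · have hX' : ∀ i, X' i = X i := fun i => by
            rcases hcase i with ⟨hb, -⟩ | ⟨-, h, -⟩
            · rw [hall i] at hb; cases hb
            · exact h
          refine ⟨h, ms', r', by simpa only [hX'] using hlen, fun i => hX' i ▸ hal i,
            fun i x xs hx => ?_, .inr hall, fun w hw => List.mem_cons_of_mem _ (hmem w hw)⟩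
          have hg := hgap i x xs ((hX' i).trans hx)
          rcases hcase i with ⟨hb, -⟩ | ⟨-, -, x₁, xs₁, hx₁, hr⟩
          · rw [hall i] at hb; cases hb
          · obtain ⟨rfl, rfl⟩ := List.cons.inj (hx.symm.trans hx₁)
            rw [hr, stepCost_eq_gap]
            have := gap_triangle v x v' h
            linarith
        · push Not at hall
          obtain ⟨i₀, hi₀⟩ := hall
          -- The diagonal step of `i₀` pays for keeping `v` in the length count.
          have hlt : ∑ i, (X' i).length < ∑ i, (X i).length := by
            refine Finset.sum_lt_sum (fun i _ => hle i) ⟨i₀, Finset.mem_univ _, ?_⟩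
            rcases hcase i₀ with ⟨-, x, h, -⟩ | ⟨hb, -⟩
            · simp [h]
            · exact absurd hb hi₀
          have hfin : ∀ i, ∃ r'', Align c (X i) (v :: h :: ms') r'' ∧ r'' ≤ r i := fun i => by
            obtain ⟨y, ys, hy⟩ := List.exists_cons_of_ne_nil (hA' i).ne_nil_left
            have hg := hgap i y ys hy
            rcases hcase i with ⟨-, x, hx, hr⟩ | ⟨-, hX', x, xs, hx, hr⟩
            · refine ⟨r' i + |x - v|, by rw [hx]; exact .diag x v (hal i), ?_⟩
              have := gap_nonneg v' y h
              rw [hr]; linarith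
            · have ha := hal i
              rw [hX', hx] at ha
              refine ⟨r' i + stepCost c v x h, by rw [hx]; exact .up v ha, ?_⟩
              obtain ⟨rfl, rfl⟩ := List.cons.inj (hy.symm.trans (hX'.trans hx))
              have := gap_triangle v y v' h
              rw [hr, stepCost_eq_gap, stepCost_eq_gap]; linarith
          choose r'' hal'' hr'' using hfin
          refine ⟨v, h :: ms', r'', by simp only [List.length_cons]; omega, hal'',
            fun i x xs hx => ?_, .inl rfl, ?_⟩
          · rw [gap_self_right, add_zero]
            exact hr'' i
          · intro w hw
            rcases List.mem_cons.1 hw with rfl | hw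
            · simp
            · exact List.mem_cons_of_mem _ (hmem w hw)

theorem Align.exists_shorter (hc : 0 ≤ c) {ι : Type*} [Fintype ι] [Nonempty ι] {X : ι → List ℝ}
    {m : List ℝ} {r : ι → ℝ} (hA : ∀ i, Align c (X i) m (r i)) :
    ∃ (m' : List ℝ) (r' : ι → ℝ), m'.length + Fintype.card ι ≤ ∑ i, (X i).length + 1 ∧
      (∀ i, Align c (X i) m' (r' i)) ∧ ∑ i, r' i ≤ ∑ i, r i := by
  obtain ⟨v, ms, rfl⟩ := List.exists_cons_of_ne_nil (hA (Classical.arbitrary ι)).ne_nil_right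
  choose b r₁ hN hr₁ using fun i => (hA i).exists_normalAlign hc
  obtain ⟨h, ms', r', hlen, hal, hgap, -, -⟩ :=
    NormalAlign.exists_shorter hc _ X v ms b r₁ le_rfl hN
  refine ⟨h :: ms', r', by simp only [List.length_cons]; omega, hal,
    Finset.sum_le_sum fun i _ => ?_⟩
  obtain ⟨y, ys, hy⟩ := List.exists_cons_of_ne_nil (hN i).ne_nil_left
  linarith [hgap i y ys hy, gap_nonneg v y h, hr₁ i]

/-! ### Rounding the mean -/

/-- A monotone map preserves the order of the three points, so the case distinction can be made
before mapping and each case is linear in the images. This is what makes expectations under rounding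
computable. -/
theorem gap_map {φ : ℝ → ℝ} (hφ : Monotone φ) (x x' y : ℝ) :
    gap (φ x) (φ x') (φ y) =
      if max x' y ≤ x then φ x - φ (max x' y)
      else if x ≤ min x' y then φ (min x' y) - φ x else 0 := by
  have h₁ : min x' y ≤ max x' y := min_le_max
  have h₂ := hφ h₁
  unfold gap
  rw [← hφ.map_max, ← hφ.map_min]
  split_ifs with h h'
  · have := hφ h
    rw [max_eq_left (by linarith : φ (min x' y) - φ x ≤ φ x - φ (max x' y)),
      max_eq_right (by linarith)]
  · have := hφ h'
    rw [max_eq_right (by linarith : φ x - φ (max x' y) ≤ φ (min x' y) - φ x),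
      max_eq_right (by linarith)]
  · push Not at h h'
    have := hφ h.le
    have := hφ h'.le
    exact max_eq_left (max_le (by linarith) (by linarith))

/-- Rounding by `φ₀` with probability `1 - t` and by `φ₁` with probability `t` does not increase
the expected distances between points of `A`. -/
structure Rounding (A : Set ℝ) (t : ℝ) (φ₀ φ₁ : ℝ → ℝ) : Prop where
  mono₀ : Monotone φ₀
  mono₁ : Monotone φ₁
  nonneg : 0 ≤ t
  le_one : t ≤ 1
  contract : ∀ a ∈ A, ∀ b ∈ A, a ≤ b →
    (1 - t) * (φ₀ b - φ₀ a) + t * (φ₁ b - φ₁ a) ≤ b - a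

theorem Rounding.gap_le {A : Set ℝ} {t : ℝ} {φ₀ φ₁ : ℝ → ℝ} (R : Rounding A t φ₀ φ₁)
    {x x' y : ℝ} (hx : x ∈ A) (hx' : x' ∈ A) (hy : y ∈ A) :
    (1 - t) * gap (φ₀ x) (φ₀ x') (φ₀ y) + t * gap (φ₁ x) (φ₁ x') (φ₁ y) ≤ gap x x' y := by
  have hmax : max x' y ∈ A := by rcases max_choice x' y with h | h <;> rwa [h]
  have hmin : min x' y ∈ A := by rcases min_choice x' y with h | h <;> rwa [h]
  rw [gap_map R.mono₀, gap_map R.mono₁]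
  have := gap_map monotone_id x x' y
  simp only [id] at this
  rw [this]
  split_ifs with h h'
  · exact R.contract _ hmax _ hx h
  · exact R.contract _ hx _ hmin h'
  · simp

theorem Rounding.abs_le {A : Set ℝ} {t : ℝ} {φ₀ φ₁ : ℝ → ℝ} (R : Rounding A t φ₀ φ₁)
    {x y : ℝ} (hx : x ∈ A) (hy : y ∈ A) :
    (1 - t) * |φ₀ x - φ₀ y| + t * |φ₁ x - φ₁ y| ≤ |x - y| := by
  rcases le_total x y with h | h
  · rw [abs_sub_comm, abs_sub_comm (φ₁ x), abs_sub_comm x,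
      abs_of_nonneg (sub_nonneg.2 (R.mono₀ h)), abs_of_nonneg (sub_nonneg.2 (R.mono₁ h)),
      abs_of_nonneg (sub_nonneg.2 h)]
    exact R.contract _ hx _ hy h
  · rw [abs_of_nonneg (sub_nonneg.2 (R.mono₀ h)), abs_of_nonneg (sub_nonneg.2 (R.mono₁ h)),
      abs_of_nonneg (sub_nonneg.2 h)]
    exact R.contract _ hy _ hx h

/-- The same sequence of alignment steps is used for both roundings, and each step satisfies the
inequality of expected costs separately. -/
theorem Align.round {A : Set ℝ} {t : ℝ} {φ₀ φ₁ : ℝ → ℝ} (R : Rounding A t φ₀ φ₁)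
    {x y : List ℝ} {r : ℝ} (h : Align c x y r) (hx : ∀ a ∈ x, a ∈ A) (hy : ∀ a ∈ y, a ∈ A) :
    ∃ r₀ r₁, Align c (x.map φ₀) (y.map φ₀) r₀ ∧ Align c (x.map φ₁) (y.map φ₁) r₁ ∧
      (1 - t) * r₀ + t * r₁ ≤ r := by
  induction h with
  | base x y =>
    exact ⟨_, _, .base _ _, .base _ _, R.abs_le (hx x (by simp)) (hy y (by simp))⟩
  | diag x y h ih =>
    obtain ⟨r₀, r₁, h₀, h₁, hr⟩ := ih (fun a ha => hx a (by simp [ha]))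
      (fun a ha => hy a (by simp [ha]))
    refine ⟨_, _, .diag _ _ h₀, .diag _ _ h₁, ?_⟩
    have := R.abs_le (hx x (by simp)) (hy y (by simp))
    linarith
  | @right x' y xs ys r x h ih =>
    obtain ⟨r₀, r₁, h₀, h₁, hr⟩ := ih (fun a ha => hx a (List.mem_cons_of_mem _ ha)) hy
    refine ⟨_, _, .right _ h₀, .right _ h₁, ?_⟩
    have := R.gap_le (hx x (by simp)) (hx x' (by simp)) (hy y (by simp))
    simp only [stepCost_eq_gap]
    linarith
  | @up x y' xs ys r y h ih =>
    obtain ⟨r₀, r₁, h₀, h₁, hr⟩ := ih hx (fun a ha => hy a (List.mem_cons_of_mem _ ha))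
    refine ⟨_, _, .up _ h₀, .up _ h₁, ?_⟩
    have := R.gap_le (hy y (by simp)) (hx x (by simp)) (hy y' (by simp))
    simp only [stepCost_eq_gap]
    linarith

/-- If `w` has neighbours `u < w < z` in `A`, it is sent to `u` or `z` with the probabilities that
make the expectation `w`. If `w` is extremal in `A`, clamping at its only neighbour shrinks all
distances, and both roundings are the same. -/
theorem exists_rounding (A : Finset ℝ) {w : ℝ} (hA : ∃ a ∈ A, a ≠ w) :
    ∃ t φ₀ φ₁, Rounding (A : Set ℝ) t φ₀ φ₁ ∧
      (∀ a ∈ A, φ₀ a ∈ A ∧ φ₀ a ≠ w ∧ (a ≠ w → φ₀ a = a)) ∧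
      (∀ a ∈ A, φ₁ a ∈ A ∧ φ₁ a ≠ w ∧ (a ≠ w → φ₁ a = a)) := by
  have hlo : ∀ B : Finset ℝ, B = A.filter (· < w) → B.Nonempty → ∃ u ∈ A, u < w ∧
      ∀ a ∈ A, a < w → a ≤ u := by
    rintro B rfl hB
    obtain ⟨u, hu, hmax⟩ := Finset.exists_max_image _ id hB
    rw [Finset.mem_filter] at hu
    exact ⟨u, hu.1, hu.2, fun a ha haw => hmax a (Finset.mem_filter.2 ⟨ha, haw⟩)⟩
  have hhi : ∀ B : Finset ℝ, B = A.filter (w < ·) → B.Nonempty → ∃ u ∈ A, w < u ∧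
      ∀ a ∈ A, w < a → u ≤ a := by
    rintro B rfl hB
    obtain ⟨u, hu, hmin⟩ := Finset.exists_min_image _ id hB
    rw [Finset.mem_filter] at hu
    exact ⟨u, hu.1, hu.2, fun a ha haw => hmin a (Finset.mem_filter.2 ⟨ha, haw⟩)⟩
  by_cases h₀ : (A.filter (· < w)).Nonempty <;> by_cases h₁ : (A.filter (w < ·)).Nonempty
  · obtain ⟨u, hu, huw, hmax⟩ := hlo _ rfl h₀
    obtain ⟨z, hz, hwz, hmin⟩ := hhi _ rfl h₁
    have hcase : ∀ a ∈ A, a ≤ u ∨ a = w ∨ z ≤ a := fun a ha => by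
      rcases lt_trichotomy a w with h | h | h
      · exact .inl (hmax a ha h)
      · exact .inr (.inl h)
      · exact .inr (.inr (hmin a ha h))
    -- The whole interval between `u` and `z` is collapsed to keep the maps monotone on the reals;
    -- within `A` only `w` is affected.
    have hf : ∀ e : ℝ, ∀ a ∈ A, (if u < a ∧ a < z then e else a) = if a = w then e else a := by
      intro e a ha
      have := hcase a ha
      grind
    -- The expectation of the rounded point is the point itself, so expected differences are
    -- preserved exactly.
    have hid : ∀ a ∈ A, (1 - (w - u) / (z - u)) * (if u < a ∧ a < z then u else a) +
        (w - u) / (z - u) * (if u < a ∧ a < z then z else a) = a := fun a ha => by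
      have : z - u ≠ 0 := by linarith
      rw [hf u a ha, hf z a ha]
      split_ifs with h
      · subst h; field_simp; ring
      · ring
    refine ⟨(w - u) / (z - u), fun a => if u < a ∧ a < z then u else a,
      fun a => if u < a ∧ a < z then z else a, ⟨?_, ?_, ?_, ?_, ?_⟩, ?_, ?_⟩
    · intro a b hab
      simp only
      grind
    · intro a b hab
      simp only
      grind
    · exact div_nonneg (by linarith) (by linarith)
    · exact div_le_one_of_le₀ (by linarith) (by linarith)
    · intro a ha b hb _
      have := hid a ha
      have := hid b hb
      linarith
    · intro a ha
      simp only [hf u a ha]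
      grind
    · intro a ha
      simp only [hf z a ha]
      grind
  · obtain ⟨u, hu, huw, hmax⟩ := hlo _ rfl h₀
    have hA' : ∀ a ∈ A, a ≤ w := fun a ha => by
      by_contra h
      exact h₁ ⟨a, Finset.mem_filter.2 ⟨ha, not_le.1 h⟩⟩
    have hmap : ∀ a ∈ A, min a u ∈ A ∧ min a u ≠ w ∧ (a ≠ w → min a u = a) := fun a ha => by
      have := hA' a ha
      have := hmax a ha
      grind
    have hm : Monotone fun a => min a u := fun a b h => min_le_min_right u h
    refine ⟨0, fun a => min a u, fun a => min a u, ⟨hm, hm, le_rfl, zero_le_one, ?_⟩, hmap, hmap⟩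
    intro a _ b _ hab
    grind
  · obtain ⟨u, hu, huw, hmin⟩ := hhi _ rfl h₁
    have hA' : ∀ a ∈ A, w ≤ a := fun a ha => by
      by_contra h
      exact h₀ ⟨a, Finset.mem_filter.2 ⟨ha, not_le.1 h⟩⟩
    have hmap : ∀ a ∈ A, max a u ∈ A ∧ max a u ≠ w ∧ (a ≠ w → max a u = a) := fun a ha => by
      have := hA' a ha
      have := hmin a ha
      grind
    have hm : Monotone fun a => max a u := fun a b h => max_le_max_right u h
    refine ⟨0, fun a => max a u, fun a => max a u, ⟨hm, hm, le_rfl, zero_le_one, ?_⟩, hmap, hmap⟩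
    intro a _ b _ hab
    grind
  · obtain ⟨a, ha, haw⟩ := hA
    rcases lt_or_gt_of_ne haw with h | h
    · exact absurd ⟨a, Finset.mem_filter.2 ⟨ha, h⟩⟩ h₀
    · exact absurd ⟨a, Finset.mem_filter.2 ⟨ha, h⟩⟩ h₁

/-- Induction on the number of values of the mean outside `V`. Each rounding removes one of them,
introduces none, and fixes all points of the series. -/
theorem Align.exists_values {ι : Type*} [Fintype ι] {X : ι → List ℝ} (V : Finset ℝ)
    (hV : V.Nonempty) (hX : ∀ i, ∀ a ∈ X i, a ∈ V) (n : ℕ) :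
    ∀ {m : List ℝ} {r : ι → ℝ}, (m.toFinset \ V).card ≤ n → (∀ i, Align c (X i) m (r i)) →
      ∃ (m' : List ℝ) (r' : ι → ℝ), m'.length = m.length ∧ (∀ a ∈ m', a ∈ V) ∧
        (∀ i, Align c (X i) m' (r' i)) ∧ ∑ i, r' i ≤ ∑ i, r i := by
  induction n with
  | zero =>
    intro m r hn hA
    refine ⟨m, r, rfl, fun a ha => ?_, hA, le_rfl⟩
    by_contra h
    have : a ∈ m.toFinset \ V := Finset.mem_sdiff.2 ⟨List.mem_toFinset.2 ha, h⟩
    rw [Finset.card_eq_zero.1 (Nat.le_zero.1 hn)] at this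
    exact absurd this (Finset.notMem_empty a)
  | succ n ih =>
    intro m r hn hA
    by_cases hne : ∃ w, w ∈ m ∧ w ∉ V
    swap
    · push Not at hne
      exact ⟨m, r, rfl, hne, hA, le_rfl⟩
    obtain ⟨w, hwm, hwV⟩ := hne
    obtain ⟨v, hv⟩ := hV
    obtain ⟨t, φ₀, φ₁, R, hφ₀, hφ₁⟩ := exists_rounding (m.toFinset ∪ V) (w := w)
      ⟨v, Finset.mem_union_right _ hv, fun h => hwV (h ▸ hv)⟩
    have hmA : ∀ a ∈ m, a ∈ m.toFinset ∪ V := fun a ha =>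
      Finset.mem_union_left _ (List.mem_toFinset.2 ha)
    have hXA : ∀ i, ∀ a ∈ X i, a ∈ m.toFinset ∪ V := fun i a ha =>
      Finset.mem_union_right _ (hX i a ha)
    have hmap : ∀ φ : ℝ → ℝ, (∀ a ∈ m.toFinset ∪ V, φ a ∈ m.toFinset ∪ V ∧ φ a ≠ w ∧
        (a ≠ w → φ a = a)) → (∀ i, (X i).map φ = X i) ∧
        ((m.map φ).toFinset \ V).card ≤ n := by
      intro φ hφ
      constructor
      · intro i
        refine (List.map_congr_left fun a ha => ?_).trans (List.map_id _)
        exact (hφ a (hXA i a ha)).2.2 fun h => hwV (h ▸ hX i a ha)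
      · have hsub : (m.map φ).toFinset \ V ⊆ (m.toFinset \ V).erase w := by
          intro b hb
          rw [Finset.mem_sdiff, List.mem_toFinset, List.mem_map] at hb
          obtain ⟨⟨a, ha, rfl⟩, hbV⟩ := hb
          have h := hφ a (hmA a ha)
          rw [Finset.mem_erase, Finset.mem_sdiff]
          exact ⟨h.2.1, (Finset.mem_union.1 h.1).resolve_right hbV, hbV⟩
        have hw : w ∈ m.toFinset \ V := Finset.mem_sdiff.2 ⟨List.mem_toFinset.2 hwm, hwV⟩
        have := Finset.card_le_card hsub
        rw [Finset.card_erase_of_mem hw] at this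
        omega
    choose r₀ r₁ h₀ h₁ hr using fun i => (hA i).round R (hXA i) hmA
    have hsum : (1 - t) * ∑ i, r₀ i + t * ∑ i, r₁ i ≤ ∑ i, r i := by
      rw [Finset.mul_sum, Finset.mul_sum, ← Finset.sum_add_distrib]
      exact Finset.sum_le_sum fun i _ => hr i
    -- A convex combination of the two totals is at most the old total, so one of them is. The same
    -- rounding serves all series, as they share the mean.
    have hor : ∑ i, r₀ i ≤ ∑ i, r i ∨ ∑ i, r₁ i ≤ ∑ i, r i := by
      by_contra! h
      rcases R.nonneg.eq_or_lt with ht | ht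
      · subst ht
        linarith
      · nlinarith [mul_pos ht (sub_pos.2 h.2),
          mul_nonneg (sub_nonneg.2 R.le_one) (sub_nonneg.2 h.1.le)]
    rcases hor with hle | hle
    · obtain ⟨hX₀, hc₀⟩ := hmap φ₀ hφ₀
      obtain ⟨m', r', hl, hm', hA', hr'⟩ := ih (r := r₀) hc₀ fun i => by
        have := h₀ i
        rwa [hX₀] at this
      exact ⟨m', r', by simpa using hl, hm', hA', hr'.trans hle⟩
    · obtain ⟨hX₁, hc₁⟩ := hmap φ₁ hφ₁
      obtain ⟨m', r', hl, hm', hA', hr'⟩ := ih (r := r₁) hc₁ fun i => by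
        have := h₁ i
        rwa [hX₁] at this
      exact ⟨m', r', by simpa using hl, hm', hA', hr'.trans hle⟩

end MSM

namespace MSM

variable {c : ℝ} {k : ℕ} {X : Fin k → TimeSeries}

/-! ### The table and alignments -/

/-- The list `[f (n - 1), …, f 0]`. -/
def revPrefix (f : ℕ → ℝ) : ℕ → List ℝ
  | 0 => []
  | n + 1 => f n :: revPrefix f n

theorem length_revPrefix (f : ℕ → ℝ) (n : ℕ) : (revPrefix f n).length = n := by
  induction n with
  | zero => rfl
  | succ n ih => simp [revPrefix, ih]

theorem revPrefix_eq_reverse (f : ℕ → ℝ) (n : ℕ) :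
    revPrefix f n = ((List.range n).map f).reverse := by
  induction n with
  | zero => rfl
  | succ n ih => simp [revPrefix, ih, List.range_succ]

theorem revPrefix_getD (l : List ℝ) : revPrefix (fun q => l.getD q 0) l.length = l.reverse := by
  rw [revPrefix_eq_reverse]
  congr 1
  refine List.ext_getElem (by simp) fun i h₁ h₂ => ?_
  simp [h₂]

theorem point_succ (i : Fin k) (q : ℕ) : point X i (q + 1) = (X i).1.getD q 0 := rfl

theorem table_eq_top {p : Fin k → ℕ} {ℓ : ℕ} {v : ℝ} (h : (∃ i, p i = 0) ∨ ℓ = 0) :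
    table c X p ℓ v = ⊤ := by
  unfold table
  rw [dif_pos h]

theorem table_init {p : Fin k → ℕ} {v : ℝ} (h : ∀ i, p i = 1) :
    table c X p 1 v = ((∑ i, |point X i 1 - v| : ℝ) : EReal) := by
  unfold table
  rw [dif_neg (by simp [h]), if_pos ⟨h, rfl⟩]

theorem table_step {p : Fin k → ℕ} {ℓ : ℕ} {v : ℝ} (hp : ∀ i, p i ≠ 0) (hℓ : ℓ ≠ 0)
    (h : ¬ ((∀ i, p i = 1) ∧ ℓ = 1)) :
    table c X p ℓ v = min
      (⨅ v' ∈ values X, ⨅ S : Finset (Fin k),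
        table c X (decr p S) (ℓ - 1) v' +
          ((∑ i ∈ S, |point X i (p i) - v| +
            ∑ i ∈ Sᶜ, stepCost c v (point X i (p i)) v' : ℝ) : EReal))
      (⨅ (S : Finset (Fin k)) (_ : S.Nonempty),
        table c X (decr p S) ℓ v +
          ((∑ i ∈ S, stepCost c (point X i (p i)) (point X i (p i - 1)) v : ℝ) : EReal)) := by
  rw [table, dif_neg (by simp [hp, hℓ]), if_neg h]

theorem table_le_of_step {p : Fin k → ℕ} {ℓ : ℕ} {v v' : ℝ} (hp : ∀ i, p i ≠ 0) (hℓ : ℓ ≠ 0)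
    (hv' : v' ∈ values X) (S : Finset (Fin k)) :
    table c X p (ℓ + 1) v ≤ table c X (decr p S) ℓ v' +
      ((∑ i ∈ S, |point X i (p i) - v| +
        ∑ i ∈ Sᶜ, stepCost c v (point X i (p i)) v' : ℝ) : EReal) := by
  rw [table_step hp ℓ.succ_ne_zero (by simp [hℓ])]
  exact (min_le_left _ _).trans ((iInf₂_le v' hv').trans (iInf_le _ S))

theorem table_le_of_merge {p : Fin k → ℕ} {ℓ : ℕ} {v : ℝ} (hp : ∀ i, p i ≠ 0) (hℓ : ℓ ≠ 0)
    (h : ¬ ((∀ i, p i = 1) ∧ ℓ = 1)) {S : Finset (Fin k)} (hS : S.Nonempty) :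
    table c X p ℓ v ≤ table c X (decr p S) ℓ v +
      ((∑ i ∈ S, stepCost c (point X i (p i)) (point X i (p i - 1)) v : ℝ) : EReal) := by
  rw [table_step hp hℓ h]
  exact (min_le_right _ _).trans (iInf₂_le S hS)

/-- The last steps of the alignments select a branch of the recursion. If some series end with a
merge, all these merges are undone simultaneously while the others pause. Otherwise all series end
with a diagonal step or a split, and the diagonal ones form `S`. -/
theorem table_le_of_align (n : ℕ) :
    ∀ {p : Fin k → ℕ} {ms : List ℝ} {v : ℝ} {r : Fin k → ℝ}, ms.length + ∑ i, p i ≤ n →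
      (∀ w ∈ ms, w ∈ values X) →
      (∀ i, Align c (revPrefix (fun q => (X i).1.getD q 0) (p i)) (v :: ms) (r i)) →
      table c X p (ms.length + 1) v ≤ ((∑ i, r i : ℝ) : EReal) := by
  classical
  induction n with
  | zero =>
    intro p ms v r hn hms hA
    have hk : IsEmpty (Fin k) := ⟨fun i => (hA i).ne_nil_left (by
      have := Finset.single_le_sum (fun _ _ => Nat.zero_le _) (Finset.mem_univ i) (f := p)
      rw [show p i = 0 by omega]; rfl)⟩
    obtain rfl : ms = [] := List.length_eq_zero_iff.1 (by omega)
    rw [List.length_nil, zero_add, table_init fun i => hk.elim i]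
    simp
  | succ n ih =>
    intro p ms v r hn hms hA
    have hp : ∀ i, p i ≠ 0 := fun i h => (hA i).ne_nil_left (by rw [h]; rfl)
    have hpS : ∀ i, p i = p i - 1 + 1 := fun i => by have := hp i; omega
    have hA' : ∀ i, Align c ((X i).1.getD (p i - 1) 0 ::
        revPrefix (fun q => (X i).1.getD q 0) (p i - 1)) (v :: ms) (r i) := fun i => by
      have := hA i
      rwa [hpS i, revPrefix] at this
    let R : Fin k → Prop := fun i => 2 ≤ p i ∧ ∃ r₀,
      Align c (revPrefix (fun q => (X i).1.getD q 0) (p i - 1)) (v :: ms) r₀ ∧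
      r i = r₀ + stepCost c (point X i (p i)) (point X i (p i - 1)) v
    by_cases hR : ∃ i, R i
    · obtain ⟨i₀, hi₀⟩ := hR
      have hch : ∀ i, ∃ r₀, Align c (revPrefix (fun q => (X i).1.getD q 0)
          (decr p (Finset.univ.filter R) i)) (v :: ms) r₀ ∧ r i = r₀ +
          if i ∈ Finset.univ.filter R then
            stepCost c (point X i (p i)) (point X i (p i - 1)) v else 0 := fun i => by
        by_cases hi : R i
        · obtain ⟨-, r₀, h, hr⟩ := id hi
          have hi' : i ∈ Finset.univ.filter R := by simpa using hi
          exact ⟨r₀, by rwa [decr, if_pos hi'], by rwa [if_pos hi']⟩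
        · have hi' : i ∉ Finset.univ.filter R := by simpa using hi
          exact ⟨r i, by rw [decr, if_neg hi']; exact hA i, by rw [if_neg hi', add_zero]⟩
      choose r₀ h₀ hr₀ using hch
      have hS : (Finset.univ.filter R).Nonempty := ⟨i₀, by simpa using hi₀⟩
      have hlt := sum_decr_lt p _ hS hp
      refine (table_le_of_merge hp (Nat.succ_ne_zero _)
        (fun h => by have := h.1 i₀; have := hi₀.1; omega) hS).trans ?_
      refine (add_le_add_left (ih (by omega) hms h₀) _).trans_eq ?_
      rw [← EReal.coe_add]
      congr 1
      rw [Finset.sum_congr rfl fun i _ => hr₀ i, Finset.sum_add_distrib, ← Finset.sum_filter]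
      simp
    · rcases ms with _ | ⟨v', ms⟩
      · have hb : ∀ i, p i = 1 ∧ r i = |point X i 1 - v| := fun i => by
          have hi := hA' i
          generalize hZ : revPrefix (fun q => (X i).1.getD q 0) (p i - 1) = Z,
            hρ : r i = ρ at hi
          cases hi with
          | base _ _ =>
            have h1 : p i - 1 = 0 := by rw [← length_revPrefix _ (p i - 1), hZ]; rfl
            have := hp i
            refine ⟨by omega, ?_⟩
            rw [h1]; rfl
          | diag _ _ h => exact absurd rfl h.ne_nil_right
          | right _ h =>
            refine absurd ⟨i, ?_, ?_⟩ hR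
            · have h1 := congrArg List.length hZ
              rw [length_revPrefix, List.length_cons] at h1
              omega
            · have h1 := congrArg List.length hZ
              rw [length_revPrefix, List.length_cons] at h1
              have h2 := hZ
              rw [show p i - 1 = p i - 1 - 1 + 1 by omega, revPrefix] at h2
              obtain ⟨rfl, -⟩ := List.cons.inj h2
              exact ⟨_, hZ ▸ h, hρ⟩
        rw [List.length_nil, zero_add, table_init fun i => (hb i).1]
        simp only [fun i => (hb i).2, le_refl]
      · let D : Fin k → Prop := fun i => ∃ r₀,
          Align c (revPrefix (fun q => (X i).1.getD q 0) (p i - 1)) (v' :: ms) r₀ ∧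
          r i = r₀ + |point X i (p i) - v|
        have hch : ∀ i, ∃ r₀, Align c (revPrefix (fun q => (X i).1.getD q 0)
            (decr p (Finset.univ.filter D) i)) (v' :: ms) r₀ ∧ r i = r₀ +
            if i ∈ Finset.univ.filter D then |point X i (p i) - v|
            else stepCost c v (point X i (p i)) v' := fun i => by
          by_cases hi : D i
          · obtain ⟨r₀, h, hr⟩ := id hi
            have hi' : i ∈ Finset.univ.filter D := by simpa using hi
            exact ⟨r₀, by rwa [decr, if_pos hi'], by rwa [if_pos hi']⟩
          · have hi' : i ∉ Finset.univ.filter D := by simpa using hi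
            simp only [decr, if_neg hi']
            have hAi := hA' i
            generalize hZ : revPrefix (fun q => (X i).1.getD q 0) (p i - 1) = Z,
              hρ : r i = ρ at hAi
            cases hAi with
            | diag _ _ h => exact absurd ⟨_, hZ ▸ h, hρ⟩ hi
            | right _ h =>
              refine absurd ⟨i, ?_, ?_⟩ hR
              · have h1 := congrArg List.length hZ
                rw [length_revPrefix, List.length_cons] at h1
                omega
              · have h1 := congrArg List.length hZ
                rw [length_revPrefix, List.length_cons] at h1
                have h2 := hZ
                rw [show p i - 1 = p i - 1 - 1 + 1 by omega, revPrefix] at h2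
                obtain ⟨rfl, -⟩ := List.cons.inj h2
                exact ⟨_, hZ ▸ h, hρ⟩
            | up _ h =>
              refine ⟨_, ?_, rfl⟩
              rw [hpS i, revPrefix, hZ]
              exact h
        choose r₀ h₀ hr₀ using hch
        have hle := sum_decr_le p (Finset.univ.filter D)
        simp only [List.length_cons] at hn
        refine (table_le_of_step hp (by simp) (hms v' (by simp)) (Finset.univ.filter D)).trans ?_
        refine (add_le_add_left (ih (by omega) (fun w hw => hms w (by simp [hw])) h₀) _).trans_eq ?_
        rw [← EReal.coe_add]
        congr 1
        rw [Finset.sum_congr rfl fun i _ => hr₀ i, Finset.sum_add_distrib, Finset.sum_ite]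
        congr 3 <;> ext i <;> simp

/-- `m` restricted to the first `ℓ` points is aligned with the first `p i` points of each time
series, at total cost `T`. -/
def Realizes (c : ℝ) (X : Fin k → TimeSeries) (p : Fin k → ℕ) (ℓ : ℕ) (m : ℕ → ℝ) (T : ℝ) : Prop :=
  ∃ r : Fin k → ℝ, (∀ i, Align c (revPrefix (fun q => (X i).1.getD q 0) (p i))
    (revPrefix m ℓ) (r i)) ∧ ∑ i, r i = T

theorem realizes_init {p : Fin k → ℕ} {m : ℕ → ℝ} (hp : ∀ i, p i = 1) :
    Realizes c X p 1 m (∑ i, |point X i 1 - m 0|) :=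
  ⟨_, fun i => by rw [hp]; exact .base _ _, rfl⟩

theorem Realizes.step {p : Fin k → ℕ} {ℓ : ℕ} {m : ℕ → ℝ} {T : ℝ} {S : Finset (Fin k)}
    (h : Realizes c X (decr p S) (ℓ + 1) m T) (hp : ∀ i, p i ≠ 0) :
    Realizes c X p (ℓ + 2) m (T + (∑ i ∈ S, |point X i (p i) - m (ℓ + 1)| +
      ∑ i ∈ Sᶜ, stepCost c (m (ℓ + 1)) (point X i (p i)) (m ℓ))) := by
  classical
  obtain ⟨r, hr, rfl⟩ := h
  refine ⟨fun i => r i + if i ∈ S then |point X i (p i) - m (ℓ + 1)|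
    else stepCost c (m (ℓ + 1)) (point X i (p i)) (m ℓ), fun i => ?_, ?_⟩
  · have hi := hr i
    have hpi : p i = p i - 1 + 1 := by have := hp i; omega
    by_cases hS : i ∈ S
    · rw [decr, if_pos hS] at hi
      simp only [if_pos hS]
      rw [hpi, revPrefix, point_succ]
      exact .diag _ _ hi
    · rw [decr, if_neg hS, hpi] at hi
      simp only [if_neg hS]
      rw [hpi, point_succ]
      exact .up _ hi
  · rw [Finset.sum_add_distrib, Finset.sum_ite]
    congr 3 <;> ext i <;> simp

theorem Realizes.merge {p : Fin k → ℕ} {ℓ : ℕ} {m : ℕ → ℝ} {T : ℝ} {S : Finset (Fin k)}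
    (h : Realizes c X (decr p S) (ℓ + 1) m T) :
    Realizes c X p (ℓ + 1) m
      (T + ∑ i ∈ S, stepCost c (point X i (p i)) (point X i (p i - 1)) (m ℓ)) := by
  classical
  obtain ⟨r, hr, rfl⟩ := h
  refine ⟨fun i => r i + if i ∈ S then
    stepCost c (point X i (p i)) (point X i (p i - 1)) (m ℓ) else 0, fun i => ?_, ?_⟩
  · have hi := hr i
    by_cases hS : i ∈ S
    · rw [decr, if_pos hS] at hi
      have hne := hi.ne_nil_left
      -- A merging series has position at least `2`: otherwise its decreased prefix would be empty,
      -- and the empty list has no alignment.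
      obtain ⟨q, hq⟩ : ∃ q, p i = q + 2 := by
        refine ⟨p i - 2, ?_⟩
        by_contra hlt
        exact hne (by rw [show p i - 1 = 0 by omega]; rfl)
      simp only [if_pos hS]
      rw [hq] at hi ⊢
      exact .right _ hi
    · rw [decr, if_neg hS] at hi
      simpa only [if_neg hS, add_zero] using hi
  · rw [Finset.sum_add_distrib, Finset.sum_ite]
    simp

theorem Realizes.totalDist_le (hc : 0 ≤ c) {ℓ : ℕ} {m : ℕ → ℝ} {T : ℝ}
    (h : Realizes c X (fun i => (X i).1.length) ℓ m T) (z : TimeSeries)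
    (hz : z.1 = (List.range ℓ).map m) : totalDist c X z ≤ T := by
  obtain ⟨r, hr, rfl⟩ := h
  refine Finset.sum_le_sum fun i _ => dist_le_of_align hc ?_
  have := hr i
  rwa [revPrefix_getD, revPrefix_eq_reverse, ← hz] at this

theorem one_le_length (i : Fin k) : 1 ≤ (X i).1.length :=
  List.length_pos_of_ne_nil (X i).2

theorem length_le_maxLength (i : Fin k) : (X i).1.length ≤ maxLength X :=
  Finset.le_sup (f := fun i => (X i).1.length) (Finset.mem_univ i)

/-- Near-optimal alignments with `z` are shortened and then rounded, neither of which increases the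
total cost; the resulting mean has its length and values in the range of the table. -/
theorem tableOptimum_le (hk : 1 ≤ k) (hc : 0 ≤ c) (z : TimeSeries) :
    tableOptimum c X ≤ ((totalDist c X z : ℝ) : EReal) := by
  classical
  have : Nonempty (Fin k) := ⟨⟨0, hk⟩⟩
  by_contra hlt
  obtain ⟨D, hD, hD'⟩ := EReal.lt_iff_exists_real_btwn.1 (not_le.1 hlt)
  rw [EReal.coe_lt_coe_iff] at hD
  -- The excesses of the `k` alignments then add up to less than `D - totalDist c X z`, so their
  -- total stays at most `D`.
  set ε := (D - totalDist c X z) / k with hε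
  have hk' : (0 : ℝ) < k := by exact_mod_cast hk
  have hε' : 0 < ε := div_pos (by linarith) hk'
  choose r hr hrlt using fun i => exists_align_lt hc (X i) z hε'
  have hrD : ∑ i, r i ≤ D := by
    refine (Finset.sum_le_sum fun i _ => (hrlt i).le).trans ?_
    rw [Finset.sum_add_distrib, Finset.sum_const, Finset.card_univ, Fintype.card_fin, nsmul_eq_mul,
      hε, mul_div_cancel₀ _ hk'.ne']
    unfold totalDist
    linarith
  obtain ⟨m₁, r₁, hlen, hA₁, hr₁⟩ := Align.exists_shorter hc hr
  let V : Finset ℝ := Finset.univ.biUnion fun i => (X i).1.toFinset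
  have hV : ∀ a, a ∈ V ↔ a ∈ values X := fun a => by simp [V, values]
  obtain ⟨m₂, r₂, hl, hmV, hA₂, hr₂⟩ := Align.exists_values V (X := fun i => (X i).1.reverse)
    (by
      obtain ⟨a, ha⟩ := List.exists_mem_of_ne_nil _ (X ⟨0, hk⟩).2
      exact ⟨a, (hV a).2 ⟨_, ha⟩⟩)
    (fun i a ha => (hV a).2 ⟨i, by simpa using ha⟩) _ le_rfl hA₁
  obtain ⟨v, ms, rfl⟩ := List.exists_cons_of_ne_nil (hA₂ ⟨0, hk⟩).ne_nil_right
  have hN : ms.length + 1 ≤ (maxLength X - 1) * k + 1 := by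
    have h₁ : ∑ i, (X i).1.reverse.length ≤ k * maxLength X := by
      refine (Finset.sum_le_sum (g := fun _ => maxLength X) fun i _ => ?_).trans (by simp)
      rw [List.length_reverse]
      exact length_le_maxLength i
    have h₂ := (one_le_length (X := X) ⟨0, hk⟩).trans (length_le_maxLength _)
    obtain ⟨q, hq⟩ := Nat.exists_eq_add_of_le h₂
    rw [← hl, Fintype.card_fin, List.length_cons] at hlen
    rw [hq] at h₁ ⊢
    rw [Nat.add_sub_cancel_left]
    have : k * (1 + q) = q * k + k := by ring
    omega
  have htab : tableOptimum c X ≤ table c X (fun i => (X i).1.length) (ms.length + 1) v :=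
    (iInf₂_le (ms.length + 1) (Finset.mem_Icc.2 ⟨by omega, hN⟩)).trans
      (iInf₂_le v ((hV v).1 (hmV v (by simp))))
  have hle := htab.trans (table_le_of_align _ le_rfl
    (fun w hw => (hV w).1 (hmV w (by simp [hw]))) fun i => by
      rw [revPrefix_getD]
      exact hA₂ i)
  have : ((∑ i, r₂ i : ℝ) : EReal) ≤ D := by
    rw [EReal.coe_le_coe_iff]
    linarith
  exact absurd hD' (not_lt.2 (hle.trans this))

/-- The total distance of `z` is at most the realized cost, which is the optimum and hence a lower
bound for all total distances. -/
theorem Realizes.isMean (hk : 1 ≤ k) (hc : 0 ≤ c) {ℓ : ℕ} {m : ℕ → ℝ} {T : ℝ}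
    (h : Realizes c X (fun i => (X i).1.length) ℓ m T) (hT : (T : EReal) = tableOptimum c X)
    (z : TimeSeries) (hz : z.1 = (List.range ℓ).map m) :
    IsMean c X z ∧ ((totalDist c X z : ℝ) : EReal) = tableOptimum c X := by
  have hle := h.totalDist_le hc z hz
  constructor
  · intro y
    have := tableOptimum_le (X := X) hk hc y
    rw [← hT, EReal.coe_le_coe_iff] at this
    exact hle.trans this
  · refine le_antisymm ?_ (tableOptimum_le hk hc z)
    rw [← hT]
    exact EReal.coe_le_coe_iff.2 hle

end MSM

namespace MSM

/-! ### Reasoning about programs -/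

/-- `Ends P σ Q`: started with memory `σ`, the program `P` halts after `t` steps with memory `τ`
such that `Q t τ`. -/
def Ends (P : Program) (σ : Memory) (Q : ℕ → Memory → Prop) : Prop :=
  ∃ t τ, Runs P σ t τ ∧ Q t τ

/-- The parts of the memory, where arrays are taken as a whole. -/
inductive Part where
  | nreg (x : ℕ)
  | rreg (x : ℕ)
  | narr (a : ℕ)
  | rarr (a : ℕ)
  deriving DecidableEq

/-- Whether the program contains an instruction that writes to the given part of the memory. -/
def Program.writes : Program → Part → Bool
  | .skip, _ => false
  | .nset x _, p => p = .nreg x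
  | .rset x _, p => p = .rreg x
  | .nput a _ _, p => p = .narr a
  | .rput a _ _, p => p = .rarr a
  | .seq P Q, p => P.writes p || Q.writes p
  | .ite _ P Q, p => P.writes p || Q.writes p
  | .while _ P, p => P.writes p

/-- The memories `σ` and `τ` agree on all parts that `P` does not write. -/
structure Frame (P : Program) (σ τ : Memory) : Prop where
  nreg (x : ℕ) : P.writes (.nreg x) = false → τ.nreg x = σ.nreg x
  rreg (x : ℕ) : P.writes (.rreg x) = false → τ.rreg x = σ.rreg x
  narr (a : ℕ) : P.writes (.narr a) = false → τ.narr a = σ.narr a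
  rarr (a : ℕ) : P.writes (.rarr a) = false → τ.rarr a = σ.rarr a

theorem Frame.refl (P : Program) (σ : Memory) : Frame P σ σ :=
  ⟨fun _ _ => rfl, fun _ _ => rfl, fun _ _ => rfl, fun _ _ => rfl⟩

theorem Frame.trans {P : Program} {σ τ υ : Memory} (h : Frame P σ τ) (h' : Frame P τ υ) :
    Frame P σ υ :=
  ⟨fun x hx => (h'.nreg x hx).trans (h.nreg x hx), fun x hx => (h'.rreg x hx).trans (h.rreg x hx),
    fun x hx => (h'.narr x hx).trans (h.narr x hx), fun x hx => (h'.rarr x hx).trans (h.rarr x hx)⟩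

theorem Frame.mono {P Q : Program} {σ τ : Memory} (h : Frame P σ τ)
    (hPQ : ∀ p, Q.writes p = false → P.writes p = false) : Frame Q σ τ :=
  ⟨fun x hx => h.nreg x (hPQ _ hx), fun x hx => h.rreg x (hPQ _ hx),
    fun x hx => h.narr x (hPQ _ hx), fun x hx => h.rarr x (hPQ _ hx)⟩

theorem Runs.frame {P : Program} {σ τ : Memory} {t : ℕ} (h : Runs P σ t τ) : Frame P σ τ := by
  induction h with
  | skip σ => exact .refl _ _
  | nset x e σ =>
    refine ⟨fun y hy => ?_, fun _ _ => rfl, fun _ _ => rfl, fun _ _ => rfl⟩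
    exact Function.update_of_ne (by simpa [Program.writes] using hy) _ _
  | rset x e σ =>
    refine ⟨fun _ _ => rfl, fun y hy => ?_, fun _ _ => rfl, fun _ _ => rfl⟩
    exact Function.update_of_ne (by simpa [Program.writes] using hy) _ _
  | nput a i e σ =>
    refine ⟨fun _ _ => rfl, fun _ _ => rfl, fun y hy => ?_, fun _ _ => rfl⟩
    exact Function.update_of_ne (by simpa [Program.writes] using hy) _ _
  | rput a i e σ =>
    refine ⟨fun _ _ => rfl, fun _ _ => rfl, fun _ _ => rfl, fun y hy => ?_⟩
    exact Function.update_of_ne (by simpa [Program.writes] using hy) _ _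
  | seq _ _ ih ih' =>
    exact (ih.mono fun p hp => (by simp only [Program.writes, Bool.or_eq_false_iff] at hp; exact hp.1)).trans
      (ih'.mono fun p hp => (by simp only [Program.writes, Bool.or_eq_false_iff] at hp; exact hp.2))
  | ite_true Q _ _ ih => exact ih.mono fun p hp => (by simp only [Program.writes, Bool.or_eq_false_iff] at hp; exact hp.1)
  | ite_false P _ _ ih => exact ih.mono fun p hp => (by simp only [Program.writes, Bool.or_eq_false_iff] at hp; exact hp.2)
  | while_false P _ => exact .refl _ _
  | while_true _ _ _ ih ih' => exact Frame.trans (ih.mono fun p hp => hp) ih'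

theorem Ends.mono {P : Program} {σ : Memory} {Q Q' : ℕ → Memory → Prop} (h : Ends P σ Q)
    (hQ : ∀ t τ, Frame P σ τ → Q t τ → Q' t τ) : Ends P σ Q' := by
  obtain ⟨t, τ, hr, hq⟩ := h
  exact ⟨t, τ, hr, hQ t τ hr.frame hq⟩

theorem ends_skip {σ : Memory} {Q : ℕ → Memory → Prop} : Ends .skip σ Q ↔ Q 1 σ :=
  ⟨by rintro ⟨t, τ, ⟨⟩, h⟩; exact h, fun h => ⟨_, _, .skip σ, h⟩⟩

theorem ends_nset {x : ℕ} {e : NExp} {σ : Memory} {Q : ℕ → Memory → Prop} :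
    Ends (.nset x e) σ Q ↔
      Q (e.steps + 1) { σ with nreg := Function.update σ.nreg x (e.eval σ) } :=
  ⟨by rintro ⟨t, τ, ⟨⟩, h⟩; exact h, fun h => ⟨_, _, .nset x e σ, h⟩⟩

theorem ends_rset {x : ℕ} {e : RExp} {σ : Memory} {Q : ℕ → Memory → Prop} :
    Ends (.rset x e) σ Q ↔
      Q (e.steps + 1) { σ with rreg := Function.update σ.rreg x (e.eval σ) } :=
  ⟨by rintro ⟨t, τ, ⟨⟩, h⟩; exact h, fun h => ⟨_, _, .rset x e σ, h⟩⟩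

theorem ends_nput {a : ℕ} {i e : NExp} {σ : Memory} {Q : ℕ → Memory → Prop} :
    Ends (.nput a i e) σ Q ↔ Q (i.steps + e.steps + 1)
      { σ with
        narr := Function.update σ.narr a (Function.update (σ.narr a) (i.eval σ) (e.eval σ)) } :=
  ⟨by rintro ⟨t, τ, ⟨⟩, h⟩; exact h, fun h => ⟨_, _, .nput a i e σ, h⟩⟩

theorem ends_rput {a : ℕ} {i : NExp} {e : RExp} {σ : Memory} {Q : ℕ → Memory → Prop} :
    Ends (.rput a i e) σ Q ↔ Q (i.steps + e.steps + 1)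
      { σ with
        rarr := Function.update σ.rarr a (Function.update (σ.rarr a) (i.eval σ) (e.eval σ)) } :=
  ⟨by rintro ⟨t, τ, ⟨⟩, h⟩; exact h, fun h => ⟨_, _, .rput a i e σ, h⟩⟩

theorem ends_seq {P R : Program} {σ : Memory} {Q : ℕ → Memory → Prop} :
    Ends (.seq P R) σ Q ↔ Ends P σ fun s τ => Ends R τ fun t υ => Q (s + t) υ := by
  constructor
  · rintro ⟨t, τ, h, hQ⟩
    cases h with
    | seq h₁ h₂ => exact ⟨_, _, h₁, _, _, h₂, hQ⟩
  · rintro ⟨_, _, h₁, _, _, h₂, hQ⟩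
    exact ⟨_, _, .seq h₁ h₂, hQ⟩

theorem ends_ite {b : Test} {P R : Program} {σ : Memory} {Q : ℕ → Memory → Prop} :
    Ends (.ite b P R) σ Q ↔ (b.Holds σ → Ends P σ fun t τ => Q (b.steps + 1 + t) τ) ∧
      (¬ b.Holds σ → Ends R σ fun t τ => Q (b.steps + 1 + t) τ) := by
  constructor
  · rintro ⟨t, τ, h, hQ⟩
    cases h with
    | ite_true _ hb h => exact ⟨fun _ => ⟨_, _, h, hQ⟩, fun hb' => absurd hb hb'⟩
    | ite_false _ hb h => exact ⟨fun hb' => absurd hb' hb, fun _ => ⟨_, _, h, hQ⟩⟩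
  · rintro ⟨h₁, h₂⟩
    by_cases hb : b.Holds σ
    · obtain ⟨t, τ, h, hQ⟩ := h₁ hb
      exact ⟨_, _, .ite_true _ hb h, hQ⟩
    · obtain ⟨t, τ, h, hQ⟩ := h₂ hb
      exact ⟨_, _, .ite_false _ hb h, hQ⟩

/-- Total correctness with a known number `n` of rounds. The `Frame` premise supplies everything the
body does not write, so the invariant `I` only describes what changes. -/
theorem ends_while {b : Test} {P : Program} (n : ℕ) (I : ℕ → Memory → Prop) (B : ℕ → ℕ)
    {σ : Memory} (h₀ : I 0 σ)
    (hstep : ∀ j < n, ∀ τ, Frame P σ τ → I j τ →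
      b.Holds τ ∧ Ends P τ fun t υ => t ≤ B j ∧ I (j + 1) υ)
    (hend : ∀ τ, Frame P σ τ → I n τ → ¬ b.Holds τ) :
    Ends (.while b P) σ fun t τ =>
      t ≤ ∑ j ∈ Finset.range n, (B j + b.steps + 1) + (b.steps + 1) ∧ I n τ := by
  induction n generalizing σ I B with
  | zero => exact ⟨_, _, .while_false P (hend σ (.refl _ _) h₀), by simp, h₀⟩
  | succ n ih =>
    obtain ⟨hb, s, τ, hr, hs, hI⟩ := hstep 0 n.succ_pos σ (.refl _ _) h₀
    obtain ⟨t, υ, hr', ht, hI'⟩ := ih (fun j => I (j + 1)) (fun j => B (j + 1)) hI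
      (fun j hj τ' hf hI => hstep (j + 1) (Nat.succ_lt_succ hj) τ' (hr.frame.trans hf) hI)
      (fun τ' hf hI => hend τ' (hr.frame.trans hf) hI)
    refine ⟨_, _, .while_true hb hr hr', ?_, hI'⟩
    rw [Finset.sum_range_succ']
    omega

/-- Execute `P` for the values `0, 1, …` of register `x` that are less than `e`. -/
def forLoop (x : ℕ) (e : NExp) (P : Program) : Program :=
  .seq (.nset x (.lit 0)) (.while (.nle (.add (.reg x) (.lit 1)) e)
    (.seq P (.nset x (.add (.reg x) (.lit 1)))))

/-- The overhead per round is `e.steps + 5` for the test and `4` for the counter; outside the rounds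
it is `2` for the initialization and a final failing test. The bound is evaluated in every round,
hence `he` for all memories in the frame. -/
theorem ends_forLoop {x : ℕ} {e : NExp} {P : Program} {σ : Memory} (n : ℕ)
    (I : ℕ → Memory → Prop) (B : ℕ → ℕ) (hx : P.writes (.nreg x) = false)
    (he : ∀ τ, Frame (forLoop x e P) σ τ → e.eval τ = n)
    (h₀ : I 0 { σ with nreg := Function.update σ.nreg x 0 })
    (hstep : ∀ j < n, ∀ τ, Frame (forLoop x e P) σ τ → τ.nreg x = j → I j τ →
      Ends P τ fun t υ => t ≤ B j ∧ I (j + 1) { υ with nreg := Function.update υ.nreg x (j + 1) }) :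
    Ends (forLoop x e P) σ fun t τ =>
      t ≤ ∑ j ∈ Finset.range n, (B j + (e.steps + 9)) + (e.steps + 7) ∧ I n τ := by
  unfold forLoop
  rw [ends_seq, ends_nset]
  have hf₀ : Frame (forLoop x e P) σ { σ with nreg := Function.update σ.nreg x 0 } := by
    refine ⟨fun y hy => ?_, fun _ _ => rfl, fun _ _ => rfl, fun _ _ => rfl⟩
    exact Function.update_of_ne (by
      rintro rfl
      simp [forLoop, Program.writes] at hy) _ _
  have hmono : ∀ p, (forLoop x e P).writes p = false →
      (Program.seq P (.nset x (.add (.reg x) (.lit 1)))).writes p = false := by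
    intro p hp
    simp [forLoop, Program.writes] at hp ⊢
    tauto
  refine (ends_while n (fun j τ => τ.nreg x = j ∧ I j τ) (fun j => B j + 4) ?_ ?_ ?_).mono ?_
  · exact ⟨by simp [NExp.eval], h₀⟩
  · rintro j hj τ hf ⟨hxj, hI⟩
    have hf' : Frame (forLoop x e P) σ τ := hf₀.trans (hf.mono hmono)
    refine ⟨?_, ?_⟩
    · simp only [Test.Holds, NExp.eval, he τ hf', hxj]
      omega
    · rw [ends_seq]
      refine (hstep j hj τ hf' hxj hI).mono fun t υ hfυ h => ?_
      rw [ends_nset]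
      have : υ.nreg x = j := (hfυ.nreg x hx).trans hxj
      simp only [NExp.eval, NExp.steps, this]
      exact ⟨by omega, by simp, h.2⟩
  · rintro τ hf ⟨hxj, hI⟩
    simp only [Test.Holds, NExp.eval, he τ (hf₀.trans (hf.mono hmono)), hxj]
    omega
  · rintro t τ - ⟨ht, -, hI⟩
    refine ⟨?_, hI⟩
    refine (Nat.add_le_add_left ht _).trans ?_
    simp only [NExp.steps, Test.steps]
    have : ∀ j, B j + 4 + (1 + 1 + 1 + e.steps + 1) + 1 = B j + (e.steps + 9) := fun j => by omega
    simp only [this]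
    omega

end MSM

namespace MSM

infixr:50 " ;; " => Program.seq

attribute [simp] ends_skip ends_nset ends_rset ends_nput ends_rput ends_seq ends_ite NExp.eval
  RExp.eval Test.Holds NExp.steps RExp.steps Test.steps

/-! ### The program

The natural registers hold: 0 the number `k` of time series, 1 the length of the output, 2 the
number `M` of points, 3 the number `N`, 4 the size of the table, 5 the current address, 6 and 7 loop
counters, 8 the number of listed subsets, 9 and 10 parameters of the scan of the listed subsets,
11 whether a candidate has been found, 12 the address of the best candidate plus one, 13 the index
of the previous mean value, 14 an auxiliary value, 15 the number of radices or the next address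
of the traceback.

The natural arrays hold: 0 the lengths, 1 the radices, 2 the strides, 3 the digits of the current
address, 4 the offsets of the time series, 5 the offsets of the listed subsets, 6 the address of
the predecessor of a table entry plus one, 7 and 8 the mean position and the mean value of a table
entry.

The real registers hold: 0 the cost `c`, 1 the current mean value, 2 the best candidate, 4 to 6
points. The real arrays hold: 0 the points, 1 the output, 2 the table, 3 and 4 the costs of the time
series inside and outside of the chosen subset, 5 the costs of the listed subsets. -/

/-- Write the distance of the real registers `x` and `y` to cell `i` of array `a`, where `i` is in
natural register 6. -/
def absDiff (a x y : ℕ) : Program :=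
  .ite (.rle (.reg x) (.reg y)) (.rput a (.reg 6) (.sub (.reg y) (.reg x)))
    (.rput a (.reg 6) (.sub (.reg x) (.reg y)))

/-- Write the step cost of the real registers `x`, `x'` and `y` to cell `i` of array `a`, where `i`
is in natural register 6. -/
def branchCost (a x x' y : ℕ) : Program :=
  .ite (.rle (.reg x') (.reg x))
    (.ite (.rle (.reg x) (.reg y)) (.rput a (.reg 6) (.reg 0))
      (.ite (.rle (.reg x') (.reg y))
        (.rput a (.reg 6) (.add (.reg 0) (.sub (.reg x) (.reg y))))
        (.rput a (.reg 6) (.add (.reg 0) (.sub (.reg x) (.reg x'))))))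
    (.ite (.rle (.reg y) (.reg x)) (.rput a (.reg 6) (.reg 0))
      (.ite (.rle (.reg x') (.reg y))
        (.rput a (.reg 6) (.add (.reg 0) (.sub (.reg x') (.reg x))))
        (.rput a (.reg 6) (.add (.reg 0) (.sub (.reg y) (.reg x))))))

/-- Compare the best candidate with the one that extends the table entry at address `e` by `w`. -/
def consider (e : NExp) (w : RExp) : Program :=
  .ite (.and (.nle (.lit 1) (.reg 11)) (.rle (.reg 2) (.add (.get 2 e) w))) .skip
    (.rset 2 (.add (.get 2 e) w) ;; .nset 12 (.add e (.lit 1)) ;; .nset 11 (.lit 1))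

/-- List the costs and offsets of all sets of time series that are not at their first point. -/
def listSubsets : Program :=
  .nset 8 (.lit 1) ;; .rput 5 (.lit 0) .zero ;; .nput 5 (.lit 0) (.lit 0) ;;
  forLoop 6 (.reg 0)
    (.ite (.nle (.lit 1) (.get 3 (.add (.reg 6) (.lit 2))))
      (forLoop 7 (.reg 8)
        (.rput 5 (.add (.reg 8) (.reg 7)) (.add (.get 5 (.reg 7)) (.get 3 (.reg 6))) ;;
        .nput 5 (.add (.reg 8) (.reg 7))
          (.add (.get 5 (.reg 7)) (.get 2 (.add (.reg 6) (.lit 2)))) ;;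
        .rput 5 (.reg 7) (.add (.get 5 (.reg 7)) (.get 4 (.reg 6)))) ;;
      .nset 8 (.add (.reg 8) (.reg 8)))
      (forLoop 7 (.reg 8) (.rput 5 (.reg 7) (.add (.get 5 (.reg 7)) (.get 4 (.reg 6))))))

/-- Consider the candidates given by the listed subsets. -/
def scanSubsets : Program :=
  forLoop 7 (.reg 8) (.ite (.nle (.reg 10) (.reg 7))
    (consider (.sub (.reg 9) (.get 5 (.reg 7))) (.get 5 (.reg 7))) .skip)

/-! ### Correctness of the subroutines -/

theorem ends_absDiff {a x y : ℕ} {σ : Memory} {Q : ℕ → Memory → Prop}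
    (h : ∀ t ≤ 20, Q t { σ with
      rarr := Function.update σ.rarr a
        (Function.update (σ.rarr a) (σ.nreg 6) |σ.rreg x - σ.rreg y|) }) :
    Ends (absDiff a x y) σ Q := by
  simp only [absDiff, ends_ite, Test.Holds, RExp.eval, ends_rput, NExp.eval]
  refine ⟨fun hxy => ?_, fun hxy => ?_⟩
  · rw [← neg_sub, ← abs_of_nonpos (sub_nonpos.2 hxy)]
    exact h _ (by simp)
  · rw [← abs_of_nonneg (sub_nonneg.2 (not_le.1 hxy).le)]
    exact h _ (by simp)

theorem ends_branchCost {a x x' y : ℕ} {σ : Memory} {Q : ℕ → Memory → Prop}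
    (h : ∀ t ≤ 40, Q t { σ with
      rarr := Function.update σ.rarr a (Function.update (σ.rarr a) (σ.nreg 6)
        (stepCost (σ.rreg 0) (σ.rreg x) (σ.rreg x') (σ.rreg y))) }) :
    Ends (branchCost a x x' y) σ Q := by
  have key : ∀ s r, r = stepCost (σ.rreg 0) (σ.rreg x) (σ.rreg x') (σ.rreg y) → s ≤ 40 →
      Q s { σ with rarr := Function.update σ.rarr a (Function.update (σ.rarr a) (σ.nreg 6) r) } := by
    rintro s r rfl hs
    exact h s hs
  simp only [branchCost, ends_ite, Test.Holds, RExp.eval, ends_rput, NExp.eval]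
  refine ⟨fun h₁ => ⟨fun h₂ => ?_, fun h₂ => ⟨fun h₃ => ?_, fun h₃ => ?_⟩⟩,
    fun h₁ => ⟨fun h₂ => ?_, fun h₂ => ⟨fun h₃ => ?_, fun h₃ => ?_⟩⟩⟩ <;>
  refine key _ _ ?_ (by simp) <;>
  · rw [stepCost_eq_gap]
    unfold gap
    grind

theorem NExp.eval_rreg (σ : Memory) (r : ℕ → ℝ) (e : NExp) :
    e.eval { σ with rreg := r } = e.eval σ := by
  induction e with
  | lit n => rfl
  | reg x => rfl
  | get a e ih => simp only [NExp.eval, ih]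
  | add e₁ e₂ ih₁ ih₂ => simp only [NExp.eval, ih₁, ih₂]
  | sub e₁ e₂ ih₁ ih₂ => simp only [NExp.eval, ih₁, ih₂]

/-- The registers hold the best of the candidates in `A`, if there are any. -/
def Best (A : Set (ℝ × ℕ)) (σ : Memory) : Prop :=
  (σ.nreg 11 = 0 ∧ A = ∅) ∨ (σ.nreg 11 = 1 ∧
    ∃ b, σ.nreg 12 = b + 1 ∧ (σ.rreg 2, b) ∈ A ∧ ∀ q ∈ A, σ.rreg 2 ≤ q.1)

theorem Best.congr {A : Set (ℝ × ℕ)} {σ τ : Memory} (h : Best A σ)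
    (h₁ : τ.nreg 11 = σ.nreg 11) (h₂ : τ.nreg 12 = σ.nreg 12) (h₃ : τ.rreg 2 = σ.rreg 2) :
    Best A τ := by
  unfold Best
  rwa [h₁, h₂, h₃]

/-- There is no infinite real to start a minimum with, so register 11 records whether register 2 is
meaningful yet. -/
theorem ends_consider {e : NExp} {w : RExp} {A : Set (ℝ × ℕ)} {σ : Memory} (h : Best A σ) :
    Ends (consider e w) σ fun t τ => t ≤ 3 * e.steps + 2 * w.steps + 30 ∧
      Best (insert (σ.rarr 2 (e.eval σ) + w.eval σ, e.eval σ) A) τ := by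
  simp only [consider, ends_ite, Test.Holds, ends_skip, ends_seq, ends_rset, ends_nset, NExp.eval,
    RExp.eval, NExp.steps, RExp.steps, Test.steps, NExp.eval_rreg]
  refine ⟨fun hb => ⟨by omega, ?_⟩, fun hb => ⟨by omega, ?_⟩⟩
  · rcases h with ⟨h₁, -⟩ | ⟨h₁, b, h₂, h₃, h₄⟩
    · omega
    · refine .inr ⟨h₁, b, h₂, Set.mem_insert_of_mem _ h₃, fun q hq => ?_⟩
      rcases Set.mem_insert_iff.1 hq with rfl | hq
      · exact hb.2
      · exact h₄ q hq
  · refine .inr ⟨by simp, e.eval σ, by simp, by simp, fun q hq => ?_⟩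
    simp only [Function.update_self]
    rcases Set.mem_insert_iff.1 hq with rfl | hq
    · exact le_rfl
    · rcases h with ⟨-, rfl⟩ | ⟨h₁, b, h₂, h₃, h₄⟩
      · exact absurd hq (Set.notMem_empty q)
      · have : ¬ σ.rreg 2 ≤ σ.rarr 2 (e.eval σ) + w.eval σ := fun hle => hb ⟨by omega, hle⟩
        exact (not_le.1 this).le.trans (h₄ q hq)

theorem ends_scanSubsets {A : Set (ℝ × ℕ)} {σ : Memory} (h : Best A σ) :
    Ends scanSubsets σ fun t τ => t ≤ 80 * σ.nreg 8 + 10 ∧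
      Best (A ∪ {q | ∃ s < σ.nreg 8, σ.nreg 10 ≤ s ∧
        q = (σ.rarr 2 (σ.nreg 9 - σ.narr 5 s) + σ.rarr 5 s, σ.nreg 9 - σ.narr 5 s)}) τ := by
  let G : ℕ → ℝ × ℕ := fun s =>
    (σ.rarr 2 (σ.nreg 9 - σ.narr 5 s) + σ.rarr 5 s, σ.nreg 9 - σ.narr 5 s)
  refine (ends_forLoop (σ.nreg 8)
    (fun j τ => Best (A ∪ {q | ∃ s < j, σ.nreg 10 ≤ s ∧ q = G s}) τ) (fun _ => 60) rfl
    (fun τ hf => by exact hf.nreg 8 rfl) ?_ ?_).mono ?_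
  · have : {q | ∃ s < 0, σ.nreg 10 ≤ s ∧ q = G s} = ∅ := by simp
    rw [this, Set.union_empty]
    exact h.congr rfl rfl rfl
  · intro j hj τ hf hτj hI
    have hsucc : A ∪ {q | ∃ s < j + 1, σ.nreg 10 ≤ s ∧ q = G s} =
        if σ.nreg 10 ≤ j then insert (G j) (A ∪ {q | ∃ s < j, σ.nreg 10 ≤ s ∧ q = G s})
        else A ∪ {q | ∃ s < j, σ.nreg 10 ≤ s ∧ q = G s} := by
      ext q
      split_ifs with hle
      · simp only [Set.mem_union, Set.mem_ofPred_eq, Set.mem_insert_iff, Nat.lt_succ_iff_lt_or_eq]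
        constructor
        · rintro (h | ⟨s, h | rfl, h', rfl⟩)
          · exact .inr (.inl h)
          · exact .inr (.inr ⟨s, h, h', rfl⟩)
          · exact .inl rfl
        · rintro (rfl | h | ⟨s, h, h', rfl⟩)
          · exact .inr ⟨j, .inr rfl, hle, rfl⟩
          · exact .inl h
          · exact .inr ⟨s, .inl h, h', rfl⟩
      · simp only [Set.mem_union, Set.mem_ofPred_eq, Nat.lt_succ_iff_lt_or_eq]
        constructor
        · rintro (h | ⟨s, h | rfl, h', rfl⟩)
          · exact .inl h
          · exact .inr ⟨s, h, h', rfl⟩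
          · exact absurd h' hle
        · rintro (h | ⟨s, h, h', rfl⟩)
          · exact .inl h
          · exact .inr ⟨s, .inl h, h', rfl⟩
    have e₁ : τ.nreg 10 = σ.nreg 10 := hf.nreg 10 rfl
    have e₂ : τ.nreg 9 = σ.nreg 9 := hf.nreg 9 rfl
    have e₃ : τ.narr 5 = σ.narr 5 := hf.narr 5 rfl
    have e₄ : τ.rarr 5 = σ.rarr 5 := hf.rarr 5 rfl
    have e₅ : τ.rarr 2 = σ.rarr 2 := hf.rarr 2 rfl
    rw [ends_ite]
    simp only [Test.Holds, NExp.eval, e₁, hτj, hsucc]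
    refine ⟨fun hle => ?_, fun hle => ?_⟩
    · rw [if_pos hle]
      refine (ends_consider hI).mono fun t υ _ ⟨ht, hb⟩ => ⟨?_, ?_⟩
      · simp only [NExp.steps, RExp.steps, Test.steps] at ht ⊢
        omega
      · simp only [NExp.eval, RExp.eval, e₂, e₃, e₄, e₅, hτj] at hb
        exact hb.congr rfl rfl rfl
    · rw [if_neg hle, ends_skip]
      exact ⟨by simp, hI.congr rfl rfl rfl⟩
  · rintro t τ - ⟨ht, hI⟩
    refine ⟨?_, hI⟩
    simp only [Finset.sum_const, Finset.card_range, smul_eq_mul, NExp.steps] at ht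
    omega

/-- The first `L` cells of `w` and `o` list the costs and offsets of all subsets `S` of
`{i | i < n ∧ 1 ≤ d (i + 2)}`, starting with the empty set. -/
def SubsetList (n : ℕ) (d st : ℕ → ℕ) (α β : ℕ → ℝ) (L : ℕ) (w : ℕ → ℝ) (o : ℕ → ℕ) : Prop :=
  1 ≤ L ∧ L ≤ 2 ^ n ∧ ∃ E : ℕ → Finset ℕ,
    (∀ s < L, (∀ i ∈ E s, i < n ∧ 1 ≤ d (i + 2)) ∧ (E s = ∅ ↔ s = 0) ∧
      w s = ∑ i ∈ Finset.range n, (if i ∈ E s then α i else β i) ∧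
      o s = ∑ i ∈ Finset.range n, if i ∈ E s then st (i + 2) else 0) ∧
    ∀ S : Finset ℕ, (∀ i ∈ S, i < n ∧ 1 ≤ d (i + 2)) → ∃ s < L, E s = S

theorem subsetList_zero {d st : ℕ → ℕ} {α β : ℕ → ℝ} {w : ℕ → ℝ} {o : ℕ → ℕ} (hw : w 0 = 0)
    (ho : o 0 = 0) : SubsetList 0 d st α β 1 w o := by
  refine ⟨le_rfl, le_rfl, fun _ => ∅, fun s hs => ?_, fun S hS => ⟨0, one_pos, ?_⟩⟩
  · obtain rfl : s = 0 := by omega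
    simp [hw, ho]
  · rw [eq_comm, Finset.eq_empty_iff_forall_notMem]
    exact fun i hi => by have := (hS i hi).1; omega

/-- A series at its first point cannot go back, since position `0` has entry `⊤`. It stays outside
of every subset and contributes `β n` to each. -/
theorem SubsetList.skip {n : ℕ} {d st : ℕ → ℕ} {α β : ℕ → ℝ} {L : ℕ} {w w' : ℕ → ℝ}
    {o : ℕ → ℕ} (h : SubsetList n d st α β L w o) (hd : ¬ 1 ≤ d (n + 2))
    (hw : ∀ s < L, w' s = w s + β n) : SubsetList (n + 1) d st α β L w' o := by
  obtain ⟨h₁, h₂, E, hE, hS⟩ := h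
  refine ⟨h₁, h₂.trans (Nat.pow_le_pow_right two_pos n.le_succ), E, fun s hs => ?_,
    fun S hS' => ?_⟩
  · obtain ⟨ha, hb, hc, he⟩ := hE s hs
    have hn : n ∉ E s := fun hn => (lt_irrefl n (ha n hn).1)
    refine ⟨fun i hi => ⟨(ha i hi).1.trans n.lt_succ_self, (ha i hi).2⟩, hb, ?_, ?_⟩
    · rw [Finset.sum_range_succ, if_neg hn, hw s hs, hc]
    · rw [Finset.sum_range_succ, if_neg hn, he, add_zero]
  · refine hS S fun i hi => ⟨?_, (hS' i hi).2⟩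
    have := (hS' i hi).1
    have hne : i ≠ n := by
      rintro rfl
      exact hd (hS' i hi).2
    omega

/-- The old list serves the subsets without `n`, and a shifted copy those with `n`. The empty set
remains at index `0`. -/
theorem SubsetList.double {n : ℕ} {d st : ℕ → ℕ} {α β : ℕ → ℝ} {L : ℕ} {w w' : ℕ → ℝ}
    {o o' : ℕ → ℕ} (h : SubsetList n d st α β L w o) (hd : 1 ≤ d (n + 2))
    (hw : ∀ s < L, w' s = w s + β n) (hw' : ∀ s < L, w' (L + s) = w s + α n)
    (ho : ∀ s < L, o' s = o s) (ho' : ∀ s < L, o' (L + s) = o s + st (n + 2)) :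
    SubsetList (n + 1) d st α β (L + L) w' o' := by
  obtain ⟨h₁, h₂, E, hE, hS⟩ := h
  refine ⟨by omega, by rw [pow_succ]; omega,
    fun s => if s < L then E s else insert n (E (s - L)), fun s hs => ?_, fun S hS' => ?_⟩
  · by_cases hsL : s < L
    · obtain ⟨ha, hb, hc, he⟩ := hE s hsL
      have hn : n ∉ E s := fun hn => (lt_irrefl n (ha n hn).1)
      simp only [if_pos hsL]
      refine ⟨fun i hi => ⟨(ha i hi).1.trans n.lt_succ_self, (ha i hi).2⟩, hb, ?_, ?_⟩
      · rw [Finset.sum_range_succ, if_neg hn, hw s hsL, hc]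
      · rw [Finset.sum_range_succ, if_neg hn, ho s hsL, he, add_zero]
    · obtain ⟨u, rfl⟩ := Nat.exists_eq_add_of_le (not_lt.1 hsL)
      have hu : u < L := by omega
      obtain ⟨ha, hb, hc, he⟩ := hE u hu
      simp only [if_neg hsL, Nat.add_sub_cancel_left]
      have hmem : ∀ i ∈ Finset.range n, (i ∈ insert n (E u) ↔ i ∈ E u) := fun i hi => by
        rw [Finset.mem_insert, or_iff_right (Finset.mem_range.1 hi).ne]
      refine ⟨fun i hi => ?_, ?_, ?_, ?_⟩
      · rcases Finset.mem_insert.1 hi with rfl | hi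
        · exact ⟨i.lt_succ_self, hd⟩
        · exact ⟨(ha i hi).1.trans n.lt_succ_self, (ha i hi).2⟩
      · simp only [Finset.insert_ne_empty, false_iff]
        omega
      · rw [Finset.sum_range_succ, if_pos (Finset.mem_insert_self _ _), hw' u hu, hc]
        congr 1
        exact Finset.sum_congr rfl fun i hi => by simp only [hmem i hi]
      · rw [Finset.sum_range_succ, if_pos (Finset.mem_insert_self _ _), ho' u hu, he]
        congr 1
        exact Finset.sum_congr rfl fun i hi => by simp only [hmem i hi]
  · have hlt : ∀ i ∈ S.erase n, i < n ∧ 1 ≤ d (i + 2) := fun i hi => by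
      rw [Finset.mem_erase] at hi
      have := hS' i hi.2
      exact ⟨by omega, this.2⟩
    obtain ⟨s, hs, hEs⟩ := hS _ hlt
    by_cases hn : n ∈ S
    · refine ⟨L + s, by omega, ?_⟩
      simp only [if_neg (by omega : ¬ L + s < L), Nat.add_sub_cancel_left, hEs,
        Finset.insert_erase hn]
    · refine ⟨s, by omega, ?_⟩
      simp only [if_pos hs, hEs, Finset.erase_eq_of_notMem hn]

/-- Treating series `i` takes time proportional to the current list, at most `2 ^ i`; the geometric
sum gives `O(2 ^ k)` for all subset costs together. -/
theorem ends_listSubsets (σ : Memory) :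
    Ends listSubsets σ fun t τ => t ≤ 120 * 2 ^ σ.nreg 0 ∧
      SubsetList (σ.nreg 0) (σ.narr 3) (σ.narr 2) (σ.rarr 3) (σ.rarr 4) (τ.nreg 8) (τ.rarr 5)
        (τ.narr 5) := by
  rw [listSubsets]
  simp only [ends_seq, ends_nset, ends_rput, ends_nput, NExp.eval, RExp.eval]
  refine (ends_forLoop (σ.nreg 0) (fun j τ => SubsetList j (σ.narr 3) (σ.narr 2) (σ.rarr 3)
    (σ.rarr 4) (τ.nreg 8) (τ.rarr 5) (τ.narr 5)) (fun j => 50 * 2 ^ j + 30) rfl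
    (fun τ hf => by exact hf.nreg 0 rfl) ?_ ?_).mono ?_
  · exact subsetList_zero (by simp) (by simp)
  · intro i hi τ hf hτi hI
    have e₁ : τ.narr 3 = σ.narr 3 := hf.narr 3 rfl
    have e₂ : τ.narr 2 = σ.narr 2 := hf.narr 2 rfl
    have e₃ : τ.rarr 3 = σ.rarr 3 := hf.rarr 3 rfl
    have e₄ : τ.rarr 4 = σ.rarr 4 := hf.rarr 4 rfl
    obtain ⟨L, hL⟩ : ∃ L, L = τ.nreg 8 := ⟨_, rfl⟩
    have hL2 : L ≤ 2 ^ i := hL ▸ hI.2.1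
    rw [← hL] at hI
    simp only [ends_ite, Test.Holds, NExp.eval, hτi, e₁, ends_seq]
    refine ⟨fun hd => ?_, fun hd => ?_⟩
    -- After `s` rounds the copies `L, …, L + s - 1` are written with `α` added, and the originals
    -- below `s` have `β` added. Each original is copied before it is overwritten.
    · refine (ends_forLoop L (fun s υ => ∀ u,
        υ.rarr 5 u = (if u < s then τ.rarr 5 u + σ.rarr 4 i else
          if L ≤ u ∧ u < L + s then τ.rarr 5 (u - L) + σ.rarr 3 i else τ.rarr 5 u) ∧
        υ.narr 5 u = if L ≤ u ∧ u < L + s then τ.narr 5 (u - L) + σ.narr 2 (i + 2)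
          else τ.narr 5 u) (fun _ => 31) rfl
          (fun υ hf => by exact (hf.nreg 8 rfl).trans hL.symm) ?_ ?_).mono ?_
      · intro u
        simp
      · intro s hs υ hfυ hυs hJ
        have f₁ : υ.nreg 8 = L := (hfυ.nreg 8 rfl).trans hL.symm
        have f₂ : υ.nreg 6 = i := (hfυ.nreg 6 rfl).trans hτi
        have f₃ : υ.rarr 3 = σ.rarr 3 := (hfυ.rarr 3 rfl).trans e₃
        have f₄ : υ.rarr 4 = σ.rarr 4 := (hfυ.rarr 4 rfl).trans e₄
        have f₅ : υ.narr 2 = σ.narr 2 := (hfυ.narr 2 rfl).trans e₂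
        simp [f₁, f₂, f₃, f₄, f₅, hυs, Function.update_apply]
        intro u
        have h₁ := hJ u
        have h₂ := hJ s
        grind
      · rintro t υ hfυ ⟨ht, hJ⟩
        have f₁ : υ.nreg 8 = L := (hfυ.nreg 8 rfl).trans hL.symm
        simp [f₁]
        refine ⟨?_, hI.double hd ?_ ?_ ?_ ?_⟩
        · simp at ht
          omega
        all_goals
          intro s hs
          first | rw [(hJ _).1] | rw [(hJ _).2]
          grind
    · refine (ends_forLoop L (fun s υ => ∀ u,
        υ.rarr 5 u = if u < s then τ.rarr 5 u + σ.rarr 4 i else τ.rarr 5 u) (fun _ => 31) rfl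
          (fun υ hf => by exact (hf.nreg 8 rfl).trans hL.symm) ?_ ?_).mono ?_
      · simp
      · intro s hs υ hfυ hυs hJ
        have f₂ : υ.nreg 6 = i := (hfυ.nreg 6 rfl).trans hτi
        have f₄ : υ.rarr 4 = σ.rarr 4 := (hfυ.rarr 4 rfl).trans e₄
        simp [f₂, f₄, hυs, Function.update_apply]
        intro u
        have h₁ := hJ u
        have h₂ := hJ s
        grind
      · rintro t υ hfυ ⟨ht, hJ⟩
        have f₁ : υ.nreg 8 = L := (hfυ.nreg 8 rfl).trans hL.symm
        have f₃ : υ.narr 5 = τ.narr 5 := hfυ.narr 5 rfl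
        simp [f₁, f₃]
        refine ⟨?_, hI.skip hd fun s hs => ?_⟩
        · simp at ht
          omega
        · rw [hJ s, if_pos hs]
  · rintro t τ - ⟨ht, hI⟩
    refine ⟨?_, hI⟩
    simp only [Finset.sum_add_distrib, ← Finset.mul_sum, Finset.sum_const, Finset.card_range,
      smul_eq_mul, NExp.steps, RExp.steps] at ht ⊢
    have h₁ : ∑ i ∈ Finset.range (σ.nreg 0), 2 ^ i + 1 = 2 ^ σ.nreg 0 := by
      have := Nat.geomSum_eq (le_refl 2) (σ.nreg 0)
      have := Nat.one_le_two_pow (n := σ.nreg 0)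
      omega
    have h₂ := Nat.lt_two_pow_self (n := σ.nreg 0)
    omega

/-- The candidate for extending the table entry at the address that is obtained from `b` by
decreasing the positions in `S` by one. -/
noncomputable def candidate (k : ℕ) (st : ℕ → ℕ) (α β T : ℕ → ℝ) (b : ℕ) (S : Finset ℕ) : ℝ × ℕ :=
  (T (b - ∑ i ∈ Finset.range k, if i ∈ S then st (i + 2) else 0) +
    ∑ i ∈ Finset.range k, (if i ∈ S then α i else β i),
  b - ∑ i ∈ Finset.range k, if i ∈ S then st (i + 2) else 0)

/-- The value `1` in register 10 starts the scan after index `0`, which excludes the empty set, as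
merge steps require; the value `0` admits it. -/
theorem ends_list_scan {A : Set (ℝ × ℕ)} {σ : Memory} (h : Best A σ) (h10 : σ.nreg 10 ≤ 1) :
    Ends (listSubsets ;; scanSubsets) σ fun t τ => t ≤ 210 * 2 ^ σ.nreg 0 ∧
      Best (A ∪ {q | ∃ S : Finset ℕ, (∀ i ∈ S, i < σ.nreg 0 ∧ 1 ≤ σ.narr 3 (i + 2)) ∧
        (σ.nreg 10 = 1 → S.Nonempty) ∧ q = candidate (σ.nreg 0) (σ.narr 2) (σ.rarr 3) (σ.rarr 4)
          (σ.rarr 2) (σ.nreg 9) S}) τ := by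
  rw [ends_seq]
  refine (ends_listSubsets σ).mono ?_
  rintro t₁ τ hf ⟨ht₁, -, hL, E, hE, hS⟩
  have e₁ : τ.nreg 10 = σ.nreg 10 := hf.nreg 10 rfl
  have e₂ : τ.nreg 9 = σ.nreg 9 := hf.nreg 9 rfl
  have e₃ : τ.rarr 2 = σ.rarr 2 := hf.rarr 2 rfl
  refine (ends_scanSubsets (h.congr (hf.nreg 11 rfl) (hf.nreg 12 rfl) (hf.rreg 2 rfl))).mono ?_
  rintro t₂ υ - ⟨ht₂, hB⟩
  have := Nat.one_le_two_pow (n := σ.nreg 0)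
  refine ⟨by omega, ?_⟩
  convert hB using 2
  ext q
  rw [Set.mem_ofPred_eq, Set.mem_ofPred_eq, e₁, e₂, e₃]
  constructor
  · rintro ⟨S, hSv, hne, rfl⟩
    obtain ⟨s, hs, rfl⟩ := hS S hSv
    obtain ⟨-, hb, hc, he⟩ := hE s hs
    refine ⟨s, hs, ?_, by rw [hc, he]; rfl⟩
    by_contra hlt
    have hs0 : s = 0 := by omega
    exact (hne (by omega)).ne_empty (hb.2 hs0)
  · rintro ⟨s, hs, hle, rfl⟩
    obtain ⟨ha, hb, hc, he⟩ := hE s hs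
    refine ⟨E s, ha, fun h1 => ?_, by rw [hc, he]; rfl⟩
    rw [Finset.nonempty_iff_ne_empty, Ne, hb]
    omega

end MSM

namespace MSM

/-! ### Addresses -/

/-! ### Mixed radix notation -/

section MixedRadix

variable (rad : ℕ → ℕ)

theorem sum_mul_prod_lt {d : ℕ → ℕ} {n : ℕ} (h : ∀ i < n, d i < rad i) :
    ∑ i ∈ Finset.range n, d i * ∏ j ∈ Finset.range i, rad j < ∏ j ∈ Finset.range n, rad j := by
  induction n with
  | zero => simp
  | succ n ih =>
    rw [Finset.sum_range_succ, Finset.prod_range_succ]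
    have h₁ := ih fun i hi => h i (hi.trans n.lt_succ_self)
    have h₂ := Nat.mul_le_mul_left (∏ j ∈ Finset.range n, rad j) (h n n.lt_succ_self)
    rw [Nat.mul_succ] at h₂
    rw [mul_comm (d n)]
    omega

/-- Dividing by the product of the first `n` radices isolates the leading digit, because the lower
part is smaller than this product. -/
theorem sum_mul_prod_inj {d e : ℕ → ℕ} {n : ℕ} (hd : ∀ i < n, d i < rad i)
    (he : ∀ i < n, e i < rad i)
    (h : ∑ i ∈ Finset.range n, d i * ∏ j ∈ Finset.range i, rad j =
      ∑ i ∈ Finset.range n, e i * ∏ j ∈ Finset.range i, rad j) : ∀ i < n, d i = e i := by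
  induction n with
  | zero => simp
  | succ n ih =>
    have hd' := fun i (hi : i < n) => hd i (hi.trans n.lt_succ_self)
    have he' := fun i (hi : i < n) => he i (hi.trans n.lt_succ_self)
    have h₁ := sum_mul_prod_lt rad hd'
    have h₂ := sum_mul_prod_lt rad he'
    rw [Finset.sum_range_succ, Finset.sum_range_succ] at h
    have hq := congrArg (· / ∏ j ∈ Finset.range n, rad j) h
    have hpos : 0 < ∏ j ∈ Finset.range n, rad j := by omega
    simp only [Nat.add_mul_div_right _ _ hpos, Nat.div_eq_of_lt h₁, Nat.div_eq_of_lt h₂,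
      zero_add] at hq
    rw [hq] at h
    intro i hi
    rcases Nat.lt_succ_iff_lt_or_eq.1 hi with hi | rfl
    · exact ih hd' he' (by omega) i hi
    · exact hq

end MixedRadix

variable {c : ℝ} {k : ℕ} (X : Fin k → TimeSeries)

/-- The length of the `i`-th time series. -/
def lens (i : ℕ) : ℕ := (List.ofFn fun j => (X j).1.length).getD i 0

/-- The points of all time series, one time series after the other. -/
noncomputable def pts (q : ℕ) : ℝ := (List.ofFn fun j => (X j).1).flatten.getD q 0

/-- The offset of the `i`-th time series in the list of all points. -/
def offs (i : ℕ) : ℕ := ∑ j ∈ Finset.range i, lens X j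

/-- The radices of the digits of an address: the value of the last point of the mean, given as an
index in the list of all points, the length of the mean minus one, and the positions in the time
series minus one. -/
def rad : ℕ → ℕ
  | 0 => offs X k
  | 1 => (maxLength X - 1) * k + 1
  | i + 2 => lens X i

def stride (i : ℕ) : ℕ := ∏ j ∈ Finset.range i, rad X j

/-- The address of the table entry with the given digits. -/
def adr (d : ℕ → ℕ) : ℕ := ∑ i ∈ Finset.range (k + 2), d i * stride X i

def Valid (d : ℕ → ℕ) : Prop := ∀ i < k + 2, d i < rad X i

/-- The positions in the time series that are encoded by the given digits. -/
def pos (k : ℕ) (d : ℕ → ℕ) : Fin k → ℕ := fun i => d (i + 2) + 1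

noncomputable def entry (c : ℝ) (d : ℕ → ℕ) : EReal :=
  table c X (pos k d) (d 1 + 1) (pts X (d 0))

variable {X}

theorem lens_fin (i : Fin k) : lens X i = (X i).1.length := by
  simp [lens]

theorem lens_pos {i : ℕ} (hi : i < k) : 1 ≤ lens X i := by
  rw [show i = ((⟨i, hi⟩ : Fin k) : ℕ) from rfl, lens_fin]
  exact one_le_length _

theorem flatten_getD_add (L : List (List ℝ)) : ∀ (i : ℕ) (hi : i < L.length) (q : ℕ),
    q < L[i].length → L.flatten.getD
      (∑ j ∈ Finset.range i, (L.map List.length).getD j 0 + q) 0 = L[i].getD q 0 := by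
  induction L with
  | nil => intro i hi; simp at hi
  | cons l L ih =>
    intro i hi q hq
    rcases i with _ | i
    · simp only [Finset.range_zero, Finset.sum_empty, zero_add, List.flatten_cons,
        List.getElem_cons_zero] at hq ⊢
      exact List.getD_append _ _ _ _ hq
    · simp only [List.getElem_cons_succ, List.length_cons] at hq hi ⊢
      rw [Finset.sum_range_succ', List.flatten_cons]
      simp only [List.map_cons, List.getD_cons_succ, List.getD_cons_zero]
      rw [List.getD_append_right _ _ _ _ (by omega), ← ih i (by omega) q hq]
      congr 1
      omega

theorem pts_offs (i : Fin k) {q : ℕ} (hq : q < (X i).1.length) :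
    pts X (offs X i + q) = point X i (q + 1) := by
  have h := flatten_getD_add (List.ofFn fun j => (X j).1) i (by simp) q (by simpa using hq)
  rw [List.map_ofFn, List.getElem_ofFn] at h
  exact h

theorem length_flatten_eq_offs : (List.ofFn fun j => (X j).1).flatten.length = offs X k := by
  rw [List.length_flatten, List.map_ofFn, List.sum_ofFn, offs, Finset.sum_range]
  simp [lens_fin]

theorem mem_values_iff {v : ℝ} : v ∈ values X ↔ ∃ j < offs X k, pts X j = v := by
  have h : v ∈ values X ↔ v ∈ (List.ofFn fun j => (X j).1).flatten := by
    simp [values, List.mem_flatten, List.mem_ofFn]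
  rw [h, ← length_flatten_eq_offs, List.mem_iff_getElem]
  constructor
  · rintro ⟨j, hj, rfl⟩
    exact ⟨j, hj, by simp [pts, List.getElem?_eq_getElem hj]⟩
  · rintro ⟨j, hj, rfl⟩
    exact ⟨j, hj, by simp [pts, List.getElem?_eq_getElem hj]⟩

theorem offs_pos (hk : 1 ≤ k) : 1 ≤ offs X k := by
  have := Finset.single_le_sum (f := lens X) (fun _ _ => Nat.zero_le _) (Finset.mem_range.2 hk)
  exact (lens_pos hk).trans this

theorem rad_pos (hk : 1 ≤ k) {i : ℕ} (hi : i < k + 2) : 1 ≤ rad X i := by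
  match i with
  | 0 => exact offs_pos hk
  | 1 => exact Nat.le_add_left _ _
  | i + 2 => exact lens_pos (by omega)

theorem stride_pos (hk : 1 ≤ k) {i : ℕ} (hi : i ≤ k + 2) : 1 ≤ stride X i := by
  unfold stride
  refine Nat.succ_le_of_lt (Finset.prod_pos fun j hj => ?_)
  have := Finset.mem_range.1 hj
  exact rad_pos hk (by omega)

theorem stride_zero : stride X 0 = 1 := rfl

theorem stride_one : stride X 1 = offs X k := by simp [stride, rad]

theorem stride_succ (i : ℕ) : stride X (i + 1) = stride X i * rad X i :=
  Finset.prod_range_succ _ _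

theorem adr_lt {d : ℕ → ℕ} (h : Valid X d) : adr X d < stride X (k + 2) :=
  sum_mul_prod_lt (rad X) h

theorem adr_inj {d e : ℕ → ℕ} (hd : Valid X d) (he : Valid X e) (h : adr X d = adr X e) :
    ∀ i < k + 2, d i = e i :=
  sum_mul_prod_inj (rad X) hd he h

theorem adr_eq (d : ℕ → ℕ) : adr X d = d 0 + d 1 * offs X k +
    ∑ i ∈ Finset.range k, d (i + 2) * stride X (i + 2) := by
  rw [adr, Finset.sum_range_succ', Finset.sum_range_succ', stride_zero, mul_one, zero_add,
    stride_one]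
  simp only [show ∀ i : ℕ, i + 1 + 1 = i + 2 from fun _ => rfl]
  omega

theorem pos_congr {d e : ℕ → ℕ} (h : ∀ i < k + 2, d i = e i) : pos k d = pos k e :=
  funext fun i => by unfold pos; rw [h _ (by omega)]

theorem entry_congr {d e : ℕ → ℕ} (h : ∀ i < k + 2, d i = e i) : entry X c d = entry X c e := by
  unfold entry
  rw [pos_congr h, h 0 (by omega), h 1 (by omega)]

theorem adr_congr {d e : ℕ → ℕ} (h : ∀ i < k + 2, d i = e i) : adr X d = adr X e :=
  Finset.sum_congr rfl fun i hi => by rw [h i (Finset.mem_range.1 hi)]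

theorem point_pos {d : ℕ → ℕ} (hd : Valid X d) (i : Fin k) :
    pts X (offs X i + d (i + 2)) = point X i (pos k d i) := by
  refine pts_offs i ?_
  have := hd (i + 2) (by omega)
  rwa [← lens_fin]

theorem point_pos_sub_one {d : ℕ → ℕ} (hd : Valid X d) (i : Fin k) (hi : 1 ≤ d (i + 2)) :
    pts X (offs X i + d (i + 2) - 1) = point X i (pos k d i - 1) := by
  have := hd (i + 2) (by omega)
  have hlt : d (i + 2) - 1 < (X i).1.length := by
    rw [← lens_fin]
    have : d (i + 2) < lens X i := this
    omega
  rw [Nat.add_sub_assoc hi, pts_offs i hlt]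
  unfold pos
  congr 1
  omega

/-- The digits of a predecessor. -/
def back (d : ℕ → ℕ) (S : Finset ℕ) (l j : ℕ) : ℕ → ℕ
  | 0 => j
  | 1 => l
  | i + 2 => if i ∈ S then d (i + 2) - 1 else d (i + 2)

/-- The set of indices in `Fin k` that belong to `S`. -/
def finSet (k : ℕ) (S : Finset ℕ) : Finset (Fin k) := Finset.univ.filter fun i => (i : ℕ) ∈ S

theorem mem_finSet {S : Finset ℕ} {i : Fin k} : i ∈ finSet k S ↔ (i : ℕ) ∈ S := by simp [finSet]

theorem finSet_map (S : Finset (Fin k)) : finSet k (S.map Fin.valEmbedding) = S := by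
  ext i
  simp [finSet, Fin.val_inj]

theorem sum_range_ite (S : Finset ℕ) (α β : ℕ → ℝ) :
    ∑ i ∈ Finset.range k, (if i ∈ S then α i else β i) =
      ∑ i ∈ finSet k S, α i + ∑ i ∈ (finSet k S)ᶜ, β i := by
  rw [Finset.sum_range, Finset.sum_ite]
  congr 2
  ext i
  simp [finSet]

theorem pos_back (d : ℕ → ℕ) (S : Finset ℕ) (l j : ℕ) (hS : ∀ i ∈ S, 1 ≤ d (i + 2)) :
    pos k (back d S l j) = decr (pos k d) (finSet k S) := by
  funext i
  simp only [pos, back, decr, mem_finSet]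
  split_ifs with h
  · have := hS i h
    omega
  · rfl

theorem valid_back {d : ℕ → ℕ} (hd : Valid X d) (S : Finset ℕ) {l j : ℕ}
    (hl : l < (maxLength X - 1) * k + 1) (hj : j < offs X k) : Valid X (back d S l j) := by
  intro i hi
  match i with
  | 0 => exact hj
  | 1 => exact hl
  | i + 2 =>
    have := hd (i + 2) hi
    change (if i ∈ S then d (i + 2) - 1 else d (i + 2)) < _
    split_ifs <;> omega

/-- Stated as an addition, so that truncated subtraction plays no role. -/
theorem adr_back (d : ℕ → ℕ) (S : Finset ℕ) (l j : ℕ) (hS : ∀ i ∈ S, 1 ≤ d (i + 2)) :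
    adr X (back d S l j) + ∑ i ∈ Finset.range k, (if i ∈ S then stride X (i + 2) else 0) =
      j + l * offs X k + ∑ i ∈ Finset.range k, d (i + 2) * stride X (i + 2) := by
  rw [adr_eq, add_assoc, ← Finset.sum_add_distrib]
  simp only [back]
  congr 1
  refine Finset.sum_congr rfl fun i _ => ?_
  split_ifs with h
  · obtain ⟨q, hq⟩ := Nat.exists_eq_add_of_le (hS i h)
    rw [hq, Nat.add_sub_cancel_left]
    ring
  · rfl

/-- The candidates of the steps in which some time series merge and all others pause. -/
def mergeSet (X : Fin k → TimeSeries) (c : ℝ) (T : ℕ → ℝ) (d : ℕ → ℕ) : Set (ℝ × ℕ) :=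
  {q | ∃ S : Finset ℕ, (∀ i ∈ S, i < k ∧ 1 ≤ d (i + 2)) ∧ S.Nonempty ∧
    q = candidate k (stride X) (fun i => stepCost c (pts X (offs X i + d (i + 2)))
      (pts X (offs X i + d (i + 2) - 1)) (pts X (d 0))) (fun _ => 0) T (adr X d) S}

/-- The candidates of the steps from the value with index `j` in which some time series move and all
others split. -/
def stepSet (X : Fin k → TimeSeries) (c : ℝ) (T : ℕ → ℝ) (d : ℕ → ℕ) (j : ℕ) : Set (ℝ × ℕ) :=
  {q | ∃ S : Finset ℕ, (∀ i ∈ S, i < k ∧ 1 ≤ d (i + 2)) ∧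
    q = candidate k (stride X) (fun i => |pts X (offs X i + d (i + 2)) - pts X (d 0)|)
      (fun i => stepCost c (pts X (d 0)) (pts X (offs X i + d (i + 2))) (pts X j)) T
      (adr X d + j - (d 0 + offs X k)) S}

theorem candidate_congr {st st' : ℕ → ℕ} {α α' β β' : ℕ → ℝ} {T : ℕ → ℝ} {b : ℕ} {S : Finset ℕ}
    (h₁ : ∀ i < k, st (i + 2) = st' (i + 2)) (h₂ : ∀ i < k, α i = α' i)
    (h₃ : ∀ i < k, β i = β' i) : candidate k st α β T b S = candidate k st' α' β' T b S := by
  unfold candidate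
  have e₁ : ∑ i ∈ Finset.range k, (if i ∈ S then st (i + 2) else 0) =
      ∑ i ∈ Finset.range k, if i ∈ S then st' (i + 2) else 0 :=
    Finset.sum_congr rfl fun i hi => by rw [h₁ i (Finset.mem_range.1 hi)]
  have e₂ : ∑ i ∈ Finset.range k, (if i ∈ S then α i else β i) =
      ∑ i ∈ Finset.range k, if i ∈ S then α' i else β' i :=
    Finset.sum_congr rfl fun i hi => by
      rw [h₂ i (Finset.mem_range.1 hi), h₃ i (Finset.mem_range.1 hi)]
  rw [e₁, e₂]

/-- The step from the table entry `d'` to the table entry `d` has cost `w`. -/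
def Transition (X : Fin k → TimeSeries) (c : ℝ) (d' d : ℕ → ℕ) (w : ℝ) : Prop :=
  (d' 0 = d 0 ∧ d' 1 = d 1 ∧ ∃ S : Finset (Fin k), pos k d' = decr (pos k d) S ∧
    w = ∑ i ∈ S, stepCost c (point X i (pos k d i)) (point X i (pos k d i - 1)) (pts X (d 0))) ∨
  (d' 1 + 1 = d 1 ∧ ∃ S : Finset (Fin k), pos k d' = decr (pos k d) S ∧
    w = ∑ i ∈ S, |point X i (pos k d i) - pts X (d 0)| +
      ∑ i ∈ Sᶜ, stepCost c (pts X (d 0)) (point X i (pos k d i)) (pts X (d' 0)))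

/-- The predecessor has a smaller address because a nonempty `S` lowers a digit and raises none. -/
theorem merge_candidate (hk : 1 ≤ k) {T : ℕ → ℝ} {d : ℕ → ℕ} (hd : Valid X d) {S : Finset ℕ}
    (hS : ∀ i ∈ S, i < k ∧ 1 ≤ d (i + 2)) (hne : S.Nonempty) :
    Valid X (back d S (d 1) (d 0)) ∧ adr X (back d S (d 1) (d 0)) < adr X d ∧
      candidate k (stride X) (fun i => stepCost c (pts X (offs X i + d (i + 2)))
        (pts X (offs X i + d (i + 2) - 1)) (pts X (d 0))) (fun _ => 0) T (adr X d) S =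
      (T (adr X (back d S (d 1) (d 0))) + ∑ i ∈ finSet k S, stepCost c (point X i (pos k d i))
        (point X i (pos k d i - 1)) (pts X (d 0)), adr X (back d S (d 1) (d 0))) := by
  have h := adr_back (X := X) d S (d 1) (d 0) fun i hi => (hS i hi).2
  rw [← adr_eq] at h
  have hpos : 0 < ∑ i ∈ Finset.range k, (if i ∈ S then stride X (i + 2) else 0) := by
    obtain ⟨i, hi⟩ := hne
    have hik := (hS i hi).1
    refine Finset.sum_pos' (fun _ _ => Nat.zero_le _) ⟨i, Finset.mem_range.2 hik, ?_⟩
    rw [if_pos hi]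
    exact stride_pos hk (by omega)
  refine ⟨valid_back hd S (hd 1 (by omega)) (hd 0 (by omega)), by omega, ?_⟩
  unfold candidate
  rw [← h, Nat.add_sub_cancel, sum_range_ite, Finset.sum_const_zero, add_zero]
  congr 2
  refine Finset.sum_congr rfl fun i hi => ?_
  rw [point_pos hd, point_pos_sub_one hd i (hS i (mem_finSet.1 hi)).2]

/-- The value digit may rise to `j`, but it is the lowest digit: lowering the length digit by one
outweighs it, even if `S` is empty. -/
theorem step_candidate {T : ℕ → ℝ} {d : ℕ → ℕ} (hd : Valid X d) (hd1 : 1 ≤ d 1) {j : ℕ}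
    (hj : j < offs X k) {S : Finset ℕ} (hS : ∀ i ∈ S, i < k ∧ 1 ≤ d (i + 2)) :
    Valid X (back d S (d 1 - 1) j) ∧ adr X (back d S (d 1 - 1) j) < adr X d ∧
      candidate k (stride X) (fun i => |pts X (offs X i + d (i + 2)) - pts X (d 0)|)
        (fun i => stepCost c (pts X (d 0)) (pts X (offs X i + d (i + 2))) (pts X j)) T
        (adr X d + j - (d 0 + offs X k)) S =
      (T (adr X (back d S (d 1 - 1) j)) + (∑ i ∈ finSet k S, |point X i (pos k d i) - pts X (d 0)| +
        ∑ i ∈ (finSet k S)ᶜ, stepCost c (pts X (d 0)) (point X i (pos k d i)) (pts X j)),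
        adr X (back d S (d 1 - 1) j)) := by
  have h := adr_back (X := X) d S (d 1 - 1) j fun i hi => (hS i hi).2
  have hadr := adr_eq (X := X) d
  obtain ⟨l, hl⟩ := Nat.exists_eq_add_of_le hd1
  have hl' : d 1 * offs X k = offs X k + l * offs X k := by rw [hl]; ring
  have hl'' : d 1 - 1 = l := by omega
  rw [hl''] at h ⊢
  have hb : adr X d + j - (d 0 + offs X k) = adr X (back d S l j) +
      ∑ i ∈ Finset.range k, (if i ∈ S then stride X (i + 2) else 0) := by omega
  have hd1' : d 1 < (maxLength X - 1) * k + 1 := hd 1 (by omega)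
  refine ⟨valid_back hd S (by omega) hj, by omega, ?_⟩
  unfold candidate
  rw [hb, Nat.add_sub_cancel, sum_range_ite]
  simp only [point_pos hd]

/-- The set of all candidates for a table entry. -/
def candidates (X : Fin k → TimeSeries) (c : ℝ) (T : ℕ → ℝ) (d : ℕ → ℕ) : Set (ℝ × ℕ) :=
  mergeSet X c T d ∪ {q | 1 ≤ d 1 ∧ ∃ j < offs X k, q ∈ stepSet X c T d j}

/-- A noninitial entry has a positive position digit, which allows a merge, or a positive length
digit, which allows a step with empty `S`. -/
theorem candidates_nonempty (hk : 1 ≤ k) {T : ℕ → ℝ} {d : ℕ → ℕ}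
    (hinit : offs X k ≤ adr X d) (hd : Valid X d) : (candidates X c T d).Nonempty := by
  by_cases h : ∃ i < k, 1 ≤ d (i + 2)
  · obtain ⟨i, hi, h1⟩ := h
    exact ⟨_, .inl ⟨{i}, by simp [hi, h1], by simp, rfl⟩⟩
  · push Not at h
    have h0 : 1 ≤ d 1 := by
      by_contra h1
      rw [adr_eq, Finset.sum_eq_zero fun i hi => by
        rw [show d (i + 2) = 0 by have := h i (Finset.mem_range.1 hi); omega, zero_mul],
        show d 1 = 0 by omega] at hinit
      have : d 0 < offs X k := hd 0 (by omega)
      omega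
    exact ⟨_, .inr ⟨h0, 0, offs_pos hk, ∅, by simp, rfl⟩⟩

/-- Every term of the recursion is either infinite or one of the listed candidates, whose table
values are already correct by `hT`. Conversely, each candidate is a term of the recursion. The
minimizing candidate also names the predecessor for the traceback. -/
theorem entry_eq_of_best (hk : 1 ≤ k) {T : ℕ → ℝ} {d : ℕ → ℕ} (hd : Valid X d)
    (hinit : offs X k ≤ adr X d)
    (hT : ∀ e, Valid X e → adr X e < adr X d → (T (adr X e) : EReal) = entry X c e)
    {r : ℝ} {b : ℕ} (hmem : (r, b) ∈ candidates X c T d)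
    (hmin : ∀ q ∈ candidates X c T d, r ≤ q.1) :
    (r : EReal) = entry X c d ∧ ∃ d', Valid X d' ∧ adr X d' < adr X d ∧ b = adr X d' ∧
      Transition X c d' d (r - T (adr X d')) := by
  have hp : ∀ i, pos k d i ≠ 0 := fun i => Nat.succ_ne_zero _
  have hni : ¬ ((∀ i, pos k d i = 1) ∧ d 1 + 1 = 1) := by
    rintro ⟨h₁, h₂⟩
    rw [adr_eq, Finset.sum_eq_zero fun i hi => by
      have := h₁ ⟨i, Finset.mem_range.1 hi⟩
      simp only [pos] at this
      rw [show d (i + 2) = 0 by omega, zero_mul], show d 1 = 0 by omega] at hinit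
    have : d 0 < offs X k := hd 0 (by omega)
    omega
  have hge : (r : EReal) ≤ entry X c d := by
    rw [entry, table_step hp (Nat.succ_ne_zero _) hni]
    refine le_min (le_iInf₂ fun v' hv' => le_iInf fun S => ?_) (le_iInf₂ fun S hne => ?_)
    -- The terms not listed as candidates are those that leave the table; there the entry is `⊤` and
    -- nothing has to be shown.
    · by_cases hz : (∃ i, decr (pos k d) S i = 0) ∨ d 1 + 1 - 1 = 0
      · rw [table_eq_top hz, EReal.top_add_coe]
        exact le_top
      · push Not at hz
        obtain ⟨j, hj, rfl⟩ := mem_values_iff.1 hv'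
        have hS : ∀ i ∈ S.map Fin.valEmbedding, i < k ∧ 1 ≤ d (i + 2) := by
          intro i hi
          obtain ⟨i', hi', rfl⟩ := Finset.mem_map.1 hi
          have := hz.1 i'
          rw [decr, if_pos hi', pos] at this
          exact ⟨i'.2, by rw [Fin.valEmbedding_apply]; omega⟩
        have h1 : 1 ≤ d 1 := by omega
        obtain ⟨hv, hlt, hcand⟩ := step_candidate (c := c) (T := T) hd h1 hj hS
        have hle := hmin _ (.inr ⟨h1, j, hj, _, hS, rfl⟩)
        rw [hcand, finSet_map] at hle
        refine (EReal.coe_le_coe_iff.2 hle).trans_eq ?_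
        rw [EReal.coe_add, hT _ hv hlt, entry, pos_back _ _ _ _ fun i hi => (hS i hi).2, finSet_map]
        simp only [back, Nat.sub_add_cancel h1]
        rfl
    · by_cases hz : ∃ i, decr (pos k d) S i = 0
      · rw [table_eq_top (.inl hz), EReal.top_add_coe]
        exact le_top
      · push Not at hz
        have hS : ∀ i ∈ S.map Fin.valEmbedding, i < k ∧ 1 ≤ d (i + 2) := by
          intro i hi
          obtain ⟨i', hi', rfl⟩ := Finset.mem_map.1 hi
          have := hz i'
          rw [decr, if_pos hi', pos] at this
          exact ⟨i'.2, by rw [Fin.valEmbedding_apply]; omega⟩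
        have hne' : (S.map Fin.valEmbedding).Nonempty := hne.map
        obtain ⟨hv, hlt, hcand⟩ := merge_candidate (c := c) (T := T) hk hd hS hne'
        have hle := hmin _ (.inl ⟨_, hS, hne', rfl⟩)
        rw [hcand, finSet_map] at hle
        refine (EReal.coe_le_coe_iff.2 hle).trans_eq ?_
        rw [EReal.coe_add, hT _ hv hlt, entry, pos_back _ _ _ _ fun i hi => (hS i hi).2, finSet_map]
        simp only [back]
  rcases hmem with ⟨S, hS, hne, hq⟩ | ⟨h1, j, hj, S, hS, hq⟩
  · obtain ⟨hv, hlt, hcand⟩ := merge_candidate (c := c) (T := T) hk hd hS hne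
    rw [hcand] at hq
    obtain ⟨rfl, rfl⟩ := Prod.ext_iff.1 hq
    have hpos := pos_back (k := k) d S (d 1) (d 0) fun i hi => (hS i hi).2
    refine ⟨le_antisymm hge ?_, _, hv, hlt, rfl,
      .inl ⟨rfl, rfl, _, hpos, by simp only [add_sub_cancel_left]⟩⟩
    simp only [EReal.coe_add, hT _ hv hlt]
    rw [entry, entry, hpos]
    refine table_le_of_merge hp (Nat.succ_ne_zero _) hni ?_
    obtain ⟨i, hi⟩ := hne
    exact ⟨⟨i, (hS i hi).1⟩, mem_finSet.2 hi⟩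
  · obtain ⟨hv, hlt, hcand⟩ := step_candidate (c := c) (T := T) hd h1 hj hS
    rw [hcand] at hq
    obtain ⟨rfl, rfl⟩ := Prod.ext_iff.1 hq
    have hpos := pos_back (k := k) d S (d 1 - 1) j fun i hi => (hS i hi).2
    refine ⟨le_antisymm hge ?_, _, hv, hlt, rfl,
      .inr ⟨Nat.sub_add_cancel h1, _, hpos, by simp only [add_sub_cancel_left]; rfl⟩⟩
    rw [EReal.coe_add, hT _ hv hlt, entry, entry, hpos]
    simp only [back, Nat.sub_add_cancel h1]
    exact table_le_of_step hp (by omega) (mem_values_iff.2 ⟨j, hj, rfl⟩) _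

end MSM

namespace MSM

/-! ### Computing one table entry -/

/-- The expression for the point of the current time series at the current position. -/
def currentPoint : NExp := .add (.get 4 (.reg 6)) (.get 3 (.add (.reg 6) (.lit 2)))

def cellInit : Program :=
  .rset 2 .zero ;; .nset 12 (.lit 0) ;;
  forLoop 6 (.reg 0)
    (.rset 4 (.get 0 (.get 4 (.reg 6))) ;;
    .ite (.rle (.reg 4) (.reg 1)) (.rset 2 (.add (.reg 2) (.sub (.reg 1) (.reg 4))))
      (.rset 2 (.add (.reg 2) (.sub (.reg 4) (.reg 1)))))

/-- For a series at its first point, the cell read as the previous point is meaningless. This is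
harmless, since no listed subset contains such a series. -/
def cellMerge : Program :=
  forLoop 6 (.reg 0)
    (.rset 4 (.get 0 currentPoint) ;; .rset 5 (.get 0 (.sub currentPoint (.lit 1))) ;;
    branchCost 3 4 5 1 ;; .rput 4 (.reg 6) .zero) ;;
  .nset 9 (.reg 5) ;; .nset 10 (.lit 1) ;; listSubsets ;; scanSubsets

/-- Register 9 receives the current address with the value digit replaced by the loop index and the
length digit lowered by one. Both additions precede the subtraction, so nothing is truncated when
the length digit is positive. -/
def cellStep : Program :=
  forLoop 13 (.reg 2)
    (.rset 6 (.get 0 (.reg 13)) ;;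
    forLoop 6 (.reg 0)
      (.rset 4 (.get 0 currentPoint) ;; absDiff 3 4 1 ;; branchCost 4 1 4 6) ;;
    .nset 9 (.sub (.add (.reg 5) (.reg 13)) (.add (.get 3 (.lit 0)) (.reg 2))) ;;
    .nset 10 (.lit 0) ;; listSubsets ;; scanSubsets)

/-- Compute the table entry at the current address, given the digits of the address. -/
def cell : Program :=
  .rset 1 (.get 0 (.get 3 (.lit 0))) ;; .nset 11 (.lit 0) ;;
  .ite (.nle (.add (.reg 5) (.lit 1)) (.reg 2)) cellInit
    (cellMerge ;; .ite (.nle (.lit 1) (.get 3 (.lit 1))) cellStep .skip) ;;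
  .rput 2 (.reg 5) (.reg 2) ;; .nput 6 (.reg 5) (.reg 12) ;;
  .nput 7 (.reg 5) (.get 3 (.lit 1)) ;; .nput 8 (.reg 5) (.get 3 (.lit 0))

/-! ### Correctness of the computation of one entry -/

variable {c : ℝ} {k : ℕ} {X : Fin k → TimeSeries}

/-- The part of the memory that is set up before the table is computed. -/
structure Static (X : Fin k → TimeSeries) (c : ℝ) (σ : Memory) : Prop where
  count : σ.nreg 0 = k
  numPoints : σ.nreg 2 = offs X k
  size : σ.nreg 4 = stride X (k + 2)
  numDigits : σ.nreg 15 = k + 2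
  cost : σ.rreg 0 = c
  radix : ∀ i < k + 2, σ.narr 1 i = rad X i
  strides : ∀ i ≤ k + 2, σ.narr 2 i = stride X i
  offsets : ∀ i < k, σ.narr 4 i = offs X i
  points : σ.rarr 0 = pts X

def staticParts : List Part :=
  [.nreg 0, .nreg 2, .nreg 4, .nreg 15, .rreg 0, .narr 1, .narr 2, .narr 4, .rarr 0]

theorem Static.frame {P : Program} {σ τ : Memory} (h : Static X c σ) (hf : Frame P σ τ)
    (hP : (staticParts.all fun p => !P.writes p) = true) : Static X c τ := by
  simp only [staticParts, List.all_cons, List.all_nil, Bool.and_true, Bool.and_eq_true,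
    Bool.not_eq_true'] at hP
  obtain ⟨h₁, h₂, h₃, h₄, h₅, h₆, h₇, h₈, h₉⟩ := hP
  refine ⟨?_, ?_, ?_, ?_, ?_, ?_, ?_, ?_, ?_⟩
  · rw [hf.nreg _ h₁, h.count]
  · rw [hf.nreg _ h₂, h.numPoints]
  · rw [hf.nreg _ h₃, h.size]
  · rw [hf.nreg _ h₄, h.numDigits]
  · rw [hf.rreg _ h₅, h.cost]
  · rw [hf.narr _ h₆]; exact h.radix
  · rw [hf.narr _ h₇]; exact h.strides
  · rw [hf.narr _ h₈]; exact h.offsets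
  · rw [hf.rarr _ h₉, h.points]

theorem ends_cellInit {σ : Memory} (hs : Static X c σ) :
    Ends cellInit σ fun t τ => t ≤ 40 * k + 20 ∧ τ.nreg 12 = 0 ∧
      τ.rreg 2 = ∑ i ∈ Finset.range k, |pts X (offs X i) - σ.rreg 1| := by
  rw [cellInit]
  simp only [ends_seq, ends_nset, ends_rset, NExp.eval, RExp.eval]
  refine (ends_forLoop k (fun j τ => τ.rreg 2 =
    ∑ i ∈ Finset.range j, |pts X (offs X i) - σ.rreg 1|) (fun _ => 25) rfl
    (fun τ hf => by exact (hf.nreg 0 rfl).trans hs.count) ?_ ?_).mono ?_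
  · simp
  · intro j hj τ hf hτj hI
    have e₁ : τ.narr 4 j = offs X j := by rw [hf.narr 4 rfl]; exact hs.offsets j hj
    have e₂ : τ.rarr 0 = pts X := by rw [hf.rarr 0 rfl]; exact hs.points
    have e₃ : τ.rreg 1 = σ.rreg 1 := hf.rreg 1 rfl
    simp only [ends_seq, ends_rset, ends_ite, Test.Holds, RExp.eval, NExp.eval, NExp.steps,
      RExp.steps, Test.steps, hτj, e₁, e₂, Function.update_self, Finset.sum_range_succ,
      Function.update_of_ne (show (2 : ℕ) ≠ 4 by decide),
      Function.update_of_ne (show (1 : ℕ) ≠ 4 by decide), e₃, hI]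
    refine ⟨fun hle => ⟨by omega, ?_⟩, fun hle => ⟨by omega, ?_⟩⟩
    · rw [abs_of_nonpos (sub_nonpos.2 hle), neg_sub]
    · rw [abs_of_nonneg (sub_nonneg.2 (not_le.1 hle).le)]
  · rintro t τ hf ⟨ht, hI⟩
    simp only [Finset.sum_const, Finset.card_range, smul_eq_mul, NExp.steps, RExp.steps] at ht ⊢
    exact ⟨by omega, hf.nreg 12 rfl, hI⟩

theorem ends_cellMerge {A : Set (ℝ × ℕ)} {σ : Memory} (hs : Static X c σ)
    (ha : σ.nreg 5 = adr X (σ.narr 3)) (hv : σ.rreg 1 = pts X (σ.narr 3 0)) (hA : Best A σ) :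
    Ends cellMerge σ fun t τ => t ≤ 500 * 2 ^ k ∧
      Best (A ∪ mergeSet X c (σ.rarr 2) (σ.narr 3)) τ := by
  rw [cellMerge, ends_seq]
  refine (ends_forLoop k (fun j τ => ∀ i < j, τ.rarr 3 i =
    stepCost c (pts X (offs X i + σ.narr 3 (i + 2))) (pts X (offs X i + σ.narr 3 (i + 2) - 1))
      (pts X (σ.narr 3 0)) ∧ τ.rarr 4 i = 0) (fun _ => 90) rfl
    (fun τ hf => by exact (hf.nreg 0 rfl).trans hs.count) ?_ ?_).mono ?_
  · intro i hi
    omega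
  · intro j hj τ hf hτj hI
    have hs' := hs.frame hf rfl
    have e₁ : τ.narr 3 = σ.narr 3 := hf.narr 3 rfl
    have e₂ : τ.rreg 1 = σ.rreg 1 := hf.rreg 1 rfl
    simp only [ends_seq, ends_rset, RExp.eval, NExp.eval, NExp.steps, RExp.steps, currentPoint, hτj,
      hs'.offsets j hj, hs'.points, e₁]
    refine ends_branchCost fun t ht => ?_
    simp only [ends_rput, RExp.eval, NExp.eval, NExp.steps, RExp.steps, hτj]
    refine ⟨by omega, fun i hi => ?_⟩
    simp only [Function.update_apply, hs'.cost, e₂, hv]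
    have := hI i
    by_cases hij : i = j
    · simp [hij]
    · have := this (by omega)
      simp [hij, this]
  · rintro t τ hf ⟨ht, hI⟩
    have hs' := hs.frame hf rfl
    have e₁ : τ.narr 3 = σ.narr 3 := hf.narr 3 rfl
    have e₂ : τ.rarr 2 = σ.rarr 2 := hf.rarr 2 rfl
    have e₃ : τ.nreg 5 = σ.nreg 5 := hf.nreg 5 rfl
    rw [ends_seq, ends_nset, ends_seq, ends_nset]
    refine (ends_list_scan (hA.congr ?_ ?_ ?_) ?_).mono ?_
    · simpa using hf.nreg 11 rfl
    · simpa using hf.nreg 12 rfl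
    · exact hf.rreg 2 rfl
    · simp
    · rintro t' υ - ⟨ht', hB⟩
      simp [hs'.count, e₁, e₂, e₃, ha] at ht' hB ⊢
      have hk := Nat.lt_two_pow_self (n := k)
      constructor
      · simp at ht
        omega
      · convert hB using 2
        ext q
        refine exists_congr fun S => and_congr_right fun _ => and_congr_right fun _ => ?_
        rw [candidate_congr (fun i hi => (hs'.strides (i + 2) (by omega)).symm)
          (fun i hi => (hI i hi).1.symm) (fun i hi => (hI i hi).2.symm)]

theorem ends_cellStep {A : Set (ℝ × ℕ)} {σ : Memory} (hk : 1 ≤ k) (hs : Static X c σ)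
    (ha : σ.nreg 5 = adr X (σ.narr 3)) (hv : σ.rreg 1 = pts X (σ.narr 3 0)) (hA : Best A σ) :
    Ends cellStep σ fun t τ => t ≤ 600 * (offs X k * 2 ^ k) ∧
      Best (A ∪ {q | ∃ j < offs X k, q ∈ stepSet X c (σ.rarr 2) (σ.narr 3) j}) τ := by
  have hM := offs_pos (X := X) hk
  have h2k := Nat.lt_two_pow_self (n := k)
  refine (ends_forLoop (offs X k) (fun j τ => Best (A ∪ {q | ∃ j' < j, q ∈
    stepSet X c (σ.rarr 2) (σ.narr 3) j'}) τ) (fun _ => 560 * 2 ^ k) rfl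
    (fun τ hf => by exact (hf.nreg 2 rfl).trans hs.numPoints) ?_ ?_).mono ?_
  · have : {q | ∃ j' < 0, q ∈ stepSet X c (σ.rarr 2) (σ.narr 3) j'} = ∅ := by simp
    rw [this, Set.union_empty]
    exact hA.congr (by simp) (by simp) rfl
  · intro j hj τ hf hτj hI
    have hsτ := hs.frame hf rfl
    have e₁ : τ.narr 3 = σ.narr 3 := hf.narr 3 rfl
    have e₂ : τ.rreg 1 = σ.rreg 1 := hf.rreg 1 rfl
    have e₃ : τ.nreg 5 = σ.nreg 5 := hf.nreg 5 rfl
    have e₄ : τ.rarr 2 = σ.rarr 2 := hf.rarr 2 rfl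
    rw [ends_seq, ends_rset, ends_seq]
    simp only [RExp.eval, NExp.eval, NExp.steps, RExp.steps, hτj, hsτ.points]
    refine (ends_forLoop k (fun l υ => ∀ i < l, υ.rarr 3 i =
      |pts X (offs X i + σ.narr 3 (i + 2)) - pts X (σ.narr 3 0)| ∧ υ.rarr 4 i =
        stepCost c (pts X (σ.narr 3 0)) (pts X (offs X i + σ.narr 3 (i + 2))) (pts X j))
      (fun _ => 80) rfl
      (fun τ hf => by exact (hf.nreg 0 rfl).trans hsτ.count) ?_ ?_).mono ?_
    · intro i hi
      omega
    · intro l hl υ hfυ hυl hJ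
      have hsυ : Static X c υ := Static.frame (σ := { τ with
        rreg := Function.update τ.rreg 6 (pts X j) }) ⟨hsτ.count, hsτ.numPoints, hsτ.size,
          hsτ.numDigits, hsτ.cost, hsτ.radix, hsτ.strides, hsτ.offsets, hsτ.points⟩ hfυ rfl
      have f₁ : υ.narr 3 = σ.narr 3 := (hfυ.narr 3 rfl).trans e₁
      have f₂ : υ.rreg 1 = σ.rreg 1 := (hfυ.rreg 1 rfl).trans (by simpa using e₂)
      have f₃ : υ.rreg 6 = pts X j := (hfυ.rreg 6 rfl).trans (by simp)
      simp only [ends_seq, ends_rset, RExp.eval, NExp.eval, NExp.steps, RExp.steps, currentPoint,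
        hυl, hsυ.offsets l hl, hsυ.points, f₁]
      refine ends_absDiff fun t ht => ends_branchCost fun t' ht' => ?_
      refine ⟨by omega, fun i hi => ?_⟩
      simp only [Function.update_apply, hsυ.cost, f₂, f₃, hv, hυl]
      by_cases hil : i = l
      · simp [hil]
      · have := hJ i (by omega)
        simp [hil, this]
    · rintro t υ hfυ ⟨ht, hJ⟩
      have hsυ : Static X c υ := Static.frame (σ := { τ with
        rreg := Function.update τ.rreg 6 (pts X j) }) ⟨hsτ.count, hsτ.numPoints, hsτ.size,
          hsτ.numDigits, hsτ.cost, hsτ.radix, hsτ.strides, hsτ.offsets, hsτ.points⟩ hfυ rfl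
      have f₁ : υ.narr 3 = σ.narr 3 := (hfυ.narr 3 rfl).trans e₁
      have f₃ : υ.nreg 5 = σ.nreg 5 := (hfυ.nreg 5 rfl).trans e₃
      have f₄ : υ.rarr 2 = σ.rarr 2 := (hfυ.rarr 2 rfl).trans e₄
      have f₅ : υ.nreg 13 = j := (hfυ.nreg 13 rfl).trans hτj
      rw [ends_seq, ends_nset, ends_seq, ends_nset]
      refine (ends_list_scan (hI.congr ?_ ?_ ?_) ?_).mono ?_
      · simpa using hfυ.nreg 11 rfl
      · simpa using hfυ.nreg 12 rfl
      · simpa using hfυ.rreg 2 rfl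
      · simp
      · rintro t' ω - ⟨ht', hB⟩
        simp [hsυ.count, f₁, f₃, f₄, f₅, ha, hsυ.numPoints] at ht' hB ⊢
        constructor
        · simp at ht
          omega
        · refine Best.congr (σ := ω) ?_ rfl rfl rfl
          convert hB using 1
          rw [Set.union_assoc]
          congr 1
          ext q
          simp only [Set.mem_ofPred_eq, Set.mem_union, stepSet, Nat.le_iff_lt_or_eq]
          constructor
          · rintro ⟨j', h | rfl, S, hS, rfl⟩
            · exact .inl ⟨j', h, S, hS, rfl⟩
            · refine .inr ⟨S, hS, ?_⟩
              exact candidate_congr (fun i hi => (hsυ.strides (i + 2) (by omega)).symm)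
                (fun i hi => (hJ i hi).1.symm) (fun i hi => (hJ i hi).2.symm)
          · rintro (⟨j', h, S, hS, rfl⟩ | ⟨S, hS, rfl⟩)
            · exact ⟨j', .inl h, S, hS, rfl⟩
            · refine ⟨j, .inr rfl, S, hS, ?_⟩
              exact candidate_congr (fun i hi => hsυ.strides (i + 2) (by omega))
                (fun i hi => (hJ i hi).1) (fun i hi => (hJ i hi).2)
  · rintro t τ - ⟨ht, hI⟩
    refine ⟨?_, hI⟩
    simp only [Finset.sum_const, Finset.card_range, smul_eq_mul, NExp.steps] at ht
    have h₁ : offs X k ≤ offs X k * 2 ^ k := Nat.le_mul_of_pos_right _ (by omega)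
    have h₂ : offs X k * (560 * 2 ^ k + (1 + 9)) = 560 * (offs X k * 2 ^ k) + 10 * offs X k := by
      ring
    omega

/-- The table entry with digits `d` is stored, together with its predecessor. -/
def Stored (X : Fin k → TimeSeries) (c : ℝ) (d : ℕ → ℕ) (σ : Memory) : Prop :=
  ((σ.rarr 2 (adr X d) : ℝ) : EReal) = entry X c d ∧
  σ.narr 7 (adr X d) = d 1 ∧ σ.narr 8 (adr X d) = d 0 ∧
  ((σ.narr 6 (adr X d) = 0 ∧ adr X d < offs X k) ∨
    ∃ d', Valid X d' ∧ adr X d' < adr X d ∧ σ.narr 6 (adr X d) = adr X d' + 1 ∧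
      Transition X c d' d (σ.rarr 2 (adr X d) - σ.rarr 2 (adr X d')))

/-- All table entries with addresses less than `a` are stored. -/
def Done (X : Fin k → TimeSeries) (c : ℝ) (a : ℕ) (σ : Memory) : Prop :=
  ∀ d, Valid X d → adr X d < a → Stored X c d σ

theorem Transition.congr {d' d e : ℕ → ℕ} {w : ℝ} (h : Transition X c d' d w)
    (he : ∀ i < k + 2, d i = e i) : Transition X c d' e w := by
  unfold Transition at h ⊢
  rwa [← pos_congr he, ← he 0 (by omega), ← he 1 (by omega)]

theorem Stored.congr {d e : ℕ → ℕ} {σ : Memory} (h : Stored X c d σ)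
    (he : ∀ i < k + 2, d i = e i) : Stored X c e σ := by
  unfold Stored at h ⊢
  rw [← adr_congr he, ← entry_congr he, ← he 0 (by omega), ← he 1 (by omega)]
  refine ⟨h.1, h.2.1, h.2.2.1, h.2.2.2.imp_right ?_⟩
  rintro ⟨d', h₁, h₂, h₃, h₄⟩
  exact ⟨d', h₁, h₂, h₃, h₄.congr he⟩

theorem Stored.mono {a : ℕ} {d : ℕ → ℕ} {σ τ : Memory} (h : Stored X c d σ) (hd : adr X d < a)
    (h₁ : ∀ b < a, τ.rarr 2 b = σ.rarr 2 b) (h₂ : ∀ b < a, τ.narr 6 b = σ.narr 6 b)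
    (h₃ : ∀ b < a, τ.narr 7 b = σ.narr 7 b) (h₄ : ∀ b < a, τ.narr 8 b = σ.narr 8 b) :
    Stored X c d τ := by
  unfold Stored at h ⊢
  rw [h₁ _ hd, h₂ _ hd, h₃ _ hd, h₄ _ hd]
  refine ⟨h.1, h.2.1, h.2.2.1, h.2.2.2.imp_right ?_⟩
  rintro ⟨d', hv, hlt, hp, ht⟩
  exact ⟨d', hv, hlt, hp, by rwa [h₁ _ (hlt.trans hd)]⟩

theorem Done.congr {a : ℕ} {σ τ : Memory} (h : Done X c a σ) (h₁ : τ.rarr 2 = σ.rarr 2)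
    (h₂ : τ.narr 6 = σ.narr 6) (h₃ : τ.narr 7 = σ.narr 7) (h₄ : τ.narr 8 = σ.narr 8) :
    Done X c a τ := fun d hd ha =>
  (h d hd ha).mono ha (fun _ _ => by rw [h₁]) (fun _ _ => by rw [h₂]) (fun _ _ => by rw [h₃])
    (fun _ _ => by rw [h₄])

/-- Uniqueness of digits: an address below the first radix is also represented with all higher
digits zero. Thus the initial entries are recognized by comparing the address with the number of
points. -/
theorem digits_of_adr_lt {d : ℕ → ℕ} (hk : 1 ≤ k) (hd : Valid X d) (h : adr X d < offs X k) :
    ∀ i < k + 1, d (i + 1) = 0 := by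
  let e : ℕ → ℕ := fun i => if i = 0 then adr X d else 0
  have he : Valid X e := fun i hi => by
    by_cases h0 : i = 0
    · subst h0
      exact h
    · simp only [e, if_neg h0]
      exact rad_pos hk hi
  have hadr : adr X d = adr X e := by
    rw [adr_eq e]
    simp [e]
  intro i hi
  rw [adr_inj hd he hadr (i + 1) (by omega)]
  rfl

theorem ends_cell {σ : Memory} (hk : 1 ≤ k) (hs : Static X c σ) (hd : Valid X (σ.narr 3))
    (ha : σ.nreg 5 = adr X (σ.narr 3)) (hdone : Done X c (σ.nreg 5) σ) :
    Ends cell σ fun t τ => t ≤ 1300 * (offs X k * 2 ^ k) ∧ Done X c (σ.nreg 5 + 1) τ := by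
  have hM := offs_pos (X := X) hk
  have h2k := Nat.lt_two_pow_self (n := k)
  have hM2 : 2 ^ k ≤ offs X k * 2 ^ k := Nat.le_mul_of_pos_left _ (by omega)
  have hT : ∀ e, Valid X e → adr X e < adr X (σ.narr 3) →
      ((σ.rarr 2 (adr X e) : ℝ) : EReal) = entry X c e := fun e he hlt =>
    (hdone e he (ha ▸ hlt)).1
  -- The common final writes: once register 2 holds the entry and register 12 the encoded
  -- predecessor, storing them extends `Done` by the current address.
  have fin : ∀ (s : ℕ) (τ : Memory), s ≤ 1270 * (offs X k * 2 ^ k) → τ.nreg 5 = σ.nreg 5 →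
      τ.narr 3 = σ.narr 3 → τ.rarr 2 = σ.rarr 2 → τ.narr 6 = σ.narr 6 → τ.narr 7 = σ.narr 7 →
      τ.narr 8 = σ.narr 8 → ((τ.rreg 2 : ℝ) : EReal) = entry X c (σ.narr 3) →
      ((τ.nreg 12 = 0 ∧ adr X (σ.narr 3) < offs X k) ∨
        ∃ d', Valid X d' ∧ adr X d' < adr X (σ.narr 3) ∧ τ.nreg 12 = adr X d' + 1 ∧
          Transition X c d' (σ.narr 3) (τ.rreg 2 - σ.rarr 2 (adr X d'))) →
      Ends (.rput 2 (.reg 5) (.reg 2) ;; .nput 6 (.reg 5) (.reg 12) ;;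
        .nput 7 (.reg 5) (.get 3 (.lit 1)) ;; .nput 8 (.reg 5) (.get 3 (.lit 0))) τ
        fun t υ => s + t ≤ 1300 * (offs X k * 2 ^ k) ∧ Done X c (σ.nreg 5 + 1) υ := by
    intro s τ hst h5 h3 h2 h6 h7 h8 hr hp
    simp only [ends_seq, ends_rput, ends_nput, NExp.eval, RExp.eval, NExp.steps, RExp.steps]
    refine ⟨by omega, fun e he hlt => ?_⟩
    rcases Nat.lt_succ_iff_lt_or_eq.1 hlt with hlt | heq
    · refine (hdone e he hlt).mono hlt ?_ ?_ ?_ ?_ <;>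
      · intro b hb
        simp [h5, h2, h6, h7, h8, hb.ne]
    · rw [ha] at heq
      refine Stored.congr (d := σ.narr 3) ?_ (adr_inj hd he heq.symm)
      simp only [Stored, h5, ha, h3, h2, h6, h7, h8, Function.update_apply]
      refine ⟨by simpa using hr, by simp, by simp, ?_⟩
      rcases hp with hp | ⟨d', hv, hlt, h12, ht⟩
      · left
        simpa using hp
      · right
        refine ⟨d', hv, hlt, by simpa using h12, ?_⟩
        simpa [hlt.ne] using ht
  rw [cell, ends_seq, ends_rset, ends_seq, ends_nset, ends_seq]
  simp only [NExp.eval, RExp.eval, NExp.steps, RExp.steps, hs.points]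
  obtain ⟨σ', hσ'⟩ : ∃ σ' : Memory, σ' =
      { σ with
        nreg := Function.update σ.nreg 11 0
        rreg := Function.update σ.rreg 1 (pts X (σ.narr 3 0)) } := ⟨_, rfl⟩
  have hs' : Static X c σ' := by
    subst hσ'
    exact ⟨hs.count, hs.numPoints, hs.size, hs.numDigits, hs.cost, hs.radix, hs.strides,
      hs.offsets, hs.points⟩
  have g5 : σ'.nreg 5 = σ.nreg 5 := by subst hσ'; rfl
  have g1 : σ'.rreg 1 = pts X (σ.narr 3 0) := by subst hσ'; simp
  have gn : σ'.narr = σ.narr := by subst hσ'; rfl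
  have gr : σ'.rarr = σ.rarr := by subst hσ'; rfl
  have g11 : σ'.nreg 11 = 0 := by subst hσ'; simp
  rw [← hσ', ends_ite]
  simp only [Test.Holds, NExp.eval, NExp.steps, Test.steps, hs'.numPoints, g5]
  refine ⟨fun hlt => ?_, fun hge => ?_⟩
  · refine (ends_cellInit hs').mono ?_
    rintro t τ hf ⟨ht, h12, hr⟩
    have hlt' : adr X (σ.narr 3) < offs X k := by omega
    have h0 := digits_of_adr_lt hk hd hlt'
    refine (fin (t + 20) τ (by omega) ((hf.nreg 5 rfl).trans g5) ?_ ?_ ?_ ?_ ?_ ?_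
      (.inl ⟨h12, hlt'⟩)).mono fun t' υ _ h => ⟨by omega, h.2⟩
    · rw [hf.narr 3 rfl, gn]
    · rw [hf.rarr 2 rfl, gr]
    · rw [hf.narr 6 rfl, gn]
    · rw [hf.narr 7 rfl, gn]
    · rw [hf.narr 8 rfl, gn]
    · have hpos : ∀ i, pos k (σ.narr 3) i = 1 := fun i => by
        rw [pos, h0 (i + 1) (by omega)]
      rw [entry, h0 0 (by omega), table_init hpos, hr, g1, Finset.sum_range]
      congr 1
      refine Finset.sum_congr rfl fun i _ => ?_
      rw [← pts_offs i (one_le_length i), add_zero]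
  · have hge' : offs X k ≤ adr X (σ.narr 3) := by omega
    have fin' : ∀ (s : ℕ) (τ : Memory), s ≤ 1270 * (offs X k * 2 ^ k) → τ.nreg 5 = σ.nreg 5 →
        τ.narr 3 = σ.narr 3 → τ.rarr 2 = σ.rarr 2 → τ.narr 6 = σ.narr 6 → τ.narr 7 = σ.narr 7 →
        τ.narr 8 = σ.narr 8 → Best (candidates X c (σ.rarr 2) (σ.narr 3)) τ →
        Ends (.rput 2 (.reg 5) (.reg 2) ;; .nput 6 (.reg 5) (.reg 12) ;;
          .nput 7 (.reg 5) (.get 3 (.lit 1)) ;; .nput 8 (.reg 5) (.get 3 (.lit 0))) τ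
          fun t υ => s + t ≤ 1300 * (offs X k * 2 ^ k) ∧ Done X c (σ.nreg 5 + 1) υ := by
      intro s τ hst h5 h3 h2 h6 h7 h8 hB
      rcases hB with ⟨-, hemp⟩ | ⟨-, b, h12, hmem, hmin⟩
      · exact absurd hemp (candidates_nonempty hk hge' hd).ne_empty
      · obtain ⟨hr, d', hv, hlt, rfl, htr⟩ := entry_eq_of_best hk hd hge' hT hmem hmin
        exact fin s τ hst h5 h3 h2 h6 h7 h8 hr (.inr ⟨d', hv, hlt, h12, htr⟩)
    rw [ends_seq]
    refine (ends_cellMerge hs' (by rw [g5, gn, ha]) (by rw [g1, gn]) (A := ∅)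
      (.inl ⟨g11, rfl⟩)).mono ?_
    rintro t τ hf ⟨ht, hB⟩
    rw [gr, gn, Set.empty_union] at hB
    have hsτ := hs'.frame hf rfl
    have f3 : τ.narr 3 = σ.narr 3 := by rw [hf.narr 3 rfl, gn]
    have f5 : τ.nreg 5 = σ.nreg 5 := (hf.nreg 5 rfl).trans g5
    have f1 : τ.rreg 1 = pts X (σ.narr 3 0) := (hf.rreg 1 rfl).trans g1
    have f2 : τ.rarr 2 = σ.rarr 2 := by rw [hf.rarr 2 rfl, gr]
    have f6 : τ.narr 6 = σ.narr 6 := by rw [hf.narr 6 rfl, gn]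
    have f7 : τ.narr 7 = σ.narr 7 := by rw [hf.narr 7 rfl, gn]
    have f8 : τ.narr 8 = σ.narr 8 := by rw [hf.narr 8 rfl, gn]
    simp only [ends_ite, Test.Holds, NExp.eval, NExp.steps, Test.steps, f3, ends_skip]
    refine ⟨fun h1 => ?_, fun h1 => ?_⟩
    · refine (ends_cellStep hk hsτ (by rw [f5, f3, ha]) (by rw [f1, f3]) hB).mono ?_
      rintro t' υ hf' ⟨ht', hB'⟩
      rw [f2, f3] at hB'
      refine (fin' (t + t' + 30) υ (by omega) ((hf'.nreg 5 rfl).trans f5) ((hf'.narr 3 rfl).trans f3)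
        ((hf'.rarr 2 rfl).trans f2) ((hf'.narr 6 rfl).trans f6) ((hf'.narr 7 rfl).trans f7)
        ((hf'.narr 8 rfl).trans f8) ?_).mono fun s ω _ h => ⟨by omega, h.2⟩
      convert hB' using 2
      simp only [candidates, h1, true_and]
    · refine (fin' (t + 30) τ (by omega) f5 f3 f2 f6 f7 f8 ?_).mono fun s ω _ h => ⟨by omega, h.2⟩
      simpa only [candidates, h1, false_and, Set.ofPred_false, Set.union_empty] using hB

end MSM

namespace MSM

/-! ### Computing the whole table -/

/-- Replace the digits of an address by those of the next address. -/
def increment : Program :=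
  .nset 14 (.lit 1) ;;
  forLoop 6 (.reg 15)
    (.ite (.nle (.lit 1) (.reg 14))
      (.ite (.nle (.add (.get 3 (.reg 6)) (.lit 2)) (.get 1 (.reg 6)))
        (.nput 3 (.reg 6) (.add (.get 3 (.reg 6)) (.lit 1)) ;; .nset 14 (.lit 0))
        (.nput 3 (.reg 6) (.lit 0)))
      .skip)

def fillTable : Program := forLoop 5 (.reg 4) (cell ;; increment)

/-- Find the best table entry at the final positions. -/
def selectBest : Program :=
  .nset 11 (.lit 0) ;;
  forLoop 7 (.get 2 (.lit 2)) (consider (.sub (.sub (.reg 4) (.reg 7)) (.lit 1)) .zero)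

variable {c : ℝ} {k : ℕ} {X : Fin k → TimeSeries}

theorem adr_update (d : ℕ → ℕ) {j : ℕ} (hj : j < k + 2) (v : ℕ) :
    adr X (Function.update d j v) + d j * stride X j = adr X d + v * stride X j := by
  unfold adr
  rw [← Finset.add_sum_erase _ _ (Finset.mem_range.2 hj),
    ← Finset.add_sum_erase _ (fun i => d i * stride X i) (Finset.mem_range.2 hj),
    Function.update_self]
  have : ∑ i ∈ (Finset.range (k + 2)).erase j, Function.update d j v i * stride X i =
      ∑ i ∈ (Finset.range (k + 2)).erase j, d i * stride X i :=
    Finset.sum_congr rfl fun i hi => by rw [Function.update_of_ne (Finset.ne_of_mem_erase hi)]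
  rw [this]
  omega

theorem valid_update {d : ℕ → ℕ} (hd : Valid X d) {j v : ℕ} (hv : v < rad X j) :
    Valid X (Function.update d j v) := fun i hi => by
  by_cases h : i = j
  · subst h
    rwa [Function.update_self]
  · rw [Function.update_of_ne h]
    exact hd i hi

/-- Before digit `j`, either the carry is settled and the address has grown by one, or it is pending
and still worth `stride X j`. A carry pending after the last digit occurs only at the last address,
where the digits wrap around to zero. -/
theorem ends_increment {σ : Memory} (hs : Static X c σ) (hd : Valid X (σ.narr 3)) :
    Ends increment σ fun t τ => t ≤ 50 * k + 120 ∧ Valid X (τ.narr 3) ∧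
      (adr X (σ.narr 3) + 1 < stride X (k + 2) → adr X (τ.narr 3) = adr X (σ.narr 3) + 1) := by
  rw [increment, ends_seq, ends_nset]
  refine (ends_forLoop (k + 2) (fun j τ => Valid X (τ.narr 3) ∧
    ((τ.nreg 14 = 0 ∧ adr X (τ.narr 3) = adr X (σ.narr 3) + 1) ∨
      (τ.nreg 14 = 1 ∧ adr X (τ.narr 3) + stride X j = adr X (σ.narr 3) + 1))) (fun _ => 30) rfl
    (fun τ hf => by exact (hf.nreg 15 rfl).trans hs.numDigits) ?_ ?_).mono ?_
  · exact ⟨hd, .inr ⟨by simp, rfl⟩⟩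
  · rintro j hj τ hf hτj ⟨hv, hI⟩
    have e₁ : τ.narr 1 j = rad X j := by rw [hf.narr 1 rfl]; exact hs.radix j hj
    have hvj := hv j hj
    simp only [ends_ite, ends_seq, ends_nput, ends_nset, ends_skip, Test.Holds, NExp.eval,
      NExp.steps, Test.steps, hτj, e₁, Function.update_self,
      Function.update_of_ne (show (14 : ℕ) ≠ 6 by decide)]
    refine ⟨fun hc => ⟨fun hlt => ?_, fun hlt => ?_⟩, fun hc => ?_⟩
    · refine ⟨by omega, valid_update hv (by omega), .inl ⟨trivial, ?_⟩⟩
      have h₁ := adr_update (X := X) (τ.narr 3) hj (τ.narr 3 j + 1)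
      rcases hI with ⟨h₂, -⟩ | ⟨-, h₂⟩
      · omega
      · rw [Nat.add_mul] at h₁
        omega
    · refine ⟨by omega, valid_update hv (by omega), ?_⟩
      have h₁ := adr_update (X := X) (τ.narr 3) hj 0
      rcases hI with ⟨h₂, -⟩ | ⟨h₂, h₃⟩
      · omega
      · refine .inr ⟨h₂, ?_⟩
        have h₄ : stride X (j + 1) = τ.narr 3 j * stride X j + stride X j := by
          rw [stride_succ, show rad X j = τ.narr 3 j + 1 by omega]
          ring
        omega
    · refine ⟨by omega, hv, ?_⟩
      rcases hI with h₂ | ⟨h₂, -⟩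
      · exact .inl h₂
      · omega
  · rintro t τ hf ⟨ht, hv, hI⟩
    simp only [Finset.sum_const, Finset.card_range, smul_eq_mul, NExp.steps] at ht ⊢
    refine ⟨by omega, hv, fun hlt => ?_⟩
    rcases hI with ⟨-, h⟩ | ⟨-, h⟩
    · exact h
    · omega

theorem ends_fillTable {σ : Memory} (hk : 1 ≤ k) (hs : Static X c σ) (hd : ∀ i, σ.narr 3 i = 0) :
    Ends fillTable σ fun t τ => t ≤ 1600 * (stride X (k + 2) * (offs X k * 2 ^ k)) ∧
      Done X c (stride X (k + 2)) τ := by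
  have hM := offs_pos (X := X) hk
  have h2k := Nat.lt_two_pow_self (n := k)
  have hM2 : 2 ^ k ≤ offs X k * 2 ^ k := Nat.le_mul_of_pos_left _ (by omega)
  -- The address is tied to the counter only while an entry remains to be computed, because the last
  -- increment wraps around.
  refine (ends_forLoop (stride X (k + 2)) (fun a τ => Valid X (τ.narr 3) ∧ Done X c a τ ∧
    (a < stride X (k + 2) → adr X (τ.narr 3) = a)) (fun _ => 1480 * (offs X k * 2 ^ k)) rfl
    (fun τ hf => by exact (hf.nreg 4 rfl).trans hs.size) ?_ ?_).mono ?_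
  · refine ⟨fun i hi => ?_, fun d _ h => absurd h (Nat.not_lt_zero _), fun _ => ?_⟩
    · rw [hd]
      exact rad_pos hk hi
    · exact Finset.sum_eq_zero fun i _ => by rw [hd, zero_mul]
  · rintro a ha τ hf hτa ⟨hv, hdone, hadr⟩
    have hsτ := hs.frame hf rfl
    rw [ends_seq]
    refine (ends_cell hk hsτ hv (by rw [hτa, hadr ha]) (by rwa [hτa])).mono ?_
    rintro t υ hfυ ⟨ht, hdone'⟩
    have e₃ : υ.narr 3 = τ.narr 3 := hfυ.narr 3 rfl
    refine (ends_increment (hsτ.frame hfυ rfl) (by rwa [e₃])).mono ?_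
    rintro t' ω hfω ⟨ht', hv', hadr'⟩
    rw [e₃, hadr ha] at hadr'
    rw [hτa] at hdone'
    exact ⟨by omega, hv', hdone'.congr (hfω.rarr 2 rfl) (hfω.narr 6 rfl) (hfω.narr 7 rfl)
      (hfω.narr 8 rfl), hadr'⟩
  · rintro t τ - ⟨ht, -, hdone, -⟩
    refine ⟨?_, hdone⟩
    simp only [Finset.sum_const, Finset.card_range, smul_eq_mul, NExp.steps] at ht
    have h₁ := stride_pos (X := X) hk le_rfl
    have h₂ : stride X (k + 2) ≤ stride X (k + 2) * (offs X k * 2 ^ k) :=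
      Nat.le_mul_of_pos_right _ (by omega)
    have h₃ : stride X (k + 2) * (1480 * (offs X k * 2 ^ k) + (1 + 9)) =
        1480 * (stride X (k + 2) * (offs X k * 2 ^ k)) + 10 * stride X (k + 2) := by ring
    omega

/-! ### The optimum -/

/-- The digits of a table entry at the final positions. -/
def finalDigits (X : Fin k → TimeSeries) (l j : ℕ) : ℕ → ℕ
  | 0 => j
  | 1 => l
  | i + 2 => lens X i - 1

theorem stride_two : stride X 2 = offs X k * ((maxLength X - 1) * k + 1) := by
  rw [stride_succ, stride_one]
  rfl

/-- Telescoping: with maximal digits each term is the difference of two consecutive strides. -/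
theorem sum_final_digits (n : ℕ) (hn : n ≤ k) :
    ∑ i ∈ Finset.range n, (lens X i - 1) * stride X (i + 2) + stride X 2 = stride X (n + 2) := by
  induction n with
  | zero => simp
  | succ n ih =>
    have h₁ := ih (by omega)
    obtain ⟨q, hq⟩ := Nat.exists_eq_add_of_le (lens_pos (X := X) (i := n) (by omega))
    rw [Finset.sum_range_succ, show n + 1 + 2 = n + 2 + 1 from rfl, stride_succ (n + 2),
      show rad X (n + 2) = lens X n from rfl, hq, Nat.add_sub_cancel_left, ← h₁]
    ring

/-- Hence the entries at the final positions occupy exactly the last `stride X 2` addresses, which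
`selectBest` scans downwards. -/
theorem adr_finalDigits (l j : ℕ) :
    adr X (finalDigits X l j) + stride X 2 = j + l * offs X k + stride X (k + 2) := by
  rw [adr_eq, ← sum_final_digits k le_rfl]
  simp only [finalDigits]
  omega

theorem valid_finalDigits {l j : ℕ} (hl : l < (maxLength X - 1) * k + 1) (hj : j < offs X k) :
    Valid X (finalDigits X l j) := by
  intro i hi
  match i with
  | 0 => exact hj
  | 1 => exact hl
  | i + 2 =>
    have := lens_pos (X := X) (i := i) (by omega)
    change lens X i - 1 < lens X i
    omega

theorem pos_finalDigits (l j : ℕ) :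
    pos k (finalDigits X l j) = fun i => (X i).1.length := by
  funext i
  have := lens_pos (X := X) i.2
  rw [← lens_fin]
  change lens X i - 1 + 1 = _
  omega

theorem stride_two_le : stride X 2 ≤ stride X (k + 2) := by
  rw [← sum_final_digits k le_rfl]
  omega

theorem tableOptimum_eq_of_best (hk : 1 ≤ k) {T : ℕ → ℝ}
    (hT : ∀ d, Valid X d → (T (adr X d) : EReal) = entry X c d) {A : Set (ℝ × ℕ)}
    (hA : A = {q | ∃ s < stride X 2, q =
      (T (stride X (k + 2) - s - 1), stride X (k + 2) - s - 1)}) {r : ℝ} {b : ℕ}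
    (hmem : (r, b) ∈ A) (hmin : ∀ q ∈ A, r ≤ q.1) :
    (r : EReal) = tableOptimum c X ∧ ∃ d, Valid X d ∧ b = adr X d ∧ r = T b ∧
      pos k d = fun i => (X i).1.length := by
  subst hA
  have hM := offs_pos (X := X) hk
  have hle := stride_two_le (X := X)
  obtain ⟨s, hs, hq⟩ := hmem
  obtain ⟨rfl, rfl⟩ := Prod.mk.inj hq
  -- The offset `u` from the start of the final block encodes the length and the value; division by
  -- the number of points recovers both digits.
  obtain ⟨u, hu⟩ : ∃ u, u + s + 1 = stride X 2 := ⟨stride X 2 - s - 1, by omega⟩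
  have hdm : u % offs X k + u / offs X k * offs X k = u := Nat.mod_add_div' _ _
  have hj : u % offs X k < offs X k := Nat.mod_lt _ (by omega)
  have hl : u / offs X k < (maxLength X - 1) * k + 1 := by
    rw [Nat.div_lt_iff_lt_mul (by omega), mul_comm, ← stride_two]
    omega
  have hadr := adr_finalDigits (X := X) (u / offs X k) (u % offs X k)
  have hb : stride X (k + 2) - s - 1 = adr X (finalDigits X (u / offs X k) (u % offs X k)) := by
    omega
  have hv := valid_finalDigits hl hj
  refine ⟨le_antisymm ?_ ?_, _, hv, hb, rfl, pos_finalDigits _ _⟩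
  · refine le_iInf₂ fun ℓ hℓ => le_iInf₂ fun v hmv => ?_
    rw [Finset.mem_Icc] at hℓ
    obtain ⟨j, hj', rfl⟩ := mem_values_iff.1 hmv
    have hv' := valid_finalDigits (X := X) (l := ℓ - 1) (j := j) (by omega) hj'
    have hadr' := adr_finalDigits (X := X) (ℓ - 1) j
    have hlt : j + (ℓ - 1) * offs X k < stride X 2 := by
      rw [stride_two]
      have h₁ : (ℓ - 1) * offs X k + offs X k ≤ offs X k * ((maxLength X - 1) * k + 1) := by
        rw [← Nat.succ_mul, mul_comm]
        exact Nat.mul_le_mul_left _ (by omega)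
      omega
    have h₁ := hmin _ ⟨stride X 2 - 1 - (j + (ℓ - 1) * offs X k), by omega, rfl⟩
    rw [show stride X (k + 2) - (stride X 2 - 1 - (j + (ℓ - 1) * offs X k)) - 1 =
      adr X (finalDigits X (ℓ - 1) j) by omega] at h₁
    refine (EReal.coe_le_coe_iff.2 h₁).trans_eq ?_
    rw [hT _ hv', entry, pos_finalDigits]
    simp only [finalDigits, Nat.sub_add_cancel hℓ.1]
  · rw [hb, hT _ hv, entry, pos_finalDigits]
    exact (iInf₂_le _ (Finset.mem_Icc.2 ⟨Nat.le_add_left _ _, hl⟩)).trans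
      (iInf₂_le _ (mem_values_iff.2 ⟨_, hj, rfl⟩))

theorem ends_selectBest {σ : Memory} (hk : 1 ≤ k) (hs : Static X c σ)
    (hdone : Done X c (stride X (k + 2)) σ) :
    Ends selectBest σ fun t τ => t ≤ 80 * stride X (k + 2) ∧
      ∃ d, Valid X d ∧ τ.nreg 12 = adr X d + 1 ∧ (pos k d = fun i => (X i).1.length) ∧
        ((σ.rarr 2 (adr X d) : ℝ) : EReal) = tableOptimum c X := by
  have hle := stride_two_le (X := X)
  have hpos := stride_pos (X := X) hk (i := 2) (by omega)
  let G : ℕ → ℝ × ℕ := fun s => (σ.rarr 2 (stride X (k + 2) - s - 1), stride X (k + 2) - s - 1)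
  rw [selectBest, ends_seq, ends_nset]
  refine (ends_forLoop (stride X 2) (fun j τ => Best {q | ∃ s < j, q = G s} τ) (fun _ => 50) rfl
    (fun τ hf => by
      have : τ.narr 2 = σ.narr 2 := hf.narr 2 rfl
      simp only [NExp.eval, this, hs.strides 2 (by omega)]) ?_ ?_).mono ?_
  · exact .inl ⟨by simp [NExp.eval], by simp⟩
  · rintro j hj τ hf hτj hI
    have e₁ : τ.nreg 4 = stride X (k + 2) := (hf.nreg 4 rfl).trans (by simpa using hs.size)
    have e₂ : τ.rarr 2 = σ.rarr 2 := hf.rarr 2 rfl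
    refine (ends_consider hI).mono ?_
    rintro t υ - ⟨ht, hB⟩
    simp only [NExp.steps, RExp.steps, NExp.eval, RExp.eval, e₁, e₂, hτj, add_zero] at ht hB
    refine ⟨by omega, ?_⟩
    have hset : {q | ∃ s < j + 1, q = G s} = insert (G j) {q | ∃ s < j, q = G s} := by
      ext q
      simp only [Set.mem_ofPred_eq, Set.mem_insert_iff, Nat.lt_succ_iff_lt_or_eq]
      constructor
      · rintro ⟨s, h | rfl, rfl⟩
        · exact .inr ⟨s, h, rfl⟩
        · exact .inl rfl
      · rintro (rfl | ⟨s, h, rfl⟩)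
        · exact ⟨j, .inr rfl, rfl⟩
        · exact ⟨s, .inl h, rfl⟩
    rw [hset]
    exact hB.congr (by simp) (by simp) rfl
  · rintro t τ hf ⟨ht, hB⟩
    simp only [Finset.sum_const, Finset.card_range, smul_eq_mul, NExp.steps] at ht ⊢
    refine ⟨by omega, ?_⟩
    rcases hB with ⟨-, hemp⟩ | ⟨-, b, h12, hmem, hmin⟩
    · have : G 0 ∈ {q | ∃ s < stride X 2, q = G s} := ⟨0, hpos, rfl⟩
      rw [hemp] at this
      exact absurd this (Set.notMem_empty _)
    · obtain ⟨hopt, d, hv, hb, hr, hp⟩ := tableOptimum_eq_of_best hk (c := c) (T := σ.rarr 2)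
        (fun d hd => (hdone d hd (adr_lt hd)).1) rfl hmem hmin
      exact ⟨d, hv, by rw [h12, hb], hp, by rw [← hb, ← hr, hopt]⟩

end MSM

namespace MSM

/-! ### The traceback -/

/-- Follow the predecessors of the best table entry and write the mean. -/
def traceback : Program :=
  .nset 16 (.reg 12) ;; .nset 1 (.add (.get 7 (.sub (.reg 16) (.lit 1))) (.lit 1)) ;;
  .while (.nle (.lit 1) (.reg 16))
    (.rput 1 (.get 7 (.sub (.reg 16) (.lit 1))) (.get 0 (.get 8 (.sub (.reg 16) (.lit 1)))) ;;
    .nset 16 (.get 6 (.sub (.reg 16) (.lit 1))))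

variable {c : ℝ} {k : ℕ} {X : Fin k → TimeSeries}

theorem ends_while_of_holds {b : Test} {P : Program} {σ : Memory} {Q : ℕ → Memory → Prop}
    (hb : b.Holds σ) (h : Ends P σ fun s τ => Ends (.while b P) τ fun t υ =>
      Q (b.steps + 1 + s + t) υ) : Ends (.while b P) σ Q := by
  obtain ⟨_, _, h₁, _, _, h₂, hQ⟩ := h
  exact ⟨_, _, .while_true hb h₁ h₂, hQ⟩

theorem ends_while_of_not_holds {b : Test} {P : Program} {σ : Memory} {Q : ℕ → Memory → Prop}
    (hb : ¬ b.Holds σ) (h : Q (b.steps + 1) σ) : Ends (.while b P) σ Q :=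
  ⟨_, _, .while_false P hb, h⟩

/-- Strong induction on the address, which decreases along predecessors. The output is written from
the back, so the conclusion records that the cells after the current one are never touched again. -/
theorem ends_traceback_loop (hk : 1 ≤ k) {a₀ : ℕ} (a : ℕ) :
    ∀ {σ : Memory} {d : ℕ → ℕ}, a < a₀ → Done X c a₀ σ → σ.rarr 0 = pts X → Valid X d →
      adr X d = a → σ.nreg 16 = a + 1 →
      Ends (.while (.nle (.lit 1) (.reg 16))
        (.rput 1 (.get 7 (.sub (.reg 16) (.lit 1))) (.get 0 (.get 8 (.sub (.reg 16) (.lit 1)))) ;;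
        .nset 16 (.get 6 (.sub (.reg 16) (.lit 1))))) σ fun t τ =>
        t ≤ 30 * (a + 1) + 4 ∧ τ.rarr 1 (d 1) = pts X (d 0) ∧
        (∀ i, d 1 < i → τ.rarr 1 i = σ.rarr 1 i) ∧
        Realizes c X (pos k d) (d 1 + 1) (τ.rarr 1) (σ.rarr 2 (adr X d)) := by
  induction a using Nat.strong_induction_on with
  | _ a ih =>
  rintro σ d ha hdone hpts hd rfl h16
  obtain ⟨hT, h7, h8, hpred⟩ := hdone d hd ha
  refine ends_while_of_holds (by simp [h16]) ?_
  simp only [ends_seq, ends_rput, ends_nset, NExp.eval, RExp.eval, NExp.steps, RExp.steps,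
    Test.steps, h16, Nat.add_sub_cancel, h7, h8, hpts]
  rcases hpred with ⟨h6, hlt⟩ | ⟨d', hd', hlt, h6, htr⟩
  · refine ends_while_of_not_holds (by simp [h6]) ?_
    have h0 := digits_of_adr_lt hk hd hlt
    have hpos : ∀ i, pos k d i = 1 := fun i => by rw [pos, h0 (i + 1) (by omega)]
    simp only [NExp.steps, Test.steps, Function.update_self]
    refine ⟨by omega, trivial, fun i hi => Function.update_of_ne hi.ne' _ _, ?_⟩
    rw [entry, h0 0 (by omega), table_init hpos, EReal.coe_eq_coe_iff] at hT
    rw [hT, h0 0 (by omega)]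
    convert realizes_init hpos using 5
    simp
  · have hdone' : Done X c a₀ { σ with
        nreg := Function.update σ.nreg 16 (adr X d' + 1)
        rarr := Function.update σ.rarr 1
          (Function.update (σ.rarr 1) (d 1) (pts X (d 0))) } :=
      hdone.congr (by simp) rfl rfl rfl
    rw [h6]
    refine (ih (adr X d') hlt (hlt.trans ha) hdone' (by simpa using hpts) hd' rfl
      (by simp)).mono ?_
    rintro t τ - ⟨ht, hval, hrest, hreal⟩
    simp only [Function.update_self] at hrest
    have h21 : Function.update σ.rarr 1 (Function.update (σ.rarr 1) (d 1) (pts X (d 0))) 2 =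
        σ.rarr 2 := by simp
    simp only [h21] at hreal
    have hT' : σ.rarr 2 (adr X d) = σ.rarr 2 (adr X d') +
        (σ.rarr 2 (adr X d) - σ.rarr 2 (adr X d')) := by ring
    -- After a merge the predecessor has the same length and value, so the same output cell is
    -- rewritten with the same value. After a step the remaining run only writes to earlier cells.
    rcases htr with ⟨e0, e1, S, hS, hw⟩ | ⟨e1, S, hS, hw⟩
    · rw [e0, e1] at hval
      rw [e1] at hrest
      refine ⟨by omega, hval, fun i hi => ?_, ?_⟩
      · rw [hrest i hi, Function.update_of_ne hi.ne']
      · rw [hT', hw, ← hval]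
        rw [hS, e1] at hreal
        exact hreal.merge
    · have hval' : τ.rarr 1 (d 1) = pts X (d 0) := by
        rw [hrest _ (by omega), Function.update_self]
      refine ⟨by omega, hval', fun i hi => ?_, ?_⟩
      · rw [hrest i (by omega), Function.update_of_ne hi.ne']
      · rw [hT', hw, ← hval, ← hval', ← e1]
        rw [hS] at hreal
        exact hreal.step fun i => Nat.succ_ne_zero _

theorem ends_traceback {σ : Memory} (hk : 1 ≤ k) (hs : Static X c σ)
    (hdone : Done X c (stride X (k + 2)) σ) {d : ℕ → ℕ} (hd : Valid X d)
    (h12 : σ.nreg 12 = adr X d + 1) :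
    Ends traceback σ fun t τ => t ≤ 30 * stride X (k + 2) + 20 ∧ τ.nreg 1 = d 1 + 1 ∧
      Realizes c X (pos k d) (d 1 + 1) (τ.rarr 1) (σ.rarr 2 (adr X d)) := by
  have hlt := adr_lt hd
  obtain ⟨-, h7, -⟩ := hdone d hd hlt
  rw [traceback, ends_seq, ends_nset, ends_seq, ends_nset]
  simp only [NExp.eval, NExp.steps, h12, Function.update_self, Nat.add_sub_cancel, h7]
  have hdone' : Done X c (stride X (k + 2)) { σ with
      nreg := Function.update (Function.update σ.nreg 16 (adr X d + 1)) 1 (d 1 + 1) } :=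
    hdone.congr rfl rfl rfl rfl
  refine (ends_traceback_loop hk _ hlt hdone' hs.points hd rfl (by simp)).mono ?_
  rintro t τ hf ⟨ht, -, -, hreal⟩
  exact ⟨by omega, (hf.nreg 1 rfl).trans (by simp), hreal⟩

/-! ### The preparation -/

/-- The machine has no multiplication, so `N` and the strides are products formed by repeated
addition. This takes time proportional to the sum of the radices, which the table size dominates. -/
def setup : Program :=
  forLoop 6 (.reg 0)
    (.nput 4 (.reg 6) (.reg 2) ;; .nput 1 (.add (.reg 6) (.lit 2)) (.get 0 (.reg 6)) ;;
    .nset 2 (.add (.reg 2) (.get 0 (.reg 6))) ;;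
    .ite (.nle (.reg 14) (.get 0 (.reg 6))) (.nset 14 (.get 0 (.reg 6))) .skip) ;;
  .nset 3 (.lit 1) ;; forLoop 6 (.reg 0) (.nset 3 (.add (.reg 3) (.sub (.reg 14) (.lit 1)))) ;;
  .nput 1 (.lit 0) (.reg 2) ;; .nput 1 (.lit 1) (.reg 3) ;; .nset 15 (.add (.reg 0) (.lit 2)) ;;
  .nput 2 (.lit 0) (.lit 1) ;;
  forLoop 6 (.reg 15)
    (.nput 2 (.add (.reg 6) (.lit 1)) (.lit 0) ;;
    forLoop 7 (.get 1 (.reg 6))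
      (.nput 2 (.add (.reg 6) (.lit 1)) (.add (.get 2 (.add (.reg 6) (.lit 1))) (.get 2 (.reg 6))))) ;;
  .nset 4 (.get 2 (.reg 15))

theorem sup_lens : (Finset.range k).sup (lens X) = maxLength X := by
  refine le_antisymm (Finset.sup_le fun i hi => ?_) (Finset.sup_le fun i _ => ?_)
  · have := length_le_maxLength (X := X) ⟨i, Finset.mem_range.1 hi⟩
    rwa [← lens_fin] at this
  · rw [← lens_fin]
    exact Finset.le_sup (f := lens X) (Finset.mem_range.2 i.2)

theorem ends_setup (c : ℝ) (X : Fin k → TimeSeries) :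
    Ends setup (input c X) fun t τ =>
      t ≤ 200 * (k + 1) + 30 * ∑ i ∈ Finset.range (k + 2), rad X i ∧ Static X c τ ∧
      ∀ i, τ.narr 3 i = 0 := by
  rw [setup, ends_seq]
  refine (ends_forLoop k (fun j τ => τ.nreg 2 = offs X j ∧
    τ.nreg 14 = (Finset.range j).sup (lens X) ∧
    ∀ i < j, τ.narr 4 i = offs X i ∧ τ.narr 1 (i + 2) = lens X i) (fun _ => 30) rfl
    (fun τ hf => by exact hf.nreg 0 rfl) ?_ ?_).mono ?_
  · simp [input, offs]
  · rintro j hj τ hf hτj ⟨h2, h14, hI⟩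
    have e₀ : τ.narr 0 j = lens X j := by rw [hf.narr 0 rfl]; rfl
    have hsup : (Finset.range (j + 1)).sup (lens X) = max ((Finset.range j).sup (lens X))
        (lens X j) := by
      rw [Finset.range_add_one, Finset.sup_insert, sup_comm]
    have hI' : ∀ i < j + 1, (if i = j then offs X j else τ.narr 4 i) = offs X i ∧
        (if i + 2 = j + 2 then lens X j else τ.narr 1 (i + 2)) = lens X i := by
      intro i hi
      by_cases hij : i = j
      · simp [hij]
      · simpa [hij] using hI i (by omega)
    simp only [ends_seq, ends_nput, ends_nset, ends_ite, ends_skip, NExp.eval, NExp.steps,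
      Test.steps, Test.Holds, hτj, h2, h14, hsup, Function.update_apply, offs,
      Finset.sum_range_succ, reduceIte, Nat.reduceEqDiff, e₀] at hI' ⊢
    refine ⟨fun hle => ⟨by omega, trivial, (max_eq_right hle).symm, hI'⟩,
      fun hle => ⟨by omega, trivial, (max_eq_left (not_le.1 hle).le).symm, hI'⟩⟩
  · rintro t₁ τ hf ⟨ht₁, h2, h14, hI⟩
    rw [sup_lens] at h14
    have e₀ : τ.nreg 0 = k := hf.nreg 0 rfl
    have er : τ.rreg 0 = c := hf.rreg 0 rfl
    have ep : τ.rarr 0 = pts X := (hf.rarr 0 rfl).trans (by funext i; simp [input, pts])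
    have ed : ∀ i, τ.narr 3 i = 0 := fun i => by rw [hf.narr 3 rfl]; simp [input]
    rw [ends_seq, ends_nset, ends_seq]
    refine (ends_forLoop k (fun j υ => υ.nreg 3 = (maxLength X - 1) * j + 1) (fun _ => 10) rfl
      (fun υ hf => by exact (hf.nreg 0 rfl).trans e₀) ?_ ?_).mono ?_
    · simp [NExp.eval]
    · intro j hj υ hfυ hυj hJ
      have e₁ : υ.nreg 14 = maxLength X := (hfυ.nreg 14 rfl).trans h14
      simp only [ends_nset, NExp.eval, NExp.steps, Function.update_apply, hJ, e₁, reduceIte,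
        Nat.reduceEqDiff]
      exact ⟨by omega, by ring⟩
    · rintro t₂ υ hfυ ⟨ht₂, h3⟩
      have f0 : υ.nreg 0 = k := (hfυ.nreg 0 rfl).trans e₀
      have f2 : υ.nreg 2 = offs X k := (hfυ.nreg 2 rfl).trans h2
      have f1 : υ.narr 1 = τ.narr 1 := hfυ.narr 1 rfl
      have f4 : υ.narr 4 = τ.narr 4 := hfυ.narr 4 rfl
      have f3 : υ.narr 3 = τ.narr 3 := hfυ.narr 3 rfl
      have fr : υ.rreg 0 = c := (hfυ.rreg 0 rfl).trans er
      have fp : υ.rarr 0 = pts X := (hfυ.rarr 0 rfl).trans ep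
      have hrad : ∀ i < k + 2, Function.update (Function.update (υ.narr 1) 0 (offs X k)) 1
          ((maxLength X - 1) * k + 1) i = rad X i := by
        intro i hi
        match i with
        | 0 => simp [rad]
        | 1 => simp [rad]
        | i + 2 =>
          rw [Function.update_of_ne (by omega), Function.update_of_ne (by omega), f1]
          exact (hI i (by omega)).2
      simp only [ends_seq, ends_nput, ends_nset, NExp.eval, NExp.steps, f0, f2, h3]
      refine (ends_forLoop (k + 2) (fun j ω => ∀ i ≤ j, ω.narr 2 i = stride X i)
        (fun j => 30 * rad X j + 20) rfl (fun ω hf => by exact (hf.nreg 15 rfl).trans (by simp))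
        ?_ ?_).mono ?_
      · intro i hi
        obtain rfl : i = 0 := by omega
        simp [stride_zero]
      · intro j hj ω hfω hωj hJ
        have g1 : ω.narr 1 j = rad X j := by
          rw [hfω.narr 1 rfl, ← hrad j hj]
          simp [Function.update_apply]
        rw [ends_seq, ends_nput]
        simp only [NExp.eval, NExp.steps, hωj]
        refine (ends_forLoop (rad X j) (fun s ψ => (∀ i ≤ j, ψ.narr 2 i = stride X i) ∧
          ψ.narr 2 (j + 1) = stride X j * s) (fun _ => 15) rfl (fun ψ hf => ?_) ?_ ?_).mono ?_
        · have h₁ : ψ.narr 1 = ω.narr 1 := (hf.narr 1 rfl).trans (by simp)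
          have h₂ : ψ.nreg 6 = j := (hf.nreg 6 rfl).trans hωj
          simp only [NExp.eval, h₁, h₂, g1]
        · refine ⟨fun i hi => ?_, by simp⟩
          simp only [Function.update_self]
          rw [Function.update_of_ne (by omega)]
          exact hJ i hi
        · rintro s hs ψ hfψ hψs ⟨hL, hL'⟩
          have h₂ : ψ.nreg 6 = j := (hfψ.nreg 6 rfl).trans hωj
          simp only [ends_nput, NExp.eval, NExp.steps, h₂, hL', hL j le_rfl, Function.update_self]
          refine ⟨by omega, fun i hi => ?_, by ring⟩
          rw [Function.update_of_ne (by omega)]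
          exact hL i hi
        · rintro t ψ - ⟨ht, hL, hL'⟩
          simp only [Finset.sum_const, Finset.card_range, smul_eq_mul, NExp.steps] at ht ⊢
          refine ⟨by omega, fun i hi => ?_⟩
          rcases Nat.le_succ_iff.1 hi with hi | rfl
          · exact hL i hi
          · rw [hL', stride_succ]
      · rintro t₃ ω hfω ⟨ht₃, hJ⟩
        have g15 : ω.nreg 15 = k + 2 := (hfω.nreg 15 rfl).trans (by simp)
        have g1 : ω.narr 1 = Function.update (Function.update (υ.narr 1) 0 (offs X k)) 1
            ((maxLength X - 1) * k + 1) := (hfω.narr 1 rfl).trans (by simp)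
        have g4 : ω.narr 4 = υ.narr 4 := (hfω.narr 4 rfl).trans (by simp)
        have g3 : ω.narr 3 = υ.narr 3 := (hfω.narr 3 rfl).trans (by simp)
        have g0 : ω.nreg 0 = k := (hfω.nreg 0 rfl).trans (by simp [f0])
        have g2 : ω.nreg 2 = offs X k := (hfω.nreg 2 rfl).trans (by simp [f2])
        have gr : ω.rreg 0 = c := (hfω.rreg 0 rfl).trans fr
        have gp : ω.rarr 0 = pts X := (hfω.rarr 0 rfl).trans fp
        rw [g15, hJ _ le_rfl]
        refine ⟨?_, ⟨?_, ?_, ?_, ?_, gr, ?_, hJ, ?_, gp⟩, ?_⟩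
        · simp only [Finset.sum_const, Finset.card_range, smul_eq_mul, NExp.steps,
            Finset.sum_add_distrib, ← Finset.mul_sum] at ht₁ ht₂ ht₃ ⊢
          omega
        · simpa using g0
        · simpa using g2
        · simp
        · simpa using g15
        · intro i hi
          rw [g1]
          exact hrad i hi
        · intro i hi
          rw [g4, f4]
          exact (hI i hi).1
        · intro i
          rw [g3, f3]
          exact ed i

/-! ### The main theorem -/

/-- The program that computes the table and a mean. -/
def meanProgram : Program := setup ;; fillTable ;; selectBest ;; traceback

/-- A value occurring several times among the points has several indices, hence several cells for
the same entry; one index is chosen for each value. The map is injective because the index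
determines the value. -/
theorem Done.holdsTable {σ : Memory} (h : Done X c (stride X (k + 2)) σ) : HoldsTable c X σ := by
  classical
  let D : (Fin k → ℕ) × ℕ × ℝ → ℕ → ℕ := fun e i => match i with
    | 0 => if hv : ∃ j < offs X k, pts X j = e.2.2 then hv.choose else 0
    | 1 => e.2.1 - 1
    | i + 2 => if hi : i < k then e.1 ⟨i, hi⟩ - 1 else 0
  have hval : ∀ e ∈ tableIndices X, D e 0 < offs X k ∧ pts X (D e 0) = e.2.2 := fun e he => by
    have hv := mem_values_iff.1 he.2.2
    simp only [D, dif_pos hv]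
    exact hv.choose_spec
  have hvalid : ∀ e ∈ tableIndices X, Valid X (D e) := fun e he i hi => by
    match i with
    | 0 => exact (hval e he).1
    | 1 =>
      have := he.2.1
      change e.2.1 - 1 < (maxLength X - 1) * k + 1
      omega
    | i + 2 =>
      have hik : i < k := by omega
      have h₁ := he.1 ⟨i, hik⟩
      have h₂ := lens_fin (X := X) ⟨i, hik⟩
      simp only [D, dif_pos hik]
      change _ < lens X i
      simp only at h₂
      omega
  have hpos : ∀ e ∈ tableIndices X, pos k (D e) = e.1 := fun e he => funext fun i => by
    have := he.1 i
    simp only [pos, D, dif_pos i.2, Fin.eta]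
    omega
  have hℓ : ∀ e ∈ tableIndices X, D e 1 + 1 = e.2.1 := fun e he => by
    have := he.2.1
    simp only [D]
    omega
  refine ⟨fun e => adr X (D e), fun e he f hf hef => ?_, fun e he => ?_⟩
  · have hDD := adr_inj (hvalid e he) (hvalid f hf) hef
    refine Prod.ext ?_ (Prod.ext ?_ ?_)
    · rw [← hpos e he, ← hpos f hf, pos_congr hDD]
    · rw [← hℓ e he, ← hℓ f hf, hDD 1 (by omega)]
    · rw [← (hval e he).2, ← (hval f hf).2, hDD 0 (by omega)]
  · rw [(h _ (hvalid e he) (adr_lt (hvalid e he))).1, entry, hpos e he, hℓ e he, (hval e he).2]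

/-! ### The running time -/

theorem offs_le {n : ℕ} (hn : ∀ i, (X i).1.length ≤ n) : offs X k ≤ n * k := by
  refine (Finset.sum_le_sum (g := fun _ => n) fun i hi => ?_).trans (by simp [mul_comm])
  have := hn ⟨i, Finset.mem_range.1 hi⟩
  rwa [← lens_fin] at this

/-- The value and length radices are at most `n * k` each, and each of the `k` position radices is
at most `n`. -/
theorem stride_le {n : ℕ} (hk : 1 ≤ k) (hn : ∀ i, (X i).1.length ≤ n) :
    stride X (k + 2) ≤ n ^ (k + 2) * k ^ 2 := by
  have hn1 : 1 ≤ n := (one_le_length ⟨0, hk⟩).trans (hn ⟨0, hk⟩)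
  have hN : (maxLength X - 1) * k + 1 ≤ n * k := by
    have h₁ : maxLength X ≤ n := Finset.sup_le fun i _ => hn i
    obtain ⟨q, rfl⟩ := Nat.exists_eq_add_of_le hn1
    have h₂ : (maxLength X - 1) * k ≤ q * k := Nat.mul_le_mul_right _ (by omega)
    rw [Nat.add_mul, one_mul]
    omega
  have hgen : ∀ j ≤ k, stride X (j + 2) ≤ n ^ j * ((n * k) * (n * k)) := by
    intro j
    induction j with
    | zero =>
      intro _
      rw [pow_zero, one_mul, zero_add, stride_two]
      exact Nat.mul_le_mul (offs_le hn) hN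
    | succ j ih =>
      intro hj
      rw [show j + 1 + 2 = j + 2 + 1 from rfl, stride_succ, pow_succ]
      have h₁ : rad X (j + 2) ≤ n := by
        have := hn ⟨j, by omega⟩
        rwa [← lens_fin] at this
      calc stride X (j + 2) * rad X (j + 2) ≤ n ^ j * ((n * k) * (n * k)) * n :=
            Nat.mul_le_mul (ih (by omega)) h₁
        _ = n ^ j * n * ((n * k) * (n * k)) := by ring
  refine (hgen k le_rfl).trans_eq ?_
  ring

theorem sum_rad (X : Fin k → TimeSeries) : ∑ i ∈ Finset.range (k + 2), rad X i =
    2 * offs X k + ((maxLength X - 1) * k + 1) := by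
  rw [Finset.sum_range_succ', Finset.sum_range_succ']
  simp only [rad, two_mul]
  unfold offs
  omega

theorem ends_meanProgram (hk : 1 ≤ k) (hc : 0 ≤ c) {n : ℕ} (hn : ∀ i, (X i).1.length ≤ n) :
    Ends meanProgram (input c X) fun t τ => t ≤ 3000 * (n ^ (k + 3) * 2 ^ k * k ^ 3) ∧
      ∃ m : TimeSeries, HoldsTable c X τ ∧ output τ = m.1 ∧ IsMean c X m ∧
        ((totalDist c X m : ℝ) : EReal) = tableOptimum c X := by
  rw [meanProgram, ends_seq]
  refine (ends_setup c X).mono ?_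
  rintro t₁ σ₁ - ⟨ht₁, hs₁, hd₁⟩
  rw [ends_seq]
  refine (ends_fillTable hk hs₁ hd₁).mono ?_
  rintro t₂ σ₂ hf₂ ⟨ht₂, hdone₂⟩
  have hs₂ := hs₁.frame hf₂ rfl
  rw [ends_seq]
  refine (ends_selectBest hk hs₂ hdone₂).mono ?_
  rintro t₃ σ₃ hf₃ ⟨ht₃, d, hd, h12, hpos, hopt⟩
  have hs₃ := hs₂.frame hf₃ rfl
  have hdone₃ := hdone₂.congr (hf₃.rarr 2 rfl) (hf₃.narr 6 rfl) (hf₃.narr 7 rfl) (hf₃.narr 8 rfl)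
  refine (ends_traceback hk hs₃ hdone₃ hd h12).mono ?_
  rintro t₄ σ₄ hf₄ ⟨ht₄, h1, hreal⟩
  have hdone₄ := hdone₃.congr (hf₄.rarr 2 rfl) (hf₄.narr 6 rfl) (hf₄.narr 7 rfl) (hf₄.narr 8 rfl)
  have hout : output σ₄ ≠ [] := by simp [output, h1]
  rw [hpos, hf₃.rarr 2 rfl] at hreal
  obtain ⟨hmean, htot⟩ := hreal.isMean hk hc hopt ⟨output σ₄, hout⟩ (by simp only [output, h1])
  refine ⟨?_, ⟨output σ₄, hout⟩, hdone₄.holdsTable, rfl, hmean, htot⟩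
  have hM := offs_pos (X := X) hk
  have h2k := Nat.lt_two_pow_self (n := k)
  have hst := stride_pos (X := X) hk le_rfl
  -- The cost of filling the table, up to a constant. All other phases are linear in quantities
  -- bounded by `U`.
  obtain ⟨U, hU⟩ : ∃ U, U = stride X (k + 2) * (offs X k * 2 ^ k) := ⟨_, rfl⟩
  have hle₁ : stride X (k + 2) ≤ U := hU ▸ Nat.le_mul_of_pos_right _ (by positivity)
  have hle₂ : offs X k * 2 ^ k ≤ U := hU ▸ Nat.le_mul_of_pos_left _ hst
  have hle₃ : offs X k ≤ offs X k * 2 ^ k := Nat.le_mul_of_pos_right _ (by omega)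
  have hle₄ : 2 ^ k ≤ offs X k * 2 ^ k := Nat.le_mul_of_pos_left _ hM
  have hle₅ : (maxLength X - 1) * k + 1 ≤ stride X (k + 2) :=
    (Nat.le_mul_of_pos_left _ hM).trans (stride_two.symm.le.trans stride_two_le)
  have hUW : U ≤ n ^ (k + 3) * 2 ^ k * k ^ 3 := by
    calc U ≤ n ^ (k + 2) * k ^ 2 * (n * k * 2 ^ k) := by
          rw [hU]
          exact Nat.mul_le_mul (stride_le hk hn) (Nat.mul_le_mul_right _ (offs_le hn))
      _ = n ^ (k + 3) * 2 ^ k * k ^ 3 := by ring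
  rw [sum_rad] at ht₁
  omega

end MSM

theorem mainTheorem2 :
    ∃ (P : MSM.Program) (K : ℕ),
      ∀ (k n : ℕ) (X : Fin k → MSM.TimeSeries) (c : ℝ),
        1 ≤ k → (∀ i, (X i).1.length ≤ n) → 0 ≤ c →
        ∃ (t : ℕ) (τ : MSM.Memory) (m : MSM.TimeSeries),
          MSM.Runs P (MSM.input c X) t τ ∧
          t ≤ K * (n ^ (k + 3) * 2 ^ k * k ^ 3) ∧
          MSM.HoldsTable c X τ ∧
          MSM.output τ = m.1 ∧
          MSM.IsMean c X m ∧
          ((MSM.totalDist c X m : ℝ) : EReal) = MSM.tableOptimum c X := by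
  refine ⟨MSM.meanProgram, 3000, fun k n X c hk hn hc => ?_⟩
  obtain ⟨t, τ, hr, ht, m, h⟩ := MSM.ends_meanProgram hk hc hn
  exact ⟨t, τ, m, hr, ht, h⟩
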